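/- **Setting.** Let $n\ge 1$ and let $\mathfrak g=\mathfrak{osp}(1|2n)$ be the complex Lie superalgebra generated by odd elements $B_j^{+},B_j^-$ ($1\le j\le n$) with relations $$[\{B_i^\xi,B_j^\eta\},B_l^\epsilon]=(\epsilon-\eta)\delta_{jl}B_i^\xi+(\epsilon-\xi)\delta_{il}B_j^\eta\qquad(\xi,\eta,\epsilon\in\{+,-\}=\{1,-1\}).$$ The elements $E_{ij}=\tfrac12\{B_i^+,B_j^-\}$ span $\mathfrak t=\mathfrak{gl}(n)$; let $\mathfrak h=\operatorname{span}\{E_{ii}\}$, $\mathfrak t^+=\operatorname{span}\{E_{ij}:i<j\}$, $h_i=E_{ii}-i+1$. Let $R(\mathfrak h)$ be the field of fractions of $U(\mathfrak h)$, $U'(\mathfrak g)=U(\mathfrak g)\otimes_{U(\mathfrak h)}R(\mathfrak h)$ (the localization of $U(\mathfrak g)$ at $U(\mathfrak h)\setminus\{0\}$), $\mathfrak J'=U'(\mathfrak g)\mathfrak t^+$, $M'=U'(\mathfrak g)/\mathfrak J'$, and let $Z(\mathfrak g,\mathfrak t)=(\operatorname{Norm}\mathfrak J')/\mathfrak J'\subset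 M'$, with $\operatorname{Norm}\mathfrak J'=\{v\in U'(\mathfrak g):\mathfrak J'v\subset\mathfrak J'\}$, be the Mickelsson–Zhelobenko algebra. The extremal projector of $\mathfrak t$, acting on $M'$ (where each series is locally finite), is $$\mathbf p=\mathbf p_{12}\,\mathbf p_{13}\mathbf p_{23}\cdots\mathbf p_{1n}\cdots\mathbf p_{n-1,n},\qquad \mathbf p_{ij}=\sum_{k\ge0}\frac{(-1)^k}{k!}E_{ji}^kE_{ij}^k\frac1{(h_i-h_j+1)_k},$$ with $(x)_k=x(x+1)\cdots(x+k-1)$; for $u\in U(\mathfrak g)$, $\mathbf pu$ denotes $\mathbf p$ applied to the class of $u$ in $M'$. For $i\le j$ let $\mathcal I_{ij}(s)$ be the set of sequences $I=(i_1,\dots,i_s)$ with $i=i_1<\dots<i_s=j$, let $I^\complement=\{i,\dots,j\}\setminus I$, and let $e_I=\sum_{u=1}^{s-1}e_{i_{u+1},i_u}$ (a sum of matrix units). For an $n\times n$ matrix $\gamma$ with entries in $\mathbb N_0$ put $E^\gamma=\prod_{k=2,\dots,n}^{\rightarrow}\big(E_{k1}^{\gamma_{k1}}\cdots E_{k,k-1}^{\gamma_{k,k-1}}\big)$,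 with $k$ increasing from left to right; thus $E^{e_I}=E_{i_2i_1}\cdots E_{i_si_{s-1}}$. **Theorem.** The elements $\mathbf pB_j^\pm$ ($1\le j\le n$) and $\mathbf p\{B_i^\pm,B_j^\pm\}$ ($1\le i\le j\le n$) belong to $Z(\mathfrak g,\mathfrak t)$. For $1\le j\le n$ the following identities hold modulo $\mathfrak J'$: $$\mathbf pB_j^+=\sum_{i=1}^{j}\sum_{s=1}^{j-i+1}\sum_{I\in\mathcal I_{ij}(s)}(-1)^{s-1}E^{e_I}B_i^+\,\frac{\prod_{\ell\in I^\complement}(h_\ell-h_j-1)}{\prod_{\ell=i}^{j-1}(h_\ell-h_j)},$$ $$\mathbf pB_j^-=\sum_{i=j}^{n}\sum_{s=1}^{i-j+1}\sum_{I\in\mathcal I_{ji}(s)}E^{e_I}B_i^-\,\frac{1}{\prod_{\ell\in I,\,\ell\ne j}(h_j-h_\ell)}.$$ Moreover there exist $H_{IJ}^\pm\in R(\mathfrak h)$ such that, for all $1\le i\le j\le n$, modulo $\mathfrak J'$, $$\mathbf p\{B_i^+,B_j^+\}=\sum_{k=1}^{i}\sum_{s=1}^{i-k+1}\sum_{I\in\mathcal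 I_{ki}(s)}\;\sum_{l=1}^{j}\sum_{t=1}^{j-l+1}\sum_{J\in\mathcal I_{lj}(t)}E^{e_I+e_J}\{B_k^+,B_l^+\}H_{IJ}^+,$$ $$\mathbf p\{B_i^-,B_j^-\}=\sum_{k=i}^{n}\sum_{s=1}^{k-i+1}\sum_{I\in\mathcal I_{ik}(s)}\;\sum_{l=j}^{n}\sum_{t=1}^{l-j+1}\sum_{J\in\mathcal I_{jl}(t)}E^{e_I+e_J}\{B_k^-,B_l^-\}H_{IJ}^-.$$ -/

import Mathlib

namespace OspGl

open OreLocalization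

noncomputable section

/-- The sign `+` (`true`) or `-` (`false`) as a complex number. -/
def sgn : Bool → ℂ
  | true => 1
  | false => -1

/-- The anticommutator. -/
def acomm {R : Type*} [Ring R] (x y : R) : R := x * y + y * x

/-- The defining relations `[{B_i^ξ, B_j^η}, B_l^ε] = (ε - η) δ_jl B_i^ξ + (ε - ξ) δ_il B_j^η` of
`osp(1|2n)` (brackets of the odd generators are anticommutators, brackets of an even with an odd
element are commutators). -/
inductive Rel (n : ℕ) : FreeAlgebra ℂ (Fin n × Bool) → FreeAlgebra ℂ (Fin n × Bool) → Prop
  | triple (i j l : Fin n) (ξ η ε : Bool) :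
      Rel n
        (acomm (FreeAlgebra.ι ℂ (i, ξ)) (FreeAlgebra.ι ℂ (j, η)) * FreeAlgebra.ι ℂ (l, ε)
          - FreeAlgebra.ι ℂ (l, ε) * acomm (FreeAlgebra.ι ℂ (i, ξ)) (FreeAlgebra.ι ℂ (j, η)))
        (((sgn ε - sgn η) * (if j = l then 1 else 0)) • FreeAlgebra.ι ℂ (i, ξ)
          + ((sgn ε - sgn ξ) * (if i = l then 1 else 0)) • FreeAlgebra.ι ℂ (j, η))

/-- The universal enveloping algebra `U(osp(1|2n))`. As `osp(1|2n)` is the Lie superalgebra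
generated by the odd elements `B_j^±` subject to `Rel`, its enveloping algebra is the associative
algebra with the same generators and relations. -/
abbrev U (n : ℕ) : Type := RingQuot (Rel n)

/-- The generators `B_j^ε`. -/
def B {n : ℕ} (ε : Bool) (j : Fin n) : U n :=
  RingQuot.mkAlgHom ℂ (Rel n) (FreeAlgebra.ι ℂ (j, ε))

/-- The basis `E_ij = ½ {B_i^+, B_j^-}` of the subalgebra `gl(n)`. -/
def E {n : ℕ} (i j : Fin n) : U n := (1 / 2 : ℂ) • acomm (B true i) (B false j)

theorem B_rel {n : ℕ} (i j l : Fin n) (ξ η ε : Bool) :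
    acomm (B ξ i) (B η j) * B ε l - B ε l * acomm (B ξ i) (B η j)
      = ((sgn ε - sgn η) * (if j = l then 1 else 0)) • B ξ i
        + ((sgn ε - sgn ξ) * (if i = l then 1 else 0)) • B η j := by
  have h := RingQuot.mkAlgHom_rel ℂ (Rel.triple i j l ξ η ε)
  rw [map_sub, map_mul, map_mul, map_add, map_smul, map_smul] at h
  simpa only [acomm, B, map_add, map_mul] using h

/-- `u` has weight `w` with respect to the Cartan subalgebra spanned by the `E_ii`. -/
def HasWt {n : ℕ} (w : Fin n → ℂ) (u : U n) : Prop :=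
  ∀ i, E i i * u = u * E i i + w i • u

theorem hasWt_B {n : ℕ} (ε : Bool) (l : Fin n) :
    HasWt (fun i => if i = l then sgn ε else 0) (B ε l) := by
  intro i
  have h := B_rel i i l true false ε
  rw [← sub_eq_iff_eq_add']
  have : E i i * B ε l - B ε l * E i i
      = (1 / 2 : ℂ) • (acomm (B true i) (B false i) * B ε l
        - B ε l * acomm (B true i) (B false i)) := by
    simp [E, smul_sub]
  rw [this, h]
  by_cases hi : i = l
  · subst hi
    cases ε
    · simp only [sgn, sub_self, ↓reduceIte, mul_one, zero_smul, zero_add, smul_smul]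
      norm_num
      module
    · simp only [sgn, sub_self, ↓reduceIte, mul_one, zero_smul, add_zero, smul_smul]
      norm_num
  · simp [hi]

theorem HasWt.mul {n : ℕ} {w w' : Fin n → ℂ} {u u' : U n} (h : HasWt w u) (h' : HasWt w' u') :
    HasWt (w + w') (u * u') := by
  intro i
  rw [← mul_assoc, h i, add_mul, mul_assoc, h' i]
  simp [mul_add, add_smul, mul_assoc]
  abel

theorem HasWt.add {n : ℕ} {w : Fin n → ℂ} {u u' : U n} (h : HasWt w u) (h' : HasWt w u') :
    HasWt w (u + u') := by
  intro i
  rw [mul_add, h i, h' i, add_mul, smul_add]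
  abel

theorem HasWt.smul {n : ℕ} {w : Fin n → ℂ} {u : U n} (c : ℂ) (h : HasWt w u) :
    HasWt w (c • u) := by
  intro i
  rw [mul_smul_comm, h i, smul_add, smul_mul_assoc, smul_comm c]

theorem hasWt_E {n : ℕ} (j : Fin n) : HasWt 0 (E j j) := by
  have h1 := (hasWt_B true j).mul (hasWt_B false j)
  have h2 := (hasWt_B false j).mul (hasWt_B true j)
  have e1 : ((fun i => if i = j then sgn true else 0) + fun i => if i = j then sgn false else 0)
      = (0 : Fin n → ℂ) := by
    funext i; by_cases h : i = j <;> simp [h, sgn]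
  have e2 : ((fun i => if i = j then sgn false else 0) + fun i => if i = j then sgn true else 0)
      = (0 : Fin n → ℂ) := by
    funext i; by_cases h : i = j <;> simp [h, sgn]
  rw [e1] at h1
  rw [e2] at h2
  exact (h1.add h2).smul _

theorem E_comm {n : ℕ} (i j : Fin n) : E i i * E j j = E j j * E i i := by
  simpa using hasWt_E j i

/-- `U(h)`: the enveloping algebra of the abelian Lie algebra `h` with basis `E_11, …, E_nn`, that
is, the polynomial ring in these elements (`X i` stands for `E_ii`). -/
abbrev Uh (n : ℕ) : Type := MvPolynomial (Fin n) ℂ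

/-- `R(h)`, the field of fractions of `U(h)`. -/
abbrev Rh (n : ℕ) : Type := FractionRing (Uh n)

open scoped IsMulCommutative in
/-- The canonical homomorphism `U(h) → U(osp(1|2n))`, `X i ↦ E_ii`. -/
def cartan (n : ℕ) : Uh n →ₐ[ℂ] U n :=
  haveI : IsMulCommutative (Algebra.adjoin ℂ (Set.range fun i : Fin n => (E i i : U n))) :=
    Algebra.isMulCommutative_adjoin ℂ (by
      rintro _ ⟨i, rfl⟩ _ ⟨j, rfl⟩
      exact E_comm i j)
  (Algebra.adjoin ℂ (Set.range fun i : Fin n => (E i i : U n))).val.comp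
    (MvPolynomial.aeval fun i => ⟨E i i, Algebra.subset_adjoin ⟨i, rfl⟩⟩)

theorem cartan_X {n : ℕ} (i : Fin n) : cartan n (MvPolynomial.X i) = E i i := by
  simp [cartan]

/-- The translation `X i ↦ X i + w i` of `U(h)`. -/
def shift {n : ℕ} (w : Fin n → ℂ) : Uh n →ₐ[ℂ] Uh n :=
  MvPolynomial.aeval fun i => MvPolynomial.X i + MvPolynomial.C (w i)

theorem shift_shift_neg {n : ℕ} (w : Fin n → ℂ) (f : Uh n) : shift w (shift (-w) f) = f := by
  have : (shift w).comp (shift (-w)) = AlgHom.id ℂ (Uh n) := by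
    ext i
    simp [shift]
  exact DFunLike.congr_fun this f

theorem shift_neg_shift {n : ℕ} (w : Fin n → ℂ) (f : Uh n) : shift (-w) (shift w f) = f := by
  simpa using shift_shift_neg (-w) f

theorem shift_ne_zero {n : ℕ} (w : Fin n → ℂ) {f : Uh n} (hf : f ≠ 0) : shift w f ≠ 0 := by
  intro h
  apply hf
  rw [← shift_neg_shift w f, h, map_zero]

theorem HasWt.cartan_mul {n : ℕ} {w : Fin n → ℂ} {u : U n} (h : HasWt w u) (f : Uh n) :
    cartan n f * u = u * cartan n (shift w f) := by
  induction f using MvPolynomial.induction_on with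
  | C a =>
    have h1 : cartan n (MvPolynomial.C a) = algebraMap ℂ (U n) a := (cartan n).commutes a
    have h2 : shift w (MvPolynomial.C a) = MvPolynomial.C a := (shift w).commutes a
    rw [h2, h1, Algebra.commutes]
  | add p q hp hq => simp [add_mul, mul_add, hp, hq]
  | mul_X p i hp =>
    have h1 : cartan n (MvPolynomial.C (w i)) = algebraMap ℂ (U n) (w i) := (cartan n).commutes _
    have h3 : shift w (MvPolynomial.X i) = MvPolynomial.X i + MvPolynomial.C (w i) := by
      simp [shift]
    have h2 : E i i * u = u * (E i i + algebraMap ℂ (U n) (w i)) := by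
      rw [h i, mul_add, ← Algebra.commutes, Algebra.smul_def]
    rw [map_mul, map_mul, map_mul, h3, map_add, cartan_X, h1, mul_assoc, h2, ← mul_assoc, hp,
      mul_assoc]

/-- The image of `U(h) ∖ {0}` in `U(osp(1|2n))`. -/
def S (n : ℕ) : Submonoid (U n) := (nonZeroDivisors (Uh n)).map (cartan n)

theorem cartan_mem_S {n : ℕ} {f : Uh n} (hf : f ≠ 0) : cartan n f ∈ S n :=
  ⟨f, mem_nonZeroDivisors_of_ne_zero hf, rfl⟩

theorem mem_S {n : ℕ} {x : U n} : x ∈ S n ↔ ∃ f : Uh n, f ≠ 0 ∧ cartan n f = x := by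
  constructor
  · rintro ⟨f, hf, rfl⟩
    exact ⟨f, nonZeroDivisors.ne_zero hf, rfl⟩
  · rintro ⟨f, hf, rfl⟩
    exact cartan_mem_S hf

theorem U_induction {n : ℕ} {P : U n → Prop} (hB : ∀ ε j, P (B ε j))
    (hc : ∀ c : ℂ, P (algebraMap ℂ (U n) c)) (ha : ∀ x y, P x → P y → P (x + y))
    (hm : ∀ x y, P x → P y → P (x * y)) (x : U n) : P x := by
  obtain ⟨y, rfl⟩ := RingQuot.mkAlgHom_surjective ℂ (Rel n) x
  induction y using FreeAlgebra.induction with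
  | grade0 r => simpa using hc r
  | grade1 x => exact hB x.2 x.1
  | mul a b h1 h2 => rw [map_mul]; exact hm _ _ h1 h2
  | add a b h1 h2 => rw [map_add]; exact ha _ _ h1 h2

theorem ore_exists {n : ℕ} (r : U n) : ∀ s : Uh n, s ≠ 0 →
    ∃ (t : Uh n) (r' : U n), t ≠ 0 ∧ cartan n t * r = r' * cartan n s := by
  induction r using U_induction with
  | hB ε j =>
    intro s hs
    refine ⟨_, B ε j, shift_ne_zero (-fun i => if i = j then sgn ε else 0) hs, ?_⟩
    rw [(hasWt_B ε j).cartan_mul, shift_shift_neg]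
  | hc c => exact fun s hs => ⟨s, algebraMap ℂ _ c, hs, (Algebra.commutes c _).symm⟩
  | ha x y hx hy =>
    intro s hs
    obtain ⟨t, x', ht, hx'⟩ := hx s hs
    obtain ⟨t', y', ht', hy'⟩ := hy s hs
    refine ⟨t * t', cartan n t' * x' + cartan n t * y', mul_ne_zero ht ht', ?_⟩
    rw [mul_add, add_mul, mul_assoc (cartan n t), ← hy', mul_assoc, ← hx', ← mul_assoc,
      ← mul_assoc, ← map_mul, ← map_mul, mul_comm t']
  | hm x y hx hy =>
    intro s hs
    obtain ⟨t', y', ht', hy'⟩ := hy s hs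
    obtain ⟨t, x', ht, hx'⟩ := hx t' ht'
    exact ⟨t, x' * y', ht, by rw [← mul_assoc, hx', mul_assoc, hy', mul_assoc]⟩

/-- The weight space of weight `w`. -/
def wtSpace {n : ℕ} (w : Fin n → ℂ) : Submodule ℂ (U n) where
  carrier := {u | HasWt w u}
  add_mem' h h' := h.add h'
  zero_mem' := by intro i; simp
  smul_mem' c _ h := h.smul c

theorem iSup_wtSpace {n : ℕ} (r : U n) : r ∈ ⨆ w : Fin n → ℂ, wtSpace w := by
  induction r using U_induction with
  | hB ε j => exact Submodule.mem_iSup_of_mem _ (hasWt_B ε j)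
  | hc c =>
    refine Submodule.mem_iSup_of_mem 0 ?_
    intro i
    simp [Algebra.commutes]
  | ha x y hx hy => exact Submodule.add_mem _ hx hy
  | hm x y hx hy =>
    induction hx using Submodule.iSup_induction' with
    | mem w x hx =>
      induction hy using Submodule.iSup_induction' with
      | mem w' y hy => exact Submodule.mem_iSup_of_mem (w + w') (HasWt.mul hx hy)
      | zero => simp
      | add y y' _ _ h h' => rw [mul_add]; exact Submodule.add_mem _ h h'
    | zero => simp
    | add x x' _ _ h h' => rw [add_mul]; exact Submodule.add_mem _ h h'

theorem wt_indep {n : ℕ} (F : Finset (Fin n → ℂ)) : ∀ g : (Fin n → ℂ) → U n,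
    (∀ w ∈ F, HasWt w (g w)) → ∑ w ∈ F, g w = 0 → ∀ w ∈ F, g w = 0 := by
  classical
  induction F using Finset.induction_on with
  | empty => simp
  | insert a F ha ih =>
    intro g hg hs
    have key : ∀ w ∈ F, g w = 0 := by
      intro w hw
      have hne : w ≠ a := fun h => ha (h ▸ hw)
      obtain ⟨i, hi⟩ := Function.ne_iff.mp hne
      have h0 := ih (fun w => (w i - a i) • g w)
        (fun w hw => (hg w (Finset.mem_insert_of_mem hw)).smul _) (by
          have e : ∑ w ∈ insert a F, (w i - a i) • g w = 0 := by
            have e1 : ∀ w ∈ insert a F,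
                (w i - a i) • g w = E i i * g w - g w * E i i - a i • g w := by
              intro w hw
              rw [hg w hw i]
              module
            rw [Finset.sum_congr rfl e1, Finset.sum_sub_distrib, Finset.sum_sub_distrib,
              ← Finset.mul_sum, ← Finset.sum_mul, ← Finset.smul_sum, hs]
            simp
          rwa [Finset.sum_insert ha, sub_self, zero_smul, zero_add] at e) w hw
      exact (smul_eq_zero.mp h0).resolve_left (sub_ne_zero.mpr hi)
    intro w hw
    rcases Finset.mem_insert.mp hw with rfl | hw
    · rw [Finset.sum_insert ha, Finset.sum_eq_zero key, add_zero] at hs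
      exact hs
    · exact key w hw

theorem ore_cancel {n : ℕ} (r : U n) (s : Uh n) (hs : s ≠ 0) (h : r * cartan n s = 0) :
    ∃ t : Uh n, t ≠ 0 ∧ cartan n t * r = 0 := by
  classical
  obtain ⟨f, hf⟩ := (Submodule.mem_iSup_iff_exists_finsupp _ _).mp (iSup_wtSpace r)
  obtain ⟨hfw, hfr⟩ := hf
  have hz : ∀ w ∈ f.support, f w * cartan n s = 0 := by
    refine wt_indep f.support (fun w => f w * cartan n s) (fun w _ i => ?_) ?_
    · have hc : E i i * cartan n s = cartan n s * E i i := by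
        rw [← cartan_X, ← map_mul, mul_comm, map_mul]
      rw [← mul_assoc, (hfw w : HasWt w (f w)) i, add_mul, mul_assoc, hc, ← mul_assoc,
        smul_mul_assoc]
    · rw [← Finset.sum_mul]
      rw [Finsupp.sum] at hfr
      rw [hfr, h]
  refine ⟨∏ w ∈ f.support, shift (-w) s,
    Finset.prod_ne_zero_iff.mpr fun w _ => shift_ne_zero _ hs, ?_⟩
  rw [← hfr, Finsupp.sum, Finset.mul_sum]
  refine Finset.sum_eq_zero fun w hw => ?_
  have h1 : cartan n (shift (-w) s) * f w = 0 := by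
    rw [(hfw w : HasWt w (f w)).cartan_mul, shift_shift_neg, hz w hw]
  rw [← Finset.prod_erase_mul _ _ hw, map_mul, mul_assoc, h1, mul_zero]

/-- `U(h) ∖ {0}` satisfies the Ore conditions in `U(osp(1|2n))`. -/
instance instOreSet (n : ℕ) : OreSet (S n) where
  ore_right_cancel r₁ r₂ s h := by
    obtain ⟨f, hf, hfs⟩ := mem_S.mp s.2
    obtain ⟨t, ht, h0⟩ := ore_cancel (r₁ - r₂) f hf (by rw [hfs, sub_mul, h, sub_self])
    refine ⟨⟨cartan n t, cartan_mem_S ht⟩, ?_⟩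
    rw [mul_sub, sub_eq_zero] at h0
    exact h0
  oreNum r s := (ore_exists r _ (mem_S.mp s.2).choose_spec.1).choose_spec.choose
  oreDenom r s := ⟨cartan n (ore_exists r _ (mem_S.mp s.2).choose_spec.1).choose,
    cartan_mem_S (ore_exists r _ (mem_S.mp s.2).choose_spec.1).choose_spec.choose_spec.1⟩
  ore_eq r s := by
    have h := (ore_exists r _ (mem_S.mp s.2).choose_spec.1).choose_spec.choose_spec.2
    exact h.trans (congrArg _ (mem_S.mp s.2).choose_spec.2)

/-- `U'(g) = U(g) ⊗_{U(h)} R(h)`, the localization of `U(g)` at `U(h) ∖ {0}`. -/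
def U' (n : ℕ) : Type := OreLocalization (S n) (U n)

instance (n : ℕ) : Ring (U' n) := inferInstanceAs (Ring (OreLocalization (S n) (U n)))

instance (n : ℕ) : Algebra ℂ (U' n) := inferInstanceAs (Algebra ℂ (OreLocalization (S n) (U n)))

/-- The canonical homomorphism `U(g) → U'(g)`. -/
def ofU {n : ℕ} : U n →+* U' n :=
  (numeratorRingHom : U n →+* OreLocalization (S n) (U n))

theorem isUnit_ofU_cartan {n : ℕ} (s : nonZeroDivisors (Uh n)) :
    IsUnit (ofU (cartan n s)) :=
  (numeratorUnit (⟨cartan n s, s, s.2, rfl⟩ : S n)).isUnit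

/-- The canonical homomorphism `R(h) → U'(g)`, `f / s ↦ s⁻¹ f`. -/
def ofR {n : ℕ} : Rh n →+* U' n :=
  universalHom (S := nonZeroDivisors (Uh n)) (ofU.comp (cartan n).toRingHom)
    (IsUnit.liftRight (((ofU.comp (cartan n).toRingHom : Uh n →+* U' n) : Uh n →* U' n).comp
      (nonZeroDivisors (Uh n)).subtype) isUnit_ofU_cartan)
    (fun _ => rfl)

theorem ofR_algebraMap {n : ℕ} (f : Uh n) :
    ofR (algebraMap (Uh n) (Rh n) f) = ofU (cartan n f) :=
  universalHom_commutes (S := nonZeroDivisors (Uh n)) (ofU.comp (cartan n).toRingHom) _ _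

/-- The elements `h_i = E_ii - i + 1` of `R(h)`, for `i = 1, …, n`; the index `i : Fin n` counts
from `0`. -/
def h {n : ℕ} (i : Fin n) : Rh n := algebraMap (Uh n) (Rh n) (MvPolynomial.X i) - (i : ℕ)

/-- The left ideal `J' = U'(g) t^+`. -/
def J' (n : ℕ) : Submodule (U' n) (U' n) :=
  Submodule.span (U' n) {x | ∃ i j : Fin n, i < j ∧ x = ofU (E i j)}

/-- The left `U'(g)`-module `M'(g,t) = U'(g) / J'`. -/
abbrev M' (n : ℕ) : Type := U' n ⧸ J' n

/-- The class of an element of `U'(g)` modulo `J'`. -/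
def cls {n : ℕ} : U' n →ₗ[U' n] M' n := (J' n).mkQ

/-- The normalizer of `J'` in `U'(g)`. -/
def normJ' (n : ℕ) : Subalgebra ℂ (U' n) where
  carrier := {v | ∀ x ∈ J' n, x * v ∈ J' n}
  mul_mem' {v w} hv hw x hx := by rw [← mul_assoc]; exact hw _ (hv _ hx)
  add_mem' {v w} hv hw x hx := by rw [mul_add]; exact add_mem (hv _ hx) (hw _ hx)
  algebraMap_mem' c x hx := by
    rw [← Algebra.commutes]
    exact (J' n).smul_mem _ hx

/-- The Mickelsson-Zhelobenko algebra `Z(g,t) = Norm J' / J'`, inside `M'(g,t)`. -/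
def Z (n : ℕ) : Submodule ℂ (M' n) :=
  (normJ' n).toSubmodule.map (cls.restrictScalars ℂ)

/-- The operator on `M'(g,t)` given by the factor
`p_ij = ∑_k ((-1)^k / k!) E_ji^k E_ij^k (1 / (h_i - h_j + 1)_k)` of the extremal projector. -/
def pFactor {n : ℕ} (i j : Fin n) (m : M' n) : M' n :=
  ∑ᶠ k : ℕ, (((-1 : ℂ) ^ k / (k.factorial : ℂ)) •
    (ofU (E j i) ^ k * ofU (E i j) ^ k *
      ofR ((ascPochhammer (Rh n) k).eval (h i - h j + 1))⁻¹)) • m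

theorem E_B {n : ℕ} (i j l : Fin n) (ε : Bool) :
    E i j * B ε l = B ε l * E i j
      + (1 / 2 : ℂ) • (((sgn ε + 1) * (if j = l then 1 else 0)) • B true i
        + ((sgn ε - 1) * (if i = l then 1 else 0)) • B false j) := by
  have h := B_rel i j l true false ε
  rw [show sgn true = 1 from rfl, show sgn false = -1 from rfl, sub_neg_eq_add] at h
  rw [← h, E]
  simp [smul_sub]

theorem exists_comm {n : ℕ} {i j : Fin n} (hij : i ≠ j) (ε : Bool) (l : Fin n) :
    ∃ C : U n, E i j * B ε l = B ε l * E i j + C ∧ E i j * C = C * E i j := by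
  refine ⟨_, E_B i j l ε, ?_⟩
  have h1 := E_B i j i true
  have h2 := E_B i j j false
  simp only [sgn, hij, hij.symm] at h1 h2
  simp at h1 h2
  cases ε <;> simp [sgn, h1, h2]

theorem hasWt_E' {n : ℕ} (i j : Fin n) : ∃ w, HasWt w (E i j : U n) := by
  have h1 := (hasWt_B true i).mul (hasWt_B false j)
  have h2 := (hasWt_B false j).mul (hasWt_B true i)
  rw [add_comm] at h2
  exact ⟨_, (h1.add h2).smul _⟩

theorem hasWt_pow {n : ℕ} {w : Fin n → ℂ} {u : U n} (h : HasWt w u) (k : ℕ) :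
    ∃ w', HasWt w' (u ^ k) := by
  induction k with
  | zero => exact ⟨0, fun i => by simp⟩
  | succ k ih =>
    obtain ⟨w', h'⟩ := ih
    exact ⟨_, by rw [pow_succ]; exact h'.mul h⟩

/-- Elements of `R(h)` can be moved across weight vectors. -/
theorem exists_ofR_swap {n : ℕ} {w : Fin n → ℂ} {u : U n} (hu : HasWt w u) (q : Rh n) :
    ∃ q' : Rh n, ofU u * ofR q = ofR q' * ofU u := by
  have key : ∀ f : Uh n, ofU u * ofR (algebraMap _ (Rh n) f)
      = ofR (algebraMap _ (Rh n) (shift (-w) f)) * ofU u := by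
    intro f
    rw [ofR_algebraMap, ofR_algebraMap, ← map_mul, ← map_mul, hu.cartan_mul, shift_shift_neg]
  obtain ⟨f, s, hs, rfl⟩ := IsFractionRing.div_surjective (A := Uh n) q
  have hs0 : s ≠ 0 := nonZeroDivisors.ne_zero hs
  have hne : ∀ {s : Uh n}, s ≠ 0 → algebraMap _ (Rh n) s ≠ 0 := fun hs =>
    (map_ne_zero_iff _ (IsFractionRing.injective (Uh n) (Rh n))).mpr hs
  have h1 : ofU u * ofR (algebraMap _ (Rh n) s)⁻¹
      = ofR (algebraMap _ (Rh n) (shift (-w) s))⁻¹ * ofU u := by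
    have a1 : ofR (algebraMap _ (Rh n) (shift (-w) s))⁻¹
        * ofR (algebraMap _ (Rh n) (shift (-w) s)) = 1 := by
      rw [← map_mul, inv_mul_cancel₀ (hne (shift_ne_zero _ hs0)), map_one]
    have a2 : ofR (algebraMap _ (Rh n) s) * ofR (algebraMap _ (Rh n) s)⁻¹ = 1 := by
      rw [← map_mul, mul_inv_cancel₀ (hne hs0), map_one]
    calc ofU u * ofR (algebraMap _ (Rh n) s)⁻¹
        = ofR (algebraMap _ (Rh n) (shift (-w) s))⁻¹
            * (ofR (algebraMap _ (Rh n) (shift (-w) s)) * ofU u)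
            * ofR (algebraMap _ (Rh n) s)⁻¹ := by rw [← mul_assoc, a1, one_mul]
      _ = _ := by rw [← key, mul_assoc, mul_assoc, a2, mul_one]
  refine ⟨algebraMap _ (Rh n) (shift (-w) f) * (algebraMap _ (Rh n) (shift (-w) s))⁻¹, ?_⟩
  rw [div_eq_mul_inv, map_mul, ← mul_assoc, key, mul_assoc, h1, map_mul, mul_assoc]

theorem U'_eq {n : ℕ} (x : U' n) : ∃ (q : Rh n) (u : U n), x = ofR q * ofU u := by
  induction x using OreLocalization.ind with
  | _ r s =>
    obtain ⟨f, hf, hfs⟩ := mem_S.mp s.2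
    refine ⟨(algebraMap _ (Rh n) f)⁻¹, r, ?_⟩
    have hne : algebraMap _ (Rh n) f ≠ 0 :=
      (map_ne_zero_iff _ (IsFractionRing.injective (Uh n) (Rh n))).mpr hf
    have h1 : ofU (s : U n) * (show U' n from r /ₒ s) = ofU r :=
      OreLocalization.mul_cancel
    change (show U' n from r /ₒ s) = _
    rw [← h1, ← hfs, ← ofR_algebraMap, ← mul_assoc, ← map_mul, inv_mul_cancel₀ hne, map_one,
      one_mul]

theorem E_locally_nilpotent {n : ℕ} {i j : Fin n} (hij : i < j) (m : M' n) :
    ∃ K : ℕ, ofU (E i j) ^ K • m = 0 := by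
  obtain ⟨w, hw⟩ := hasWt_E' i j
  have hB : ∀ u : U n, ∀ m : M' n, (∃ K : ℕ, ofU (E i j) ^ K • m = 0) →
      ∃ K : ℕ, ofU (E i j) ^ K • (ofU u • m) = 0 := by
    intro u
    induction u using U_induction with
    | hB ε l =>
      rintro m ⟨K, hK⟩
      obtain ⟨C, hC, hC'⟩ := exists_comm hij.ne ε l
      have hCk : ∀ k : ℕ, E i j ^ k * C = C * E i j ^ k := fun k =>
        ((show Commute (E i j) C from hC').pow_left k).eq
      have hk : ∀ k : ℕ, E i j ^ (k + 1) * B ε l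
          = B ε l * E i j ^ (k + 1) + ((k + 1 : ℕ) : U n) * C * E i j ^ k := by
        intro k
        induction k with
        | zero => simp [hC]
        | succ k ih =>
          rw [pow_succ (E i j) (k + 1), mul_assoc, hC, mul_add, ← mul_assoc, ih, hCk, add_mul]
          push_cast
          noncomm_ring
      refine ⟨K + 1, ?_⟩
      rw [smul_smul, ← map_pow, ← map_mul, hk, map_add, map_mul, map_mul, map_pow, map_pow,
        add_smul, mul_smul, mul_smul, pow_succ', mul_smul, hK]
      simp
    | hc c =>
      rintro m ⟨K, hK⟩
      refine ⟨K, ?_⟩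
      rw [smul_smul, ← map_pow, ← map_mul, ← Algebra.commutes, map_mul, mul_smul, map_pow, hK,
        smul_zero]
    | ha x y hx hy =>
      intro m hm
      obtain ⟨K, hK⟩ := hx m hm
      obtain ⟨L, hL⟩ := hy m hm
      refine ⟨K + L, ?_⟩
      rw [map_add, add_smul, smul_add]
      nth_rw 1 [add_comm K L]
      rw [pow_add, pow_add, mul_smul, mul_smul, hK, hL, smul_zero, smul_zero, add_zero]
    | hm x y hx hy =>
      intro m hm
      rw [map_mul, mul_smul]
      exact hx _ (hy m hm)
  obtain ⟨x, rfl⟩ := (J' n).mkQ_surjective m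
  obtain ⟨q, u, rfl⟩ := U'_eq x
  obtain ⟨K, hK⟩ := hB u ((J' n).mkQ 1) ⟨1, by
    rw [pow_one, ← map_smul, smul_eq_mul, mul_one]
    exact (Submodule.Quotient.mk_eq_zero _).mpr (Submodule.subset_span ⟨i, j, hij, rfl⟩)⟩
  refine ⟨K, ?_⟩
  have e : (J' n).mkQ (ofR q * ofU u) = ofR q • (ofU u • (J' n).mkQ 1) := by
    rw [smul_smul, ← map_smul, smul_eq_mul, mul_one]
  obtain ⟨w', hw'⟩ := hasWt_pow hw K
  obtain ⟨q', hq'⟩ := exists_ofR_swap hw' q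
  rw [e, smul_smul, ← map_pow, hq', mul_smul, map_pow, hK, smul_zero]

/-- For `i < j` only finitely many summands in `pFactor i j m` are nonzero. -/
theorem pFactor_finite {n : ℕ} {i j : Fin n} (hij : i < j) (m : M' n) :
    (Function.support fun k : ℕ => (((-1 : ℂ) ^ k / (k.factorial : ℂ)) •
      (ofU (E j i) ^ k * ofU (E i j) ^ k *
        ofR ((ascPochhammer (Rh n) k).eval (h i - h j + 1))⁻¹)) • m).Finite := by
  obtain ⟨K, hK⟩ := E_locally_nilpotent hij m
  refine (Set.finite_lt_nat K).subset fun k hk => ?_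
  by_contra hlt
  obtain ⟨d, rfl⟩ := Nat.exists_eq_add_of_le' (not_lt.mp hlt)
  apply hk
  obtain ⟨w, hw⟩ := hasWt_E' i j
  obtain ⟨w', hw'⟩ := hasWt_pow hw (d + K)
  obtain ⟨q', hq'⟩ := exists_ofR_swap hw'
    ((ascPochhammer (Rh n) (d + K)).eval (h i - h j + 1))⁻¹
  have h0 : ofU (E i j) ^ (d + K) • m = 0 := by rw [pow_add, mul_smul, hK, smul_zero]
  have e : ofU (E j i) ^ (d + K) * ofU (E i j) ^ (d + K)
        * ofR ((ascPochhammer (Rh n) (d + K)).eval (h i - h j + 1))⁻¹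
      = ofU (E j i) ^ (d + K) * ofR q' * ofU (E i j) ^ (d + K) := by
    rw [mul_assoc, ← map_pow ofU (E i j), hq', mul_assoc]
  simp only [e]
  rw [Algebra.smul_def, mul_smul, mul_smul, h0, smul_zero, smul_zero]

/-- The positive roots `ε_i - ε_j`, `i < j`, of `gl(n)` as pairs `(i, j)`, in the normal order
`12, 13, 23, …, 1n, …, (n-1)n`. -/
def posRoots (n : ℕ) : List (Fin n × Fin n) :=
  (List.finRange n).flatMap fun j =>
    ((List.finRange n).filter fun i => i < j).map fun i => (i, j)

/-- The extremal projector `p = p_12 p_13 p_23 ⋯ p_1n ⋯ p_(n-1)n` of `gl(n)`, acting on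
`M'(g,t)`. -/
def extProj {n : ℕ} (m : M' n) : M' n :=
  (posRoots n).foldr (fun r m => pFactor r.1 r.2 m) m

/-- The element `p u` of `M'(g,t)`, for `u ∈ U(g)`. -/
def pOf {n : ℕ} (u : U n) : M' n := extProj (cls (ofU u))

/-- The ordered monomial `E^γ = ∏_k (E_k1^(γ_k1) ⋯ E_k,k-1^(γ_k,k-1))` in `U(t^-)`, where `k`
increases from left to right. -/
def Epow {n : ℕ} (γ : Matrix (Fin n) (Fin n) ℕ) : U n :=
  ((List.finRange n).map fun k =>
    (((List.finRange n).filter fun l => l < k).map fun l => E k l ^ γ k l).prod).prod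

/-- The set `I_ij(s)` of increasing sequences `i = i_1 < ⋯ < i_s = j`; a sequence is given by the
set of its entries. -/
def chains {n : ℕ} (i j : Fin n) (s : ℕ) : Finset (Finset (Fin n)) :=
  (Finset.Icc i j).powerset.filter fun I => I.card = s ∧ i ∈ I ∧ j ∈ I

/-- The matrix `e_I = ∑_u e_(i_(u+1), i_u)`: its `(k,l)` entry is `1` if `l < k` are consecutive
elements of `I`, and `0` otherwise. -/
def eMat {n : ℕ} (I : Finset (Fin n)) : Matrix (Fin n) (Fin n) ℕ := fun k l =>
  if k ∈ I ∧ l ∈ I ∧ l < k ∧ ∀ m ∈ I, ¬ (l < m ∧ m < k) then 1 else 0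

end

end OspGl

open OspGl

/-!
Write `e_ij` for the operator of `E_ij` on `M'`. The argument rests on the two characteristic
properties of the extremal projector: `E_ij p = 0` (`raise_smul_extProj`) and `p E_ji = 0`
(`extProj_lower_smul`) for `i < j`. Together with the obvious fact that `p` fixes every vector
annihilated by `t^+` (`extProj_of_singular`) they give the membership in `Z(g,t)` and reduce each
formula for `p B_j^±` to the verification that its right-hand side is annihilated by `t^+`.

*The projector.* By commutators, both properties need only be shown for simple roots `(i, i+1)`.
Translating the argument of the series `p_ij` by an integer gives the operators `pT i j t`. Root
vectors can be moved across `pT i j t` at the cost of a correction term `pD i j t`, the series with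
coefficients `(k + 1) φ_(k+1)` (`pT_e_left`, `pT_e_right`, `e_pT_left`, `e_pT_right`), and for the
root `(i, j)` itself `sl(2)`-theory gives a multiple of `pD` which vanishes for simple roots
(`pT_e_opposite`, `e_pT`). In the products `p_ij p_(i+1)j` and `p_ki p_k(i+1)` the two corrections
cancel (`pFactor_pFactor_e_smul`, `e_smul_pFactor_pFactor`), so that a simple root vector passes
through each column `p_1j ⋯ p_(j-1)j` of the projector, or each pair of neighbouring columns,
until it meets the factor of its own root.

*The formulas for `p B_j^±`.* Splitting off the first step of a sequence turns the sums over
increasing sequences into recursions (`minusTail_rec`, `plusTail_rec`), from which induction gives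
the action of the simple raising operators (`e_smul_minusTail`, `e_smul_plusTail`). All terms
except the one of the sequence of length one lie in `t^- M'`, which `p` annihilates; hence `p` maps
the right-hand side, which it fixes, to `p B_j^±`. For `B_j^+` the monomials `E^(e_I)` have to be
moved past `B_i^+`; the change of coefficients is `plusCoeff_add_sum`.

*The expansions.* The factors of `p` preserve the span of the `E_(c_1 d_1) ⋯ E_(c_r d_r)
{B_k^ε, B_l^ε}` with `d_a < c_a` and given weight (`pFactor_mem_wordSpan`), and the products of
lowering operators are combinations of ordered monomials `E^γ` (`lowerSpan_le`). Thus
`p {B_i^+, B_j^+}` is a combination of `E^γ {B_k^+, B_l^+}` where `E^γ` has weight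
`ε_i + ε_j - ε_k - ε_l`. Reading `γ` as a directed multigraph with edges from smaller to larger
indices, this says that `γ` is a flow from `k` and `l` to `i` and `j`; such a flow decomposes into
two increasing paths, that is `γ = e_I + e_J` (`exists_two_chains`). For `B^-` the flow goes from
`i` and `j` to `k` and `l`.
-/

namespace OspGl

open OreLocalization

noncomputable section

/-! ### Commutation relations -/

/-- The weight `ε_i` of the Cartan subalgebra, dual to the basis element `E_ii`. -/
def wt {n : ℕ} (i : Fin n) : Fin n → ℂ := Pi.single i 1

theorem E_mul_E {n : ℕ} (i j k l : Fin n) :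
    (E i j * E k l : U n) = E k l * E i j + (if j = k then E i l else 0)
      - (if i = l then E k j else 0) := by
  have h1 := E_B i j k true
  have h2 := E_B i j l false
  simp only [sgn] at h1 h2
  have e1 : E i j * B true k = B true k * E i j + (if j = k then (1 : ℂ) else 0) • B true i := by
    rw [h1]; split_ifs <;> norm_num [smul_smul]
  have e2 : E i j * B false l = B false l * E i j - (if i = l then (1 : ℂ) else 0) • B false j := by
    rw [h2]; split_ifs <;> norm_num [smul_smul, sub_eq_add_neg]
  have h3 : ∀ a b : U n, acomm a b = a * b + b * a := fun _ _ => rfl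
  have key : E i j * acomm (B true k) (B false l) = acomm (B true k) (B false l) * E i j
      + (if j = k then (1 : ℂ) else 0) • acomm (B true i) (B false l)
      - (if i = l then (1 : ℂ) else 0) • acomm (B true k) (B false j) := by
    rw [h3, h3, h3, mul_add, ← mul_assoc, ← mul_assoc, e1, e2, add_mul, sub_mul, mul_assoc,
      mul_assoc, e1, e2]
    simp only [mul_add, mul_sub, add_mul, smul_add, smul_mul_assoc, mul_smul_comm, ← mul_assoc]
    abel
  have h4 : ∀ a b : Fin n, (E a b : U n) = (1 / 2 : ℂ) • acomm (B true a) (B false b) :=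
    fun _ _ => rfl
  rw [h4 k l, mul_smul_comm, key, h4 i l, h4 k j, smul_sub, smul_add, smul_mul_assoc]
  split_ifs <;> simp

theorem hasWt_E_sub {n : ℕ} (i j : Fin n) : HasWt (wt i - wt j) (E i j : U n) := by
  intro r
  rw [E_mul_E]
  by_cases h1 : r = i <;> by_cases h2 : r = j <;>
    simp [wt, h1, h2, Pi.single_apply]
  · by_cases h3 : i = j <;> simp [h3]
  · subst h1; simp [h2]
  · subst h2
    simp only [h1, if_false, zero_sub, add_zero]
    module

theorem E_mul_B {n : ℕ} (i j l : Fin n) :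
    E i j * B true l = B true l * E i j + (if j = l then B true i else 0) := by
  rw [E_B]; simp only [sgn]; split_ifs <;> norm_num [smul_smul]

theorem E_mul_B_neg {n : ℕ} (i j l : Fin n) :
    E i j * B false l = B false l * E i j - (if i = l then B false j else 0) := by
  rw [E_B]; simp only [sgn]; split_ifs <;> norm_num [smul_smul, sub_eq_add_neg]

/-- The image of `E_ij` in `U'(g)`. -/
def e {n : ℕ} (i j : Fin n) : U' n := ofU (E i j)

theorem e_mul_e {n : ℕ} (i j k l : Fin n) :
    (e i j * e k l : U' n) = e k l * e i j + (if j = k then e i l else 0)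
      - (if i = l then e k j else 0) := by
  unfold e
  rw [← map_mul, E_mul_E, map_sub, map_add, map_mul]
  split_ifs <;> simp

theorem e_commute {n : ℕ} {i j k l : Fin n} (h1 : j ≠ k) (h2 : i ≠ l) :
    Commute (e i j : U' n) (e k l) := by
  have h3 := e_mul_e i j k l
  simp only [h1, h2, if_false, add_zero, sub_zero] at h3
  exact h3

/-! ### Moving elements of `R(h)` across weight vectors -/

theorem algebraMap_Rh_ne_zero {n : ℕ} {s : Uh n} (hs : s ≠ 0) : algebraMap (Uh n) (Rh n) s ≠ 0 :=
  (map_ne_zero_iff _ (IsFractionRing.injective (Uh n) (Rh n))).mpr hs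

/-- The translation of `R(h)` that extends `shift w`. -/
def shiftR {n : ℕ} (w : Fin n → ℂ) : Rh n →+* Rh n :=
  IsFractionRing.map (A := Uh n) (B := Uh n) (j := (shift w).toRingHom)
    ((injective_iff_map_eq_zero _).mpr fun f hf => by
      by_contra h0
      exact shift_ne_zero w h0 hf)

theorem shiftR_algebraMap {n : ℕ} (w : Fin n → ℂ) (f : Uh n) :
    shiftR w (algebraMap (Uh n) (Rh n) f) = algebraMap (Uh n) (Rh n) (shift w f) := by
  unfold shiftR IsFractionRing.map
  exact IsLocalization.map_eq _ _

theorem shiftR_h {n : ℕ} (w : Fin n → ℂ) (i : Fin n) :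
    shiftR w (h i) = h i + algebraMap ℂ (Rh n) (w i) := by
  unfold h
  rw [map_sub, map_natCast, shiftR_algebraMap]
  have : shift w (MvPolynomial.X i) = MvPolynomial.X i + algebraMap ℂ (Uh n) (w i) := by
    simp [shift, MvPolynomial.algebraMap_eq]
  rw [this, map_add, ← IsScalarTower.algebraMap_apply]
  ring

theorem shiftR_algebraMap' {n : ℕ} (w : Fin n → ℂ) (c : ℂ) :
    shiftR w (algebraMap ℂ (Rh n) c) = algebraMap ℂ (Rh n) c := by
  rw [IsScalarTower.algebraMap_apply ℂ (Uh n) (Rh n), shiftR_algebraMap]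
  congr 1
  exact (shift w).commutes c

theorem ofR_mul_ofU {n : ℕ} {w : Fin n → ℂ} {u : U n} (hu : HasWt w u) (q : Rh n) :
    ofR q * ofU u = ofU u * ofR (shiftR w q) := by
  obtain ⟨f, s, hs, rfl⟩ := IsFractionRing.div_surjective (A := Uh n) q
  have hs0 : algebraMap _ (Rh n) s ≠ 0 := algebraMap_Rh_ne_zero (nonZeroDivisors.ne_zero hs)
  have hs1 : shiftR w (algebraMap _ (Rh n) s) ≠ 0 := (map_ne_zero _).mpr hs0
  have key : ∀ f : Uh n, ofR (algebraMap _ (Rh n) f) * ofU u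
      = ofU u * ofR (shiftR w (algebraMap _ (Rh n) f)) := by
    intro f
    rw [shiftR_algebraMap, ofR_algebraMap, ofR_algebraMap, ← map_mul, ← map_mul, hu.cartan_mul]
  have e1 : ofR (algebraMap (Uh n) (Rh n) s)⁻¹ * ofU u
      = ofU u * ofR (shiftR w (algebraMap _ (Rh n) s))⁻¹ := by
    calc _ = ofR (algebraMap (Uh n) (Rh n) s)⁻¹ * (ofU u *
            ofR (shiftR w (algebraMap _ (Rh n) s))) *
              ofR (shiftR w (algebraMap _ (Rh n) s))⁻¹ := by
          rw [mul_assoc, mul_assoc, ← map_mul, mul_inv_cancel₀ hs1, map_one, mul_one]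
      _ = _ := by
          rw [← key, ← mul_assoc, ← map_mul, inv_mul_cancel₀ hs0, map_one, one_mul]
  rw [div_eq_mul_inv, map_mul, mul_assoc, e1, ← mul_assoc, key, map_mul (shiftR w),
    map_inv₀ (shiftR w), map_mul, mul_assoc]

theorem shiftR_shiftR_neg {n : ℕ} (w : Fin n → ℂ) (q : Rh n) :
    shiftR w (shiftR (-w) q) = q := by
  obtain ⟨f, s, hs, rfl⟩ := IsFractionRing.div_surjective (A := Uh n) q
  simp [map_div₀, shiftR_algebraMap, shift_shift_neg]

theorem ofU_mul_ofR {n : ℕ} {w : Fin n → ℂ} {u : U n} (hu : HasWt w u) (q : Rh n) :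
    ofU u * ofR q = ofR (shiftR (-w) q) * ofU u := by
  rw [ofR_mul_ofU hu, shiftR_shiftR_neg]

theorem ofR_mul_e {n : ℕ} (i j : Fin n) (q : Rh n) :
    ofR q * e i j = e i j * ofR (shiftR (wt i - wt j) q) :=
  ofR_mul_ofU (hasWt_E_sub i j) q

theorem ofR_C {n : ℕ} (c : ℂ) : ofR (algebraMap ℂ (Rh n) c) = algebraMap ℂ (U' n) c := by
  rw [IsScalarTower.algebraMap_apply ℂ (Uh n) (Rh n), ofR_algebraMap, AlgHom.commutes]
  rfl

theorem e_self {n : ℕ} (i : Fin n) : (e i i : U' n) = ofR (h i + ((i : ℕ) : Rh n)) := by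
  unfold e h
  rw [sub_add_cancel, ofR_algebraMap, cartan_X]

theorem e_self_sub {n : ℕ} (i j : Fin n) :
    (e i i - e j j : U' n) = ofR (h i - h j + (((i : ℕ) : Rh n) - ((j : ℕ) : Rh n))) := by
  rw [e_self, e_self, ← map_sub]
  congr 1
  ring

/-- Differences of the `h_i` are transcendental: they never equal a complex number. -/
theorem h_sub_h_ne {n : ℕ} {i j : Fin n} (hij : i ≠ j) (c : ℂ) :
    (h i - h j : Rh n) + algebraMap ℂ (Rh n) c ≠ 0 := by
  intro h0
  have h1 := congrArg (shiftR (wt i)) h0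
  rw [map_add, map_sub, shiftR_h, shiftR_h, shiftR_algebraMap', map_zero] at h1
  have h2 : (1 : Rh n) = 0 := by
    simp [wt, hij.symm] at h1
    linear_combination h1 - h0
  exact one_ne_zero h2

/-! ### The rank one series -/

/-- The coefficient `(-1)^k / (k! (x + 1)_k)` of the extremal projector of `sl(2)`. -/
def phi {n : ℕ} (x : Rh n) (k : ℕ) : Rh n :=
  algebraMap ℂ (Rh n) ((-1) ^ k / (k.factorial : ℂ)) * ((ascPochhammer (Rh n) k).eval (x + 1))⁻¹

theorem phi_zero {n : ℕ} (x : Rh n) : phi x 0 = 1 := by simp [phi]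

theorem phi_rec {n : ℕ} (x : Rh n) (k : ℕ) (hx : x + 1 + k ≠ 0) :
    phi x k = -((k + 1) * (x + 1 + k) * phi x (k + 1)) := by
  have h1 : ((-1) ^ k / (k.factorial : ℂ))
      = -((k + 1 : ℕ) : ℂ) * ((-1) ^ (k + 1) / ((k + 1).factorial : ℂ)) := by
    rw [Nat.factorial_succ, pow_succ]
    have : ((k + 1 : ℕ) : ℂ) ≠ 0 := by exact_mod_cast k.succ_ne_zero
    have : (k.factorial : ℂ) ≠ 0 := by exact_mod_cast k.factorial_ne_zero
    push_cast at *
    field_simp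
  unfold phi
  rw [h1, ascPochhammer_succ_eval, map_mul, map_neg, map_natCast, mul_inv]
  push_cast
  field_simp

theorem shiftR_phi {n : ℕ} (w : Fin n → ℂ) (x : Rh n) (k : ℕ) :
    shiftR w (phi x k) = phi (shiftR w x) k := by
  unfold phi
  rw [map_mul, map_inv₀, shiftR_algebraMap']
  congr 2
  have h1 := Polynomial.eval₂_at_apply (p := ascPochhammer (Rh n) k) (shiftR w) (x + 1)
  rw [← h1, ← ascPochhammer_eval₂, map_add, map_one]

/-- `∑_k E_ji^k E_ij^k c_k`, acting on `M'`. -/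
def pairSum {n : ℕ} (i j : Fin n) (c : ℕ → Rh n) (m : M' n) : M' n :=
  ∑ᶠ k : ℕ, (e j i ^ k * e i j ^ k * ofR (c k)) • m

theorem pFactor_eq_pairSum {n : ℕ} (i j : Fin n) (m : M' n) :
    pFactor i j m = pairSum i j (phi (h i - h j)) m := by
  unfold pFactor pairSum
  refine finsum_congr fun k => ?_
  congr 1
  rw [phi, map_mul, ofR_C, Algebra.smul_def, Algebra.left_comm]
  rfl

theorem pairTerm_eq_zero {n : ℕ} {i j : Fin n} {K k : ℕ} (hk : K ≤ k) {m : M' n}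
    (hm : e i j ^ K • m = 0) (c : Rh n) : (e j i ^ k * e i j ^ k * ofR c) • m = 0 := by
  obtain ⟨d, rfl⟩ := Nat.exists_eq_add_of_le' hk
  obtain ⟨w', hw'⟩ := hasWt_pow (hasWt_E_sub i j) (d + K)
  have h1 : e i j ^ (d + K) * ofR c = ofR (shiftR (-w') c) * e i j ^ (d + K) := by
    unfold e
    rw [← map_pow, ofU_mul_ofR hw']
  rw [mul_assoc, h1, pow_add (e i j), ← mul_assoc, ← mul_assoc, mul_smul, hm, smul_zero]

theorem pairSum_eq_sum {n : ℕ} {i j : Fin n} {K : ℕ} {m : M' n}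
    (hm : e i j ^ K • m = 0) (c : ℕ → Rh n) :
    pairSum i j c m = ∑ k ∈ Finset.range K, (e j i ^ k * e i j ^ k * ofR (c k)) • m := by
  refine finsum_eq_sum_of_support_subset _ fun k hk => ?_
  by_contra hlt
  exact hk (pairTerm_eq_zero (by simpa using hlt) hm _)

theorem exists_pow_smul_eq_zero {n : ℕ} {i j : Fin n} (hij : i < j) (m : M' n) :
    ∃ K, ∀ k, K ≤ k → e i j ^ k • m = 0 := by
  obtain ⟨K, hK⟩ := E_locally_nilpotent hij m
  refine ⟨K, fun k hk => ?_⟩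
  obtain ⟨d, rfl⟩ := Nat.exists_eq_add_of_le' hk
  rw [pow_add, mul_smul]
  exact (congrArg _ hK).trans (smul_zero _)

theorem pairSum_add {n : ℕ} {i j : Fin n} (hij : i < j) (c : ℕ → Rh n) (m m' : M' n) :
    pairSum i j c (m + m') = pairSum i j c m + pairSum i j c m' := by
  obtain ⟨K, hK⟩ := exists_pow_smul_eq_zero hij m
  obtain ⟨L, hL⟩ := exists_pow_smul_eq_zero hij m'
  have h1 := hK (K + L) (by omega)
  have h2 := hL (K + L) (by omega)
  rw [pairSum_eq_sum h1, pairSum_eq_sum h2,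
    pairSum_eq_sum (K := K + L) (by rw [smul_add, h1, h2, add_zero]), ← Finset.sum_add_distrib]
  simp_rw [smul_add]

/-- The rank one series as an additive map. -/
def pairHom {n : ℕ} {i j : Fin n} (hij : i < j) (c : ℕ → Rh n) : M' n →+ M' n :=
  AddMonoidHom.mk' (pairSum i j c) (pairSum_add hij c)

theorem pairSum_zsmul {n : ℕ} {i j : Fin n} (hij : i < j) (c : ℕ → Rh n) (z : ℤ) (m : M' n) :
    pairSum i j c (z • m) = z • pairSum i j c m :=
  map_zsmul (pairHom hij c) z m

theorem pairSum_zero {n : ℕ} {i j : Fin n} (hij : i < j) (c : ℕ → Rh n) :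
    pairSum i j c (0 : M' n) = 0 :=
  map_zero (pairHom hij c)

theorem pairSum_add_coeff {n : ℕ} {i j : Fin n} (hij : i < j) (c c' : ℕ → Rh n) (m : M' n) :
    pairSum i j c m + pairSum i j c' m = pairSum i j (fun k => c k + c' k) m := by
  obtain ⟨K, hK⟩ := exists_pow_smul_eq_zero hij m
  have h1 := hK K le_rfl
  rw [pairSum_eq_sum h1, pairSum_eq_sum h1, pairSum_eq_sum h1, ← Finset.sum_add_distrib]
  refine Finset.sum_congr rfl fun k _ => ?_
  rw [map_add, mul_add, add_smul]

theorem pairSum_zsmul_coeff {n : ℕ} {i j : Fin n} (hij : i < j) (c : ℕ → Rh n) (z : ℤ)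
    (m : M' n) : pairSum i j (fun k => z * c k) m = z • pairSum i j c m := by
  obtain ⟨K, hK⟩ := exists_pow_smul_eq_zero hij m
  have h1 := hK K le_rfl
  rw [pairSum_eq_sum h1, pairSum_eq_sum h1, Finset.smul_sum]
  refine Finset.sum_congr rfl fun k _ => ?_
  rw [map_mul, map_intCast, ← zsmul_eq_mul, mul_smul_comm, smul_assoc]

/-- Identities between rank one series follow from identities between their terms, one of the
series possibly being shifted by one step. -/
theorem pairSum_rule {n : ℕ} {i j : Fin n} (hij : i < j) (g u v : U' n) {c c₁ c₂ : ℕ → Rh n}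
    {m m₁ m₂ : M' n}
    (h0 : (g * ofR (c 0)) • m = (u * ofR (c₁ 0)) • m₁)
    (hs : ∀ k, (g * (e j i ^ (k + 1) * e i j ^ (k + 1) * ofR (c (k + 1)))) • m
      = (u * (e j i ^ (k + 1) * e i j ^ (k + 1) * ofR (c₁ (k + 1)))) • m₁
        + (v * (e j i ^ k * e i j ^ k * ofR (c₂ k))) • m₂) :
    g • pairSum i j c m = u • pairSum i j c₁ m₁ + v • pairSum i j c₂ m₂ := by
  obtain ⟨K, hK⟩ := exists_pow_smul_eq_zero hij m
  obtain ⟨K₁, hK₁⟩ := exists_pow_smul_eq_zero hij m₁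
  obtain ⟨K₂, hK₂⟩ := exists_pow_smul_eq_zero hij m₂
  rw [pairSum_eq_sum (hK (K + K₁ + K₂ + 1) (by omega)),
    pairSum_eq_sum (hK₁ (K + K₁ + K₂ + 1) (by omega)),
    pairSum_eq_sum (hK₂ (K + K₁ + K₂) (by omega)), Finset.sum_range_succ', Finset.sum_range_succ',
    smul_add, smul_add, Finset.smul_sum, Finset.smul_sum, Finset.smul_sum,
    add_right_comm (Finset.sum _ _), ← Finset.sum_add_distrib]
  congr 1
  · refine Finset.sum_congr rfl fun k _ => ?_
    rw [smul_smul, smul_smul, smul_smul, hs]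
  · simpa [smul_smul] using h0

/-- The series of the factor `p_ij`, with its argument translated by the integer `t`. -/
def pT {n : ℕ} (i j : Fin n) (t : ℤ) (m : M' n) : M' n :=
  pairSum i j (fun k => phi (h i - h j + (t : Rh n)) k) m

/-- The series `∑_k E_ji^k E_ij^k (k + 1) φ_(k+1)`, where `φ_k` are the coefficients of `pT`. It
governs the failure of `pT` to commute with root vectors. -/
def pD {n : ℕ} (i j : Fin n) (t : ℤ) (m : M' n) : M' n :=
  pairSum i j (fun k => (k + 1) * phi (h i - h j + (t : Rh n)) (k + 1)) m

theorem pFactor_eq_pT {n : ℕ} (i j : Fin n) (m : M' n) : pFactor i j m = pT i j 0 m := by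
  rw [pFactor_eq_pairSum, pT]
  simp

theorem pT_add {n : ℕ} {i j : Fin n} (hij : i < j) (t : ℤ) (m m' : M' n) :
    pT i j t (m + m') = pT i j t m + pT i j t m' := pairSum_add hij _ m m'

theorem pD_zsmul {n : ℕ} {i j : Fin n} (hij : i < j) (t z : ℤ) (m : M' n) :
    pD i j t (z • m) = z • pD i j t m := pairSum_zsmul hij _ z m

theorem pT_zero {n : ℕ} {i j : Fin n} (hij : i < j) (t : ℤ) : pT i j t (0 : M' n) = 0 :=
  pairSum_zero hij _

theorem ofR_phi_mul_e {n : ℕ} {i j : Fin n} (a b : Fin n) (t s : ℤ) (k : ℕ)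
    (hs : (wt a - wt b) i - (wt a - wt b) j = (s : ℂ)) :
    (ofR (phi (h i - h j + (t : Rh n)) k) * e a b : U' n)
      = e a b * ofR (phi (h i - h j + ((t + s : ℤ) : Rh n)) k) := by
  rw [ofR_mul_e, shiftR_phi]
  congr 3
  rw [map_add, map_sub, shiftR_h, shiftR_h, map_intCast]
  have := congrArg (algebraMap ℂ (Rh n)) hs
  rw [map_sub, map_intCast] at this
  push_cast
  rw [← this]
  ring

theorem pow_succ_mul_of_comm {R : Type*} [Ring R] {a f b : R} (h1 : a * f = f * a + b)
    (h2 : Commute a b) (k : ℕ) : a ^ (k + 1) * f = f * a ^ (k + 1) + (k + 1 : ℕ) * (b * a ^ k) := by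
  induction k with
  | zero => simp [h1]
  | succ k ih =>
    have h3 : a ^ (k + 1) * b = b * a ^ (k + 1) := (h2.pow_left _).eq
    rw [pow_succ a (k + 1), mul_assoc, h1, mul_add, ← mul_assoc, ih, h3]
    push_cast
    simp only [add_mul, one_mul, mul_assoc, ← pow_succ]
    abel

theorem mul_pow_of_comm {R : Type*} [Ring R] {a H : R} (h2 : H * a = a * H + (2 : ℤ) • a) (l : ℕ) :
    H * a ^ l = a ^ l * H + (2 * l : ℤ) • a ^ l := by
  induction l with
  | zero => simp
  | succ l ih =>
    rw [pow_succ, ← mul_assoc, ih, add_mul, mul_assoc, h2, smul_mul_assoc, mul_add, mul_smul_comm,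
      ← mul_assoc]
    push_cast
    module

theorem pow_succ_mul_sl2 {R : Type*} [Ring R] {a b H : R} (h1 : a * b = b * a + H)
    (h2 : H * a = a * H + (2 : ℤ) • a) (k : ℕ) :
    a ^ (k + 1) * b = b * a ^ (k + 1) + (k + 1 : ℤ) • (a ^ k * (H + (k : ℤ) • 1)) := by
  induction k with
  | zero => simp [h1]
  | succ k ih =>
    rw [pow_succ' a (k + 1), mul_assoc, ih, mul_add, ← mul_assoc, h1, add_mul,
      mul_pow_of_comm h2, mul_smul_comm, ← mul_assoc a (a ^ k), ← pow_succ', mul_assoc b,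
      mul_add, mul_add]
    simp only [mul_smul_comm, mul_one]
    push_cast
    module

theorem mul_pow_succ_sl2 {R : Type*} [Ring R] {a b H : R} (h1 : a * b = b * a + H)
    (h2 : H * b = b * H - (2 : ℤ) • b) (k : ℕ) :
    a * b ^ (k + 1) = b ^ (k + 1) * a + (k + 1 : ℤ) • (b ^ k * (H - (k : ℤ) • 1)) := by
  induction k with
  | zero => simp [h1]
  | succ k ih =>
    rw [pow_succ b (k + 1), ← mul_assoc, ih, add_mul, mul_assoc _ a, h1, smul_mul_assoc,
      mul_assoc, sub_mul, h2, smul_mul_assoc, one_mul]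
    simp only [mul_smul_comm, mul_one, mul_add, mul_sub, ← mul_assoc, ← pow_succ]
    push_cast
    module

theorem e_mul_e_opposite {n : ℕ} {i j : Fin n} :
    (e i j * e j i : U' n) = e j i * e i j
      + ofR (h i - h j + (((i : ℕ) : Rh n) - ((j : ℕ) : Rh n))) := by
  rw [← e_self_sub, e_mul_e]
  simp
  abel

theorem wt_sub_apply {n : ℕ} (a b i : Fin n) :
    (wt a - wt b) i = (if i = a then 1 else 0) - (if i = b then 1 else 0) := by
  simp [wt, Pi.single_apply]

theorem e_self_sub_mul_e {n : ℕ} {i j : Fin n} (hij : i ≠ j) :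
    (e i i - e j j : U' n) * e i j = e i j * (e i i - e j j) + (2 : ℤ) • e i j := by
  rw [sub_mul, e_mul_e, e_mul_e j j]
  simp only [hij, hij.symm, if_true, if_false, mul_sub, add_zero, sub_zero]
  module

theorem e_self_sub_mul_e' {n : ℕ} {i j : Fin n} (hij : i ≠ j) :
    (e i i - e j j : U' n) * e j i = e j i * (e i i - e j j) - (2 : ℤ) • e j i := by
  rw [sub_mul, e_mul_e, e_mul_e j j]
  simp only [hij, hij.symm, if_true, if_false, mul_sub, add_zero, sub_zero]
  module

/-- The recursion for the coefficients of `pT`. The factor `h_i - h_j + t + 1 + k` is nonzero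
because `h_i - h_j` is not a complex number. -/
theorem phi_h_rec {n : ℕ} {i j : Fin n} (hij : i ≠ j) (t : ℤ) (k : ℕ) :
    phi (h i - h j + (t : Rh n)) k = -((k + 1) * (h i - h j + (t : Rh n) + 1 + k)
      * phi (h i - h j + (t : Rh n)) (k + 1)) := by
  refine phi_rec _ _ ?_
  have := h_sub_h_ne hij ((t : ℂ) + 1 + k)
  simpa [← add_assoc] using this

/-- The combination of series that arises when a root vector of the root `(i, j)` is moved across
`pT i j t`. Its scalar factor vanishes for a simple root and `t = 0`. -/
theorem pD_combine {n : ℕ} {i j : Fin n} (hij : i < j) (t : ℤ) (m : M' n) :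
    pT i j (t - 2) m + pairSum i j (fun k => (k + 1) *
        ((h i - h j + (((i : ℕ) : Rh n) - ((j : ℕ) : Rh n)) + k) *
          phi (h i - h j + ((t - 2 : ℤ) : Rh n)) (k + 1))) m
      = -((j : ℕ) - (i : ℕ) + t - 1 : ℤ) • pD i j (t - 2) m := by
  unfold pT pD
  rw [pairSum_add_coeff hij, ← pairSum_zsmul_coeff hij]
  congr 1
  funext k
  rw [phi_h_rec hij.ne]
  push_cast
  ring

theorem ofR_coeff {n : ℕ} (H p : Rh n) (k : ℕ) :
    (ofR ((k + 1) * ((H + k) * p)) : U' n)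
      = (k + 1 : ℤ) • ((ofR H + (k : ℤ) • 1) * ofR p) := by
  rw [map_mul, map_mul, map_add, map_add, map_natCast, map_one, zsmul_eq_mul, zsmul_eq_mul]
  push_cast
  rw [mul_one]

/-- The `sl(2)` computation behind `p_ij E_ji = 0` for simple roots. -/
theorem pT_e_opposite {n : ℕ} {i j : Fin n} (hij : i < j) (t : ℤ) (m : M' n) :
    pT i j t (e j i • m) = -((j : ℕ) - (i : ℕ) + t - 1 : ℤ) • (e j i • pD i j (t - 2) m) := by
  rw [← smul_comm (e j i), ← pD_combine hij, smul_add, ← one_smul (U' n) (pT i j t _)]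
  have hs : ∀ k, ofR (phi (h i - h j + (t : Rh n)) k) * e j i
      = e j i * ofR (phi (h i - h j + ((t - 2 : ℤ) : Rh n)) k) := fun k =>
    ofR_phi_mul_e j i t (-2) k (by
      rw [wt_sub_apply, wt_sub_apply]; simp [hij.ne, hij.ne']; norm_num)
  refine pairSum_rule hij 1 (e j i) (e j i) ?_ fun k => ?_
  · rw [one_mul, smul_smul, hs]
  · rw [one_mul, smul_smul, ← add_smul]
    congr 1
    rw [mul_assoc, hs, ← mul_assoc, mul_assoc (e j i ^ (k + 1)), ofR_coeff,
      pow_succ_mul_sl2 e_mul_e_opposite (by rw [← e_self_sub, e_self_sub_mul_e hij.ne])]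
    have h1 : ∀ x : U' n, e j i ^ (k + 1) * (e j i * x) = e j i * (e j i ^ (k + 1) * x) :=
        fun x => by
      rw [← mul_assoc, ← pow_succ, pow_succ', mul_assoc]
    have h2 : ∀ x : U' n, e j i ^ (k + 1) * x = e j i * (e j i ^ k * x) := fun x => by
      rw [pow_succ', mul_assoc]
    simp only [mul_add, add_mul, mul_assoc, mul_smul_comm, smul_mul_assoc, h1]
    simp only [h2]

/-- The `sl(2)` computation behind `E_ij p_ij = 0` for simple roots. -/
theorem e_pT {n : ℕ} {i j : Fin n} (hij : i < j) (t : ℤ) (m : M' n) :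
    e i j • pT i j t m = -((j : ℕ) - (i : ℕ) + t - 1 : ℤ) • pD i j (t - 2) (e i j • m) := by
  rw [← pD_combine hij, ← one_smul (U' n) (pT i j (t - 2) _), ← one_smul (U' n) (pairSum _ _ _ _)]
  have hs : ∀ k, ofR (phi (h i - h j + ((t - 2 : ℤ) : Rh n)) k) * e i j
      = e i j * ofR (phi (h i - h j + (t : Rh n)) k) := fun k => by
    have := ofR_phi_mul_e (i := i) (j := j) i j (t - 2) 2 k (by
      rw [wt_sub_apply, wt_sub_apply]; simp [hij.ne, hij.ne']; norm_num)
    rwa [sub_add_cancel] at this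
  refine pairSum_rule hij (e i j) 1 1 ?_ fun k => ?_
  · rw [one_mul, smul_smul, hs]
  · rw [one_mul, one_mul, smul_smul, smul_smul, ← add_smul]
    congr 1
    rw [ofR_coeff, mul_assoc _ _ (e i j), hs]
    simp only [mul_assoc, smul_mul_assoc, hs]
    have hH : (ofR (h i - h j + (((i : ℕ) : Rh n) - ((j : ℕ) : Rh n))) + (k : ℤ) • 1) * e i j
      = e i j * (ofR (h i - h j + (((i : ℕ) : Rh n) - ((j : ℕ) : Rh n))) + ((k : ℤ) + 2) • 1) := by
      rw [← e_self_sub, add_mul, e_self_sub_mul_e hij.ne, mul_add, smul_mul_assoc, mul_smul_comm,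
        one_mul, mul_one]
      module
    rw [← mul_assoc (e i j), mul_pow_succ_sl2 e_mul_e_opposite (by
      rw [← e_self_sub, e_self_sub_mul_e' hij.ne])]
    have hk : ∀ l : ℕ, (ofR (h i - h j + (((i : ℕ) : Rh n) - ((j : ℕ) : Rh n))) : U' n) * e i j ^ l
      = e i j ^ l * ofR (h i - h j + (((i : ℕ) : Rh n) - ((j : ℕ) : Rh n)))
        + (2 * l : ℤ) • e i j ^ l := fun l =>
      mul_pow_of_comm (by rw [← e_self_sub, e_self_sub_mul_e hij.ne]) l
    have hk' := hk (k + 1)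
    push_cast at hk'
    set H : U' n := ofR (h i - h j + (((i : ℕ) : Rh n) - ((j : ℕ) : Rh n)))
    set p : U' n := ofR (phi (h i - h j + (t : Rh n)) (k + 1))
    have h3 : (H - (k : ℤ) • 1) * e i j ^ (k + 1)
        = e i j ^ k * (e i j * (H + ((k : ℤ) + 2) • 1)) := by
      rw [← mul_assoc, ← pow_succ, sub_mul, hk', mul_add (e i j ^ (k + 1)), smul_mul_assoc,
        mul_smul_comm, one_mul, mul_one]
      module
    have h4 : (H + (k : ℤ) • 1) * (e i j * p) = e i j * (H + ((k : ℤ) + 2) • 1) * p := by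
      rw [← mul_assoc, hH]
    have h5 : (H - (k : ℤ) • 1) * (e i j ^ (k + 1) * p)
        = e i j ^ k * (e i j * (H + ((k : ℤ) + 2) • 1) * p) := by
      rw [← mul_assoc, h3, mul_assoc]
    rw [add_mul, smul_mul_assoc, mul_assoc, mul_assoc, h5, mul_smul_comm, mul_smul_comm, h4,
      ← mul_assoc (e i j), ← pow_succ', ← mul_assoc _ (e i j) p, ← pow_succ]

/-! ### Commuting root vectors with the factors of the projector -/

/-- Moving `E_ki` to the left across the factor `p_ij`. -/
theorem pT_e_left {n : ℕ} {i j k : Fin n} (hij : i < j) (hki : k ≠ i) (hkj : k ≠ j) (t : ℤ)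
    (m : M' n) :
    pT i j t (e k i • m) = e k i • pT i j (t - 1) m - e j i • pD i j (t - 2) (e k j • m) := by
  rw [← one_smul (U' n) (pT i j t _), sub_eq_add_neg, ← neg_smul]
  have hs : ∀ l, ofR (phi (h i - h j + (t : Rh n)) l) * e k i
      = e k i * ofR (phi (h i - h j + ((t - 1 : ℤ) : Rh n)) l) := fun l =>
    ofR_phi_mul_e k i t (-1) l (by
      rw [wt_sub_apply, wt_sub_apply]; simp [hki.symm, hkj.symm, hij.ne'])
  have hs' : ∀ l, ofR (phi (h i - h j + ((t - 2 : ℤ) : Rh n)) l) * e k j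
      = e k j * ofR (phi (h i - h j + ((t - 1 : ℤ) : Rh n)) l) := fun l => by
    have := ofR_phi_mul_e (i := i) (j := j) k j (t - 2) 1 l (by
      rw [wt_sub_apply, wt_sub_apply]; simp [hki.symm, hkj.symm, hij.ne])
    rwa [show t - 2 + 1 = t - 1 by ring] at this
  refine pairSum_rule hij 1 (e k i) (-e j i) ?_ fun l => ?_
  · rw [one_mul, smul_smul, hs]
  · rw [one_mul, smul_smul, smul_smul, ← add_smul]
    congr 1
    have h1 : (e i j * e k i : U' n) = e k i * e i j + -e k j := by
      rw [e_mul_e]; simp [hkj.symm, sub_eq_add_neg]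
    have h2 : Commute (e i j : U' n) (-e k j) := (e_commute hkj.symm hij.ne).neg_right
    have h3 : Commute (e j i ^ (l + 1) : U' n) (e k i) :=
      (e_commute hki.symm hij.ne').pow_left _
    have h4 : Commute (e i j ^ l : U' n) (e k j) := (e_commute hkj.symm hij.ne).pow_left _
    have h5 : (ofR ((l + 1) * phi (h i - h j + ((t - 2 : ℤ) : Rh n)) (l + 1)) : U' n) * e k j
        = (l + 1 : ℕ) * (e k j * ofR (phi (h i - h j + ((t - 1 : ℤ) : Rh n)) (l + 1))) := by
      rw [map_mul, map_add, map_natCast, map_one, mul_assoc, hs']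
      push_cast
      rfl
    rw [mul_assoc, hs, ← mul_assoc, mul_assoc (e j i ^ (l + 1)), pow_succ_mul_of_comm h1 h2,
      neg_mul (e k j), neg_mul (e j i), neg_mul _ (e k j), mul_assoc (e j i),
      mul_assoc (e j i ^ l * e i j ^ l), h5]
    simp only [mul_add, add_mul, mul_neg, neg_mul]
    rw [← mul_assoc _ (e k i), h3.eq]
    congr 1
    · simp only [mul_assoc]
    · rw [← h4.eq, pow_succ' (e j i), ← nsmul_eq_mul, ← nsmul_eq_mul]
      simp only [mul_assoc, mul_smul_comm, smul_mul_assoc]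

/-- Moving `E_ki` to the left across the factor `p_kj`. -/
theorem pT_e_right {n : ℕ} {i j k : Fin n} (hkj : k < j) (hki : k ≠ i) (hij : i ≠ j) (t : ℤ)
    (m : M' n) :
    pT k j t (e k i • m) = e k i • pT k j (t + 1) m + e j i • pD k j (t - 1) (e k j • m) := by
  rw [← one_smul (U' n) (pT k j t _)]
  have hs : ∀ l, ofR (phi (h k - h j + (t : Rh n)) l) * e k i
      = e k i * ofR (phi (h k - h j + ((t + 1 : ℤ) : Rh n)) l) := fun l =>
    ofR_phi_mul_e k i t 1 l (by
      rw [wt_sub_apply, wt_sub_apply]; simp [hki, hkj.ne', hij.symm])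
  have hs' : ∀ l, ofR (phi (h k - h j + ((t - 1 : ℤ) : Rh n)) l) * e k j
      = e k j * ofR (phi (h k - h j + ((t + 1 : ℤ) : Rh n)) l) := fun l => by
    have := ofR_phi_mul_e (i := k) (j := j) k j (t - 1) 2 l (by
      rw [wt_sub_apply, wt_sub_apply]; simp [hkj.ne, hkj.ne']; norm_num)
    rwa [show t - 1 + 2 = t + 1 by ring] at this
  refine pairSum_rule hkj 1 (e k i) (e j i) ?_ fun l => ?_
  · rw [one_mul, smul_smul, hs]
  · rw [one_mul, smul_smul, smul_smul, ← add_smul]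
    congr 1
    have h1 : (e j k * e k i : U' n) = e k i * e j k + e j i := by
      rw [e_mul_e]; simp [hij.symm]
    have h2 : Commute (e j k : U' n) (e j i) := e_commute hkj.ne hij.symm
    have h3 : Commute (e k j ^ (l + 1) : U' n) (e k i) :=
      (e_commute hkj.ne' hki).pow_left _
    have h5 : (ofR ((l + 1) * phi (h k - h j + ((t - 1 : ℤ) : Rh n)) (l + 1)) : U' n) * e k j
        = (l + 1 : ℕ) * (e k j * ofR (phi (h k - h j + ((t + 1 : ℤ) : Rh n)) (l + 1))) := by
      rw [map_mul, map_add, map_natCast, map_one, mul_assoc, hs']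
      push_cast
      rfl
    rw [mul_assoc, hs, ← mul_assoc, mul_assoc (e j k ^ (l + 1)), h3.eq, ← mul_assoc,
      pow_succ_mul_of_comm h1 h2, mul_assoc (e j i), mul_assoc (e j k ^ l * e k j ^ l), h5]
    simp only [add_mul]
    congr 1
    · simp only [mul_assoc]
    · rw [pow_succ (e k j), ← nsmul_eq_mul, ← nsmul_eq_mul]
      simp only [mul_assoc, mul_smul_comm, smul_mul_assoc]

/-- Moving `E_ij` to the right across the factor `p_ki`. -/
theorem e_pT_left {n : ℕ} {i j k : Fin n} (hki : k < i) (hij : i ≠ j) (hkj : k ≠ j) (t : ℤ)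
    (m : M' n) :
    e i j • pT k i t m = pT k i (t + 1) (e i j • m) - e i k • pD k i (t - 1) (e k j • m) := by
  rw [← one_smul (U' n) (pT k i (t + 1) _), sub_eq_add_neg, ← neg_smul]
  have hs : ∀ l, ofR (phi (h k - h i + ((t + 1 : ℤ) : Rh n)) l) * e i j
      = e i j * ofR (phi (h k - h i + (t : Rh n)) l) := fun l => by
    have := ofR_phi_mul_e (i := k) (j := i) i j (t + 1) (-1) l (by
      rw [wt_sub_apply, wt_sub_apply]; simp [hki.ne, hkj, hij])
    rwa [show t + 1 + -1 = t by ring] at this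
  have hs' : ∀ l, ofR (phi (h k - h i + ((t - 1 : ℤ) : Rh n)) l) * e k j
      = e k j * ofR (phi (h k - h i + (t : Rh n)) l) := fun l => by
    have := ofR_phi_mul_e (i := k) (j := i) k j (t - 1) 1 l (by
      rw [wt_sub_apply, wt_sub_apply]; simp [hki.ne', hkj, hij])
    rwa [show t - 1 + 1 = t by ring] at this
  refine pairSum_rule hki (e i j) 1 (-e i k) ?_ fun l => ?_
  · rw [one_mul, smul_smul, hs]
  · rw [one_mul, smul_smul, smul_smul, ← add_smul]
    congr 1
    have h1 : (e k i * e i j : U' n) = e i j * e k i + e k j := by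
      rw [e_mul_e]; simp [hkj]
    have h2 : Commute (e k i : U' n) (e k j) := e_commute hki.ne' hkj
    have h3 : Commute (e i k ^ (l + 1) : U' n) (e i j) :=
      (e_commute hki.ne hij).pow_left _
    have h4 : Commute (e k i ^ l : U' n) (e k j) := h2.pow_left _
    have h5 : (ofR ((l + 1) * phi (h k - h i + ((t - 1 : ℤ) : Rh n)) (l + 1)) : U' n) * e k j
        = (l + 1 : ℕ) * (e k j * ofR (phi (h k - h i + (t : Rh n)) (l + 1))) := by
      rw [map_mul, map_add, map_natCast, map_one, mul_assoc, hs']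
      push_cast
      rfl
    have h6 := pow_succ_mul_of_comm h1 h2 l
    rw [mul_assoc (e i k ^ (l + 1) * e k i ^ (l + 1)), hs, ← mul_assoc _ (e i j),
      mul_assoc (e i k ^ (l + 1)) _ (e i j), h6, neg_mul (e i k), neg_mul _ (e k j),
      mul_assoc (e i k),
      mul_assoc (e i k ^ l * e k i ^ l), h5]
    simp only [mul_add, add_mul]
    rw [← mul_assoc _ (e i j), h3.eq, ← h4.eq, pow_succ' (e i k), ← nsmul_eq_mul, ← nsmul_eq_mul]
    simp only [mul_assoc, mul_smul_comm, smul_mul_assoc]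
    abel

/-- Moving `E_ij` to the right across the factor `p_kj`. -/
theorem e_pT_right {n : ℕ} {i j k : Fin n} (hkj : k < j) (hij : i ≠ j) (hki : k ≠ i) (t : ℤ)
    (m : M' n) :
    e i j • pT k j t m = pT k j (t - 1) (e i j • m) + e i k • pD k j (t - 2) (e k j • m) := by
  rw [← one_smul (U' n) (pT k j (t - 1) _)]
  have hs : ∀ l, ofR (phi (h k - h j + ((t - 1 : ℤ) : Rh n)) l) * e i j
      = e i j * ofR (phi (h k - h j + (t : Rh n)) l) := fun l => by
    have := ofR_phi_mul_e (i := k) (j := j) i j (t - 1) 1 l (by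
      rw [wt_sub_apply, wt_sub_apply]; simp [hki, hkj.ne, hij.symm])
    rwa [show t - 1 + 1 = t by ring] at this
  have hs' : ∀ l, ofR (phi (h k - h j + ((t - 2 : ℤ) : Rh n)) l) * e k j
      = e k j * ofR (phi (h k - h j + (t : Rh n)) l) := fun l => by
    have := ofR_phi_mul_e (i := k) (j := j) k j (t - 2) 2 l (by
      rw [wt_sub_apply, wt_sub_apply]; simp [hkj.ne, hkj.ne']; norm_num)
    rwa [show t - 2 + 2 = t by ring] at this
  refine pairSum_rule hkj (e i j) 1 (e i k) ?_ fun l => ?_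
  · rw [one_mul, smul_smul, hs]
  · rw [one_mul, smul_smul, smul_smul, ← add_smul]
    congr 1
    have h1 : (e j k * e i j : U' n) = e i j * e j k + -e i k := by
      rw [e_mul_e]; simp [hki, sub_eq_add_neg]
    have h2 : Commute (e j k : U' n) (-e i k) := (e_commute hki hkj.ne').neg_right
    have h3 : Commute (e k j ^ (l + 1) : U' n) (e i j) :=
      (e_commute hij.symm hkj.ne).pow_left _
    have h5 : (ofR ((l + 1) * phi (h k - h j + ((t - 2 : ℤ) : Rh n)) (l + 1)) : U' n) * e k j
        = (l + 1 : ℕ) * (e k j * ofR (phi (h k - h j + (t : Rh n)) (l + 1))) := by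
      rw [map_mul, map_add, map_natCast, map_one, mul_assoc, hs']
      push_cast
      rfl
    have h6 := pow_succ_mul_of_comm h1 h2 l
    rw [mul_assoc (e j k ^ (l + 1) * e k j ^ (l + 1)), hs, ← mul_assoc _ (e i j),
      mul_assoc (e j k ^ (l + 1)) _ (e i j), h3.eq, ← mul_assoc (e j k ^ (l + 1)), h6,
      mul_assoc (e i k),
      mul_assoc (e j k ^ l * e k j ^ l), h5, pow_succ (e k j), ← nsmul_eq_mul, ← nsmul_eq_mul]
    simp only [mul_assoc, mul_smul_comm, smul_mul_assoc, add_mul, neg_mul, smul_neg]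
    abel

/-! ### The extremal projector of `gl(n)` -/

theorem pFactor_add {n : ℕ} {i j : Fin n} (hij : i < j) (m m' : M' n) :
    pFactor i j (m + m') = pFactor i j m + pFactor i j m' := by
  simp only [pFactor_eq_pT, pT_add hij]

theorem pFactor_zero {n : ℕ} {i j : Fin n} (hij : i < j) : pFactor i j (0 : M' n) = 0 := by
  rw [pFactor_eq_pT, pT_zero hij]

theorem pairSum_smul_of_commute {n : ℕ} {i j : Fin n} (hij : i < j) {c : ℕ → Rh n} {x : U' n}
    (hx : ∀ k, Commute (e j i ^ k * e i j ^ k * ofR (c k)) x) (m : M' n) :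
    pairSum i j c (x • m) = x • pairSum i j c m := by
  obtain ⟨K, hK⟩ := exists_pow_smul_eq_zero hij m
  obtain ⟨L, hL⟩ := exists_pow_smul_eq_zero hij (x • m)
  rw [pairSum_eq_sum (hK (K + L) (by omega)), pairSum_eq_sum (hL (K + L) (by omega)),
    Finset.smul_sum]
  refine Finset.sum_congr rfl fun k _ => ?_
  rw [smul_smul, smul_smul, (hx k).eq]

theorem HasWt.pow {n : ℕ} {w : Fin n → ℂ} {u : U n} (hu : HasWt w u) (k : ℕ) :
    HasWt ((k : ℂ) • w) (u ^ k) := by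
  induction k with
  | zero => intro i; simp
  | succ k ih =>
    have := ih.mul hu
    rw [← pow_succ] at this
    convert this using 1
    push_cast
    module

theorem shiftR_zero {n : ℕ} (q : Rh n) : shiftR 0 q = q := by
  have h1 : ∀ f : Uh n, shift 0 f = f := fun f => by simp [shift]
  obtain ⟨f, s, hs, rfl⟩ := IsFractionRing.div_surjective (A := Uh n) q
  simp [map_div₀, shiftR_algebraMap, h1]

theorem ofR_commute_pair {n : ℕ} (i j : Fin n) (q : Rh n) (k : ℕ) :
    Commute (ofR q) (e j i ^ k * e i j ^ k : U' n) := by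
  have h1 := ((hasWt_E_sub j i).pow k).mul ((hasWt_E_sub i j).pow k)
  have h2 : (k : ℂ) • (wt j - wt i) + (k : ℂ) • (wt i - wt j) = (0 : Fin n → ℂ) := by module
  rw [h2] at h1
  have h3 := ofR_mul_ofU h1 q
  rw [shiftR_zero, map_mul, map_pow, map_pow] at h3
  exact h3

theorem ofR_commute {n : ℕ} (q q' : Rh n) : Commute (ofR q : U' n) (ofR q') := by
  rw [Commute, SemiconjBy, ← map_mul, mul_comm, map_mul]

theorem pFactor_ofR_smul {n : ℕ} {i j : Fin n} (hij : i < j) (q : Rh n) (m : M' n) :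
    pFactor i j (ofR q • m) = ofR q • pFactor i j m := by
  rw [pFactor_eq_pairSum, pFactor_eq_pairSum]
  exact pairSum_smul_of_commute hij
    (fun k => ((ofR_commute_pair i j q k).mul_right (ofR_commute q _)).symm) m

theorem pFactor_e_smul {n : ℕ} {i j a b : Fin n} (hij : i < j) (hai : a ≠ i) (haj : a ≠ j)
    (hbi : b ≠ i) (hbj : b ≠ j) (m : M' n) :
    pFactor i j (e a b • m) = e a b • pFactor i j m := by
  rw [pFactor_eq_pairSum, pFactor_eq_pairSum]
  refine pairSum_smul_of_commute hij (fun k => ?_) m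
  refine (((e_commute hai.symm hbj.symm).pow_left k).mul_left
    ((e_commute haj.symm hbi.symm).pow_left k)).mul_left ?_
  have h1 := ofR_phi_mul_e (i := i) (j := j) a b 0 0 k (by
    rw [wt_sub_apply, wt_sub_apply]; simp [hai.symm, haj.symm, hbi.symm, hbj.symm])
  simp only [Int.cast_zero, add_zero] at h1
  exact h1

theorem pFactor_e_pow_smul {n : ℕ} {i j a b : Fin n} (hij : i < j) (hai : a ≠ i) (haj : a ≠ j)
    (hbi : b ≠ i) (hbj : b ≠ j) (k : ℕ) (m : M' n) :
    pFactor i j (e a b ^ k • m) = e a b ^ k • pFactor i j m := by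
  induction k with
  | zero => simp
  | succ k ih => rw [pow_succ', mul_smul, mul_smul, pFactor_e_smul hij hai haj hbi hbj, ih]

theorem pFactor_comm {n : ℕ} {i j a b : Fin n} (hij : i < j) (hab : a < b) (hai : a ≠ i)
    (haj : a ≠ j) (hbi : b ≠ i) (hbj : b ≠ j) (m : M' n) :
    pFactor i j (pFactor a b m) = pFactor a b (pFactor i j m) := by
  obtain ⟨K, hK⟩ := exists_pow_smul_eq_zero hab m
  have h1 := hK K le_rfl
  have h2 : e a b ^ K • pFactor i j m = 0 := by
    rw [← pFactor_e_pow_smul hij hai haj hbi hbj, h1, pFactor_zero hij]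
  rw [pFactor_eq_pairSum a b, pFactor_eq_pairSum a b, pairSum_eq_sum h1, pairSum_eq_sum h2]
  rw [show pFactor i j = AddMonoidHom.mk' (pFactor i j) (pFactor_add (n := n) hij) from rfl,
    map_sum]
  refine Finset.sum_congr rfl fun k _ => ?_
  simp only [AddMonoidHom.mk'_apply, mul_smul]
  rw [pFactor_e_pow_smul hij hbi hbj hai haj, pFactor_e_pow_smul hij hai haj hbi hbj,
    pFactor_ofR_smul hij]

theorem pFactor_of_e_smul_eq_zero {n : ℕ} {i j : Fin n} {m : M' n} (hm : e i j • m = 0) :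
    pFactor i j m = m := by
  rw [pFactor_eq_pairSum, pairSum_eq_sum (K := 1) (by rwa [pow_one])]
  simp [phi_zero]

theorem pFactor_e_opposite_smul {n : ℕ} {i j : Fin n} (hij : (j : ℕ) = i + 1) (m : M' n) :
    pFactor i j (e j i • m) = 0 := by
  rw [pFactor_eq_pT, pT_e_opposite (by omega), hij]
  simp

theorem e_smul_pFactor {n : ℕ} {i j : Fin n} (hij : (j : ℕ) = i + 1) (m : M' n) :
    e i j • pFactor i j m = 0 := by
  rw [pFactor_eq_pT, e_pT (by omega), hij]
  simp

/-- The product `p_ij p_kj` with `k = i + 1` carries the simple lowering operator `E_ki` to the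
left. -/
theorem pFactor_pFactor_e_smul {n : ℕ} {i k j : Fin n} (hik : (k : ℕ) = i + 1) (hkj : k < j)
    (m : M' n) :
    pFactor i j (pFactor k j (e k i • m)) = e k i • pT i j (-1) (pT k j 1 m) := by
  have hki : k ≠ i := by intro h0; rw [h0] at hik; omega
  have hij : i < j := by omega
  rw [pFactor_eq_pT, pFactor_eq_pT, pT_e_right hkj hki hij.ne, pT_add hij,
    pT_e_left hij hki hkj.ne, pT_e_opposite hij, zero_add, e_pT hkj, pD_zsmul hij,
    smul_comm (e j i), hik]
  norm_num
  generalize e j i • pD i j (-2) (pD k j (-1) (e k j • m)) = x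
  generalize e k i • pT i j (-1) (pT k j 1 m) = y
  module

/-- The product `p_ki p_kj` with `j = i + 1` preserves the kernel of the simple raising operator
`E_ij`. -/
theorem e_smul_pFactor_pFactor {n : ℕ} {i k j : Fin n} (hij : (j : ℕ) = i + 1) (hki : k < i)
    {m : M' n} (hm : e i j • m = 0) : e i j • pFactor k i (pFactor k j m) = 0 := by
  have hne : i ≠ j := by intro h0; rw [h0] at hij; omega
  have hkj : k < j := by omega
  rw [pFactor_eq_pT, pFactor_eq_pT, e_pT_left hki hne hkj.ne, e_pT_right hkj hne hki.ne, hm,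
    pT_zero hkj, zero_add, zero_add, pT_e_opposite hki, e_pT hkj, pD_zsmul hki,
    smul_comm (e i k), hij]
  norm_num
  generalize e i k • pD k i (-1) (pD k j (-2) (e k j • m)) = x
  module

theorem finRange_split {n : ℕ} {i k : Fin n} (hik : (k : ℕ) = i + 1) :
    ∃ s t : List (Fin n), List.finRange n = s ++ i :: k :: t ∧ (∀ x ∈ s, x < i) ∧
      (∀ x ∈ t, k < x) ∧ s.Nodup := by
  have hp : (List.finRange n).Pairwise (· < ·) := List.pairwise_lt_finRange n
  obtain ⟨s, t, hst⟩ := List.append_of_mem (List.mem_finRange i)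
  rw [hst] at hp
  obtain ⟨hs, hit, hsi⟩ := List.pairwise_append.mp hp
  have hk : k ∈ s ++ i :: t := hst ▸ List.mem_finRange k
  have hs' : ∀ x ∈ s, x < i := fun x hx => hsi x hx i (by simp)
  rw [List.pairwise_cons] at hit
  have hkt : k ∈ t := by
    rcases List.mem_append.mp hk with h1 | h1
    · have := hs' k h1; omega
    · rcases List.mem_cons.mp h1 with h2 | h2
      · rw [h2] at hik; omega
      · exact h2
  obtain _ | ⟨x, t⟩ := t
  · simp at hkt
  · have h1 := hit.1 x (by simp)
    have h2 := List.pairwise_cons.mp hit.2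
    have hx : x = k := by
      rcases List.mem_cons.mp hkt with h3 | h3
      · exact h3.symm
      · have := h2.1 k h3; omega
    subst hx
    exact ⟨s, t, hst, hs', h2.1, hs.imp fun h => h.ne⟩

/-- The product of the factors `p_ij` over the list `l` of first indices `i`. -/
def colProj {n : ℕ} (l : List (Fin n)) (j : Fin n) (m : M' n) : M' n :=
  l.foldr (fun i m => pFactor i j m) m

theorem colProj_append {n : ℕ} (l l' : List (Fin n)) (j : Fin n) (m : M' n) :
    colProj (l ++ l') j m = colProj l j (colProj l' j m) := List.foldr_append

theorem colProj_cons {n : ℕ} (i : Fin n) (l : List (Fin n)) (j : Fin n) (m : M' n) :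
    colProj (i :: l) j m = pFactor i j (colProj l j m) := rfl

/-- The columns of the extremal projector. -/
theorem extProj_eq {n : ℕ} (m : M' n) :
    extProj m = (List.finRange n).foldr
      (fun j m => colProj ((List.finRange n).filter fun i => i < j) j m) m := by
  unfold extProj posRoots
  rw [List.foldr_flatMap]
  simp only [List.foldr_map]
  rfl

theorem colProj_zero {n : ℕ} {l : List (Fin n)} {j : Fin n} (hl : ∀ x ∈ l, x < j) :
    colProj l j (0 : M' n) = 0 := by
  induction l with
  | nil => rfl
  | cons a l ih =>
    rw [colProj_cons, ih fun x hx => hl x (by simp [hx]), pFactor_zero (hl a (by simp))]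

theorem colProj_add {n : ℕ} {l : List (Fin n)} {j : Fin n} (hl : ∀ x ∈ l, x < j) (m m' : M' n) :
    colProj l j (m + m') = colProj l j m + colProj l j m' := by
  induction l with
  | nil => rfl
  | cons a l ih =>
    rw [colProj_cons, ih fun x hx => hl x (by simp [hx]), pFactor_add (hl a (by simp))]
    rfl

theorem colProj_e_smul {n : ℕ} {l : List (Fin n)} {j a b : Fin n} (hl : ∀ x ∈ l, x < j)
    (ha : a ∉ l) (hb : b ∉ l) (haj : a ≠ j) (hbj : b ≠ j) (m : M' n) :
    colProj l j (e a b • m) = e a b • colProj l j m := by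
  induction l with
  | nil => rfl
  | cons x l ih =>
    simp only [List.mem_cons, not_or] at ha hb
    rw [colProj_cons, ih (fun x hx => hl x (by simp [hx])) ha.2 hb.2,
      pFactor_e_smul (hl x (by simp)) ha.1 haj hb.1 hbj]
    rfl

theorem colProj_pFactor {n : ℕ} {l : List (Fin n)} {j a b : Fin n} (hl : ∀ x ∈ l, x < j)
    (hab : a < b) (ha : a ∉ l) (hb : b ∉ l) (haj : a ≠ j) (hbj : b ≠ j) (m : M' n) :
    colProj l j (pFactor a b m) = pFactor a b (colProj l j m) := by
  induction l with
  | nil => rfl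
  | cons x l ih =>
    simp only [List.mem_cons, not_or] at ha hb
    rw [colProj_cons, ih (fun x hx => hl x (by simp [hx])) ha.2 hb.2,
      pFactor_comm (hl x (by simp)) hab ha.1 haj hb.1 hbj]
    rfl

theorem mem_filter_lt {n : ℕ} (j : Fin n) :
    ∀ x ∈ (List.finRange n).filter fun i => i < j, x < j := by
  intro x hx
  simpa using (List.mem_filter.mp hx).2

/-- A column to the right of the simple root carries the lowering operator to the left. -/
theorem colProj_e_smul_of_lt {n : ℕ} {i k j : Fin n} (hik : (k : ℕ) = i + 1) (hkj : k < j)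
    (m : M' n) : ∃ m', colProj ((List.finRange n).filter fun i => i < j) j (e k i • m)
      = e k i • m' := by
  obtain ⟨s, t, hst, hs, ht, -⟩ := finRange_split hik
  have hij : i < j := by omega
  rw [hst, List.filter_append, List.filter_cons_of_pos (by simpa using hij),
    List.filter_cons_of_pos (by simpa using hkj), colProj_append, colProj_cons, colProj_cons]
  have hne : ∀ x ∈ t, i ≠ x ∧ k ≠ x := fun x hx => by
    have := ht x hx
    constructor <;> (intro h0; subst h0; omega)
  have hne' : ∀ x ∈ s, i ≠ x ∧ k ≠ x := fun x hx => by
    have := hs x hx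
    constructor <;> (intro h0; subst h0; omega)
  rw [colProj_e_smul (fun x hx => by simpa using (List.mem_filter.mp hx).2)
      (fun hx => (hne k (List.mem_filter.mp hx).1).2 rfl)
      (fun hx => (hne i (List.mem_filter.mp hx).1).1 rfl) hkj.ne hij.ne,
    pFactor_pFactor_e_smul hik hkj,
    colProj_e_smul (fun x hx => by simpa using (List.mem_filter.mp hx).2)
      (fun hx => (hne' k (List.mem_filter.mp hx).1).2 rfl)
      (fun hx => (hne' i (List.mem_filter.mp hx).1).1 rfl) hkj.ne hij.ne]
  exact ⟨_, rfl⟩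

theorem filter_lt_succ {n : ℕ} {i k : Fin n} (hik : (k : ℕ) = i + 1) {s t : List (Fin n)}
    (hst : List.finRange n = s ++ i :: k :: t) (hs : ∀ x ∈ s, x < i) (ht : ∀ x ∈ t, k < x) :
    ((List.finRange n).filter fun x => x < k) = s ++ [i] ∧
      ((List.finRange n).filter fun x => x < i) = s := by
  have h1 : (s.filter fun x => x < k) = s := List.filter_eq_self.mpr fun x hx => by
    have := hs x hx
    simp; omega
  have h2 : (s.filter fun x => x < i) = s := List.filter_eq_self.mpr fun x hx => by
    have := hs x hx
    simp; omega
  have h3 : (t.filter fun x => x < k) = [] := List.filter_eq_nil_iff.mpr fun x hx => by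
    have := ht x hx
    simp; omega
  have h4 : (t.filter fun x => x < i) = [] := List.filter_eq_nil_iff.mpr fun x hx => by
    have := ht x hx
    simp; omega
  have h5 : i < k := by omega
  rw [hst, List.filter_append, List.filter_append, h1, h2]
  simp [h3, h4, h5, h5.le]

theorem foldr_zero {n : ℕ} (l : List (Fin n)) :
    l.foldr (fun j m => colProj ((List.finRange n).filter fun i => i < j) j m) (0 : M' n) = 0 := by
  induction l with
  | nil => rfl
  | cons a l ih => rw [List.foldr_cons, ih, colProj_zero (mem_filter_lt a)]

/-- For a simple root `(i, k)`, the lowering operator passes through the columns to the right of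
`k` and is annihilated by `p_ik`, the last factor of column `k`. -/
theorem extProj_simple_smul {n : ℕ} {i k : Fin n} (hik : (k : ℕ) = i + 1) (m : M' n) :
    extProj (e k i • m) = 0 := by
  obtain ⟨s, t, hst, hs, ht, -⟩ := finRange_split hik
  rw [extProj_eq]
  have h1 : ∀ l : List (Fin n), (∀ x ∈ l, k < x) → ∃ m', l.foldr
      (fun j m => colProj ((List.finRange n).filter fun i => i < j) j m) (e k i • m)
        = e k i • m' := by
    intro l
    induction l with
    | nil => exact fun _ => ⟨m, rfl⟩
    | cons a l ih =>
      intro hl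
      obtain ⟨m', hm'⟩ := ih fun x hx => hl x (by simp [hx])
      rw [List.foldr_cons, hm']
      exact colProj_e_smul_of_lt hik (hl a (by simp)) m'
  obtain ⟨m', hm'⟩ := h1 t ht
  have h2 : colProj ((List.finRange n).filter fun i => i < k) k (e k i • m') = 0 := by
    rw [(filter_lt_succ hik hst hs ht).1, colProj_append, colProj_cons]
    change colProj s k (pFactor i k (e k i • m')) = 0
    rw [pFactor_e_opposite_smul hik, colProj_zero fun x hx => (hs x hx).trans (by omega)]
  have h3 : (List.finRange n).foldr
      (fun j m => colProj ((List.finRange n).filter fun i => i < j) j m) (e k i • m)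
      = (s ++ i :: k :: t).foldr
      (fun j m => colProj ((List.finRange n).filter fun i => i < j) j m) (e k i • m) := by
    congr 1
  rw [h3, List.foldr_append, List.foldr_cons, List.foldr_cons, hm', h2,
    colProj_zero (mem_filter_lt i), foldr_zero]

/-- The columns of two neighbouring indices `i, k`, without the factor `p_ik`, can be interleaved to
a product of pairs `p_xi p_xk`, each of which preserves the kernel of `E_ik`. -/
theorem e_smul_colProj_colProj {n : ℕ} {i k : Fin n} (hik : (k : ℕ) = i + 1) {m : M' n}
    (hm : e i k • m = 0) (l : List (Fin n)) (hl : ∀ x ∈ l, x < i) (hd : l.Nodup) :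
    e i k • colProj l i (colProj l k m) = 0 := by
  induction l with
  | nil => exact hm
  | cons a l ih =>
    have hai := hl a (by simp)
    have hl' : ∀ x ∈ l, x < i := fun x hx => hl x (by simp [hx])
    rw [List.nodup_cons] at hd
    rw [colProj_cons, colProj_cons, colProj_pFactor hl' (by omega) hd.1
      (fun hx => by have := hl' k hx; omega) hai.ne (by intro h0; rw [h0] at hik; omega)]
    exact e_smul_pFactor_pFactor hik hai (ih hl' hd.2)

/-- For a simple root `(i, k)`, the raising operator passes through the columns to the left of `i`;
the remaining product of the columns `i` and `k` maps into the kernel of `E_ik`, because its factor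
`p_ik` does so and the other factors preserve this kernel. -/
theorem simple_smul_extProj {n : ℕ} {i k : Fin n} (hik : (k : ℕ) = i + 1) (m : M' n) :
    e i k • extProj m = 0 := by
  obtain ⟨s, t, hst, hs, ht, hd⟩ := finRange_split hik
  obtain ⟨f1, f2⟩ := filter_lt_succ hik hst hs ht
  rw [extProj_eq]
  have h3 : (List.finRange n).foldr
      (fun j m => colProj ((List.finRange n).filter fun i => i < j) j m) m
      = (s ++ i :: k :: t).foldr
      (fun j m => colProj ((List.finRange n).filter fun i => i < j) j m) m := by
    congr 1
  rw [h3, List.foldr_append, List.foldr_cons, List.foldr_cons, f1, f2, colProj_append]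
  set m' := colProj [i] k (t.foldr
    (fun j m => colProj ((List.finRange n).filter fun i => i < j) j m) m)
  have h4 : e i k • m' = 0 := e_smul_pFactor hik _
  have h5 := e_smul_colProj_colProj hik h4 s hs hd
  generalize colProj s i (colProj s k m') = m'' at h5
  clear h3 hst f1 f2 hd
  induction s with
  | nil => exact h5
  | cons a s ih =>
    rw [List.foldr_cons, ← colProj_e_smul (mem_filter_lt a), ih fun x hx => hs x (by simp [hx]),
      colProj_zero (mem_filter_lt a)]
    · intro hx
      have := mem_filter_lt a i hx
      have := hs a (by simp)
      omega
    · intro hx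
      have := mem_filter_lt a k hx
      have := hs a (by simp)
      omega
    · exact (hs a (by simp)).ne'
    · have := hs a (by simp)
      intro h0
      rw [h0] at hik
      omega

theorem extProj_add {n : ℕ} (m m' : M' n) : extProj (m + m') = extProj m + extProj m' := by
  rw [extProj_eq, extProj_eq, extProj_eq]
  generalize hL : (fun (j : Fin n) (m : M' n) =>
    colProj ((List.finRange n).filter fun i => i < j) j m) = f
  have hf : ∀ j m m', f j (m + m') = f j m + f j m' := by
    subst hL
    exact fun j m m' => colProj_add (mem_filter_lt j) m m'
  induction List.finRange n with
  | nil => rfl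
  | cons a l ih => rw [List.foldr_cons, ih, hf]; rfl

/-- The extremal projector as an additive map. -/
def extHom (n : ℕ) : M' n →+ M' n := AddMonoidHom.mk' extProj extProj_add

/-- A property stable under all factors `p_ij` is stable under the extremal projector. -/
theorem extProj_induction {n : ℕ} {P : M' n → Prop}
    (hP : ∀ i j : Fin n, i < j → ∀ m, P m → P (pFactor i j m)) {m : M' n} (hm : P m) :
    P (extProj m) := by
  have h1 : ∀ l : List (Fin n × Fin n), (∀ r ∈ l, r.1 < r.2) →
      P (l.foldr (fun r m => pFactor r.1 r.2 m) m) := by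
    intro l
    induction l with
    | nil => exact fun _ => hm
    | cons r l ih =>
      exact fun hl => hP _ _ (hl r (by simp)) _ (ih fun x hx => hl x (by simp [hx]))
  refine h1 _ fun r hr => ?_
  obtain ⟨j, -, hr⟩ := List.mem_flatMap.mp hr
  obtain ⟨i, hi, rfl⟩ := List.mem_map.mp hr
  exact mem_filter_lt j i hi

/-- The extremal projector fixes the vectors annihilated by `t^+`. -/
theorem extProj_of_singular {n : ℕ} {m : M' n} (hm : ∀ i j : Fin n, i < j → e i j • m = 0) :
    extProj m = m :=
  extProj_induction (P := fun x => x = m)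
    (fun i j hij x hx => by subst hx; exact pFactor_of_e_smul_eq_zero (hm i j hij)) rfl

/-- A vector annihilated by the simple raising operators is annihilated by `t^+`, as the simple
root vectors generate `t^+`. -/
theorem e_smul_eq_zero_of_simple {n : ℕ} {m : M' n}
    (hm : ∀ i k : Fin n, (k : ℕ) = i + 1 → e i k • m = 0) {i j : Fin n} (hij : i < j) :
    e i j • m = 0 := by
  obtain ⟨d, hd⟩ : ∃ d, (j : ℕ) = i + 1 + d := ⟨j - (i + 1), by omega⟩
  induction d generalizing j with
  | zero => exact hm i j hd
  | succ d ih =>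
    let k : Fin n := ⟨i + 1 + d, by omega⟩
    have hk : (k : ℕ) = i + 1 + d := rfl
    have h1 := ih (j := k) (by omega) hk
    have h2 := hm k j (by omega)
    have hne : i ≠ j := hij.ne
    have h3 : (e i j : U' n) = e i k * e k j - e k j * e i k := by
      rw [e_mul_e]; simp [hne]
    rw [h3, sub_smul, mul_smul, mul_smul, h1, h2, smul_zero, smul_zero, sub_zero]

/-- The extremal projector annihilates `t^- M'`. -/
theorem extProj_lower_smul {n : ℕ} {i j : Fin n} (hij : i < j) (m : M' n) :
    extProj (e j i • m) = 0 := by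
  obtain ⟨d, hd⟩ : ∃ d, (j : ℕ) = i + 1 + d := ⟨j - (i + 1), by omega⟩
  induction d generalizing i m with
  | zero => exact extProj_simple_smul hd m
  | succ d ih =>
    let k : Fin n := ⟨i + 1, by omega⟩
    have hk : (k : ℕ) = i + 1 := rfl
    have hne : i ≠ j := hij.ne
    have h3 : (e j i : U' n) = e j k * e k i - e k i * e j k := by
      rw [e_mul_e]; simp [hne.symm]
    rw [h3, sub_smul, mul_smul, mul_smul, sub_eq_add_neg, ← smul_neg, extProj_add,
      extProj_simple_smul hk, ih (i := k) (by omega) _ (by omega), add_zero]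

/-- The image of the extremal projector is annihilated by `t^+`. -/
theorem raise_smul_extProj {n : ℕ} {i j : Fin n} (hij : i < j) (m : M' n) :
    e i j • extProj m = 0 :=
  e_smul_eq_zero_of_simple (fun _ _ hik => simple_smul_extProj hik m) hij

/-- The Mickelsson-Zhelobenko algebra contains the vectors of `M'` annihilated by `t^+`. -/
theorem mem_Z_of_singular {n : ℕ} {m : M' n} (hm : ∀ i j : Fin n, i < j → e i j • m = 0) :
    m ∈ Z n := by
  obtain ⟨v, rfl⟩ := (J' n).mkQ_surjective m
  refine ⟨v, fun x hx => ?_, rfl⟩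
  induction hx using Submodule.span_induction with
  | mem x hx =>
    obtain ⟨i, j, hij, rfl⟩ := hx
    have h1 := hm i j hij
    rw [← map_smul] at h1
    exact (Submodule.Quotient.mk_eq_zero _).mp h1
  | zero => rw [zero_mul]; exact zero_mem _
  | add x y _ _ hx hy => rw [add_mul]; exact add_mem hx hy
  | smul a x _ hx => rw [smul_eq_mul, mul_assoc]; exact (J' n).smul_mem a hx

theorem pOf_mem_Z {n : ℕ} (u : U n) : pOf u ∈ Z n :=
  mem_Z_of_singular fun _ _ hij => raise_smul_extProj hij _

/-! ### Right multiplication by `R(h)` and weights in `M'` -/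

theorem J'_mul_ofR {n : ℕ} (q : Rh n) {x : U' n} (hx : x ∈ J' n) : x * ofR q ∈ J' n := by
  induction hx using Submodule.span_induction with
  | mem x hx =>
    obtain ⟨i, j, hij, rfl⟩ := hx
    rw [ofU_mul_ofR (hasWt_E_sub i j)]
    exact (J' n).smul_mem _ (Submodule.subset_span ⟨i, j, hij, rfl⟩)
  | zero => rw [zero_mul]; exact zero_mem _
  | add x y _ _ hx hy => rw [add_mul]; exact add_mem hx hy
  | smul a x _ hx => rw [smul_eq_mul, mul_assoc]; exact (J' n).smul_mem a hx

/-- Right multiplication by an element of `R(h)` on `M'`; it is well defined as `J'` is stable under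
right multiplication by `R(h)`. -/
def rho {n : ℕ} (q : Rh n) : M' n →ₗ[U' n] M' n :=
  Submodule.mapQ (J' n) (J' n) (LinearMap.toSpanSingleton (U' n) (U' n) (ofR q))
    fun _ hx => J'_mul_ofR q hx

theorem rho_cls {n : ℕ} (q : Rh n) (x : U' n) : rho q (cls x) = cls (x * ofR q) := rfl

theorem rho_rho {n : ℕ} (q q' : Rh n) (m : M' n) : rho q (rho q' m) = rho (q * q') m := by
  obtain ⟨x, rfl⟩ := (J' n).mkQ_surjective m
  change rho q (rho q' (cls x)) = rho (q * q') (cls x)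
  rw [rho_cls, rho_cls, rho_cls, mul_assoc, ← map_mul, mul_comm q]

theorem rho_add {n : ℕ} (q q' : Rh n) (m : M' n) : rho (q + q') m = rho q m + rho q' m := by
  obtain ⟨x, rfl⟩ := (J' n).mkQ_surjective m
  change rho (q + q') (cls x) = rho q (cls x) + rho q' (cls x)
  rw [rho_cls, rho_cls, rho_cls, map_add, mul_add, map_add]

theorem rho_one {n : ℕ} (m : M' n) : rho 1 m = m := by
  obtain ⟨x, rfl⟩ := (J' n).mkQ_surjective m
  change rho 1 (cls x) = cls x
  rw [rho_cls, map_one, mul_one]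

theorem rho_zero {n : ℕ} (m : M' n) : rho 0 m = 0 := by
  obtain ⟨x, rfl⟩ := (J' n).mkQ_surjective m
  change rho 0 (cls x) = 0
  rw [rho_cls, map_zero, mul_zero, map_zero]

theorem rho_neg {n : ℕ} (q : Rh n) (m : M' n) : rho (-q) m = -rho q m := by
  rw [eq_neg_iff_add_eq_zero, ← rho_add, neg_add_cancel, rho_zero]

theorem rho_sum {n : ℕ} {ι : Type*} (s : Finset ι) (q : ι → Rh n) (m : M' n) :
    rho (∑ i ∈ s, q i) m = ∑ i ∈ s, rho (q i) m :=
  map_sum (AddMonoidHom.mk' (fun q => rho q m) fun q q' => rho_add q q' m) q s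

/-- `m` is a vector of weight `w` for the difference of the left and the right action of `h`. -/
def IsWt {n : ℕ} (w : Fin n → ℂ) (m : M' n) : Prop := ∀ q, ofR q • m = rho (shiftR w q) m

theorem isWt_cls {n : ℕ} {w : Fin n → ℂ} {u : U n} (hu : HasWt w u) : IsWt w (cls (ofU u)) := by
  intro q
  rw [rho_cls, ← ofR_mul_ofU hu, ← map_smul, smul_eq_mul]

theorem IsWt.add {n : ℕ} {w : Fin n → ℂ} {m m' : M' n} (hm : IsWt w m) (hm' : IsWt w m') :
    IsWt w (m + m') := fun q => by rw [smul_add, hm, hm', map_add]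

theorem IsWt.sum {n : ℕ} {w : Fin n → ℂ} {ι : Type*} {s : Finset ι} {f : ι → M' n}
    (hf : ∀ i ∈ s, IsWt w (f i)) : IsWt w (∑ i ∈ s, f i) := fun q => by
  rw [Finset.smul_sum, map_sum]
  exact Finset.sum_congr rfl fun i hi => hf i hi q

theorem IsWt.rho {n : ℕ} {w : Fin n → ℂ} {m : M' n} (hm : IsWt w m) (q : Rh n) :
    IsWt w (rho q m) := fun q' => by
  rw [← map_smul, hm, rho_rho, rho_rho, mul_comm]

theorem IsWt.neg {n : ℕ} {w : Fin n → ℂ} {m : M' n} (hm : IsWt w m) : IsWt w (-m) := fun q => by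
  rw [smul_neg, hm, map_neg]

theorem shiftR_add {n : ℕ} (w w' : Fin n → ℂ) (q : Rh n) :
    shiftR w (shiftR w' q) = shiftR (w + w') q := by
  have h1 : ∀ f : Uh n, shift w (shift w' f) = shift (w + w') f := by
    intro f
    have h2 : (shift w).comp (shift w') = shift (w + w') := by
      ext i : 1
      simp [shift]
      ring
    exact DFunLike.congr_fun h2 f
  obtain ⟨f, s, hs, rfl⟩ := IsFractionRing.div_surjective (A := Uh n) q
  simp [map_div₀, shiftR_algebraMap, h1]

theorem IsWt.e_smul {n : ℕ} {w : Fin n → ℂ} {m : M' n} (hm : IsWt w m) (i j : Fin n) :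
    IsWt (w + (wt i - wt j)) (e i j • m) := fun q => by
  rw [smul_smul, ofR_mul_e, mul_smul, hm, map_smul, shiftR_add]

theorem e_self_sub_smul {n : ℕ} {w : Fin n → ℂ} {m : M' n} (hm : IsWt w m) (i j : Fin n) :
    e i i • m - e j j • m = rho (h i - h j + (((i : ℕ) : Rh n) - ((j : ℕ) : Rh n))
      + algebraMap ℂ (Rh n) (w i - w j)) m := by
  rw [← sub_smul, e_self_sub, hm]
  congr 1
  rw [map_add, map_sub, map_sub, shiftR_h, shiftR_h, map_natCast, map_natCast, map_sub]
  congr 1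
  ring

/-! ### Sums over increasing sequences -/

/-- The increasing sequences from `i` to `j` of arbitrary length. -/
def chainSet {n : ℕ} (i j : Fin n) : Finset (Finset (Fin n)) :=
  (Finset.Icc i j).powerset.filter fun I => i ∈ I ∧ j ∈ I

theorem mem_chainSet {n : ℕ} {i j : Fin n} {I : Finset (Fin n)} :
    I ∈ chainSet i j ↔ (∀ x ∈ I, i ≤ x ∧ x ≤ j) ∧ i ∈ I ∧ j ∈ I := by
  simp [chainSet, Finset.subset_iff]

theorem sum_chains {n : ℕ} {A : Type*} [AddCommMonoid A] (i j : Fin n)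
    (f : ℕ → Finset (Fin n) → A) :
    ∑ s ∈ Finset.Icc 1 ((j : ℕ) - (i : ℕ) + 1), ∑ I ∈ chains i j s, f s I
      = ∑ I ∈ chainSet i j, f I.card I := by
  rw [← Finset.sum_fiberwise_of_maps_to (s := chainSet i j)
    (t := Finset.Icc 1 ((j : ℕ) - (i : ℕ) + 1)) (g := Finset.card)]
  · refine Finset.sum_congr rfl fun s _ => ?_
    have h1 : chains i j s = (chainSet i j).filter fun I => I.card = s := by
      ext I
      simp only [chains, chainSet, Finset.mem_filter]
      tauto
    rw [h1]
    refine Finset.sum_congr rfl fun I hI => ?_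
    rw [(Finset.mem_filter.mp hI).2]
  · intro I hI
    have h1 := mem_chainSet.mp hI
    have hsub : I ⊆ Finset.Icc i j := fun x hx => Finset.mem_Icc.mpr (h1.1 x hx)
    have h2 := Finset.card_le_card hsub
    rw [Fin.card_Icc] at h2
    have h3 : (i : ℕ) ≤ j := (h1.1 i h1.2.1).2
    have h4 := Finset.card_pos.mpr ⟨i, h1.2.1⟩
    rw [Finset.mem_Icc]
    omega

theorem chainSet_self {n : ℕ} (i : Fin n) : chainSet i i = {{i}} := by
  ext I
  rw [mem_chainSet, Finset.mem_singleton]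
  constructor
  · rintro ⟨h1, h2, -⟩
    ext x
    rw [Finset.mem_singleton]
    constructor
    · intro hx
      exact le_antisymm (h1 x hx).2 (h1 x hx).1
    · rintro rfl
      exact h2
  · rintro rfl
    simp

theorem sum_chainSet_of_lt {n : ℕ} {A : Type*} [AddCommMonoid A] {i j : Fin n} (hij : i < j)
    (f : Finset (Fin n) → A) :
    ∑ I ∈ chainSet i j, f I = ∑ m ∈ Finset.Ioc i j, ∑ J ∈ chainSet m j, f (insert i J) := by
  rw [Finset.sum_sigma']
  symm
  have hnot : ∀ {m : Fin n} {J : Finset (Fin n)}, m ∈ Finset.Ioc i j → J ∈ chainSet m j →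
      i ∉ J := by
    intro m J hm hJ hi
    have h1 := ((mem_chainSet.mp hJ).1 i hi).1
    have h2 := (Finset.mem_Ioc.mp hm).1
    omega
  refine Finset.sum_bij (fun x _ => insert i x.2) ?_ ?_ ?_ ?_
  · rintro ⟨m, J⟩ hx
    obtain ⟨hm, hJ⟩ := Finset.mem_sigma.mp hx
    have h1 := mem_chainSet.mp hJ
    have h2 := Finset.mem_Ioc.mp hm
    rw [mem_chainSet]
    refine ⟨fun x hx => ?_, by simp, by simp [h1.2.2]⟩
    rcases Finset.mem_insert.mp hx with rfl | hx
    · exact ⟨le_rfl, hij.le⟩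
    · exact ⟨h2.1.le.trans (h1.1 x hx).1, (h1.1 x hx).2⟩
  · rintro ⟨m, J⟩ hx ⟨m', J'⟩ hx' heq
    obtain ⟨hm, hJ⟩ : m ∈ Finset.Ioc i j ∧ J ∈ chainSet m j := Finset.mem_sigma.mp hx
    obtain ⟨hm', hJ'⟩ : m' ∈ Finset.Ioc i j ∧ J' ∈ chainSet m' j := Finset.mem_sigma.mp hx'
    have h1 : J = J' := by
      rw [← Finset.erase_insert (hnot hm hJ), ← Finset.erase_insert (hnot hm' hJ')]
      exact congrArg (fun s => Finset.erase s i) heq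
    subst h1
    have h2 := mem_chainSet.mp hJ
    have h3 := mem_chainSet.mp hJ'
    have h4 : m = m' := le_antisymm (h2.1 _ h3.2.1).1 (h3.1 _ h2.2.1).1
    subst h4
    rfl
  · intro I hI
    have h1 := mem_chainSet.mp hI
    have hne : (I.erase i).Nonempty := ⟨j, Finset.mem_erase.mpr ⟨hij.ne', h1.2.2⟩⟩
    have hm := Finset.mem_erase.mp ((I.erase i).min'_mem hne)
    refine ⟨⟨(I.erase i).min' hne, I.erase i⟩, ?_, Finset.insert_erase h1.2.1⟩
    refine Finset.mem_sigma.mpr ⟨?_, ?_⟩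
    · exact Finset.mem_Ioc.mpr ⟨lt_of_le_of_ne (h1.1 _ hm.2).1 hm.1.symm, (h1.1 _ hm.2).2⟩
    · rw [mem_chainSet]
      refine ⟨fun x hx => ⟨Finset.min'_le _ _ hx, (h1.1 x (Finset.mem_erase.mp hx).2).2⟩,
        Finset.min'_mem _ hne, Finset.mem_erase.mpr ⟨hij.ne', h1.2.2⟩⟩
  · intro x _
    rfl

/-- The row `∏_l E_kl^(γ_kl)`, `l < k`, of the ordered monomial `E^γ`. -/
def Erow {n : ℕ} (γ : Matrix (Fin n) (Fin n) ℕ) (k : Fin n) : U n :=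
  (((List.finRange n).filter fun l => l < k).map fun l => E k l ^ γ k l).prod

theorem Epow_eq {n : ℕ} (γ : Matrix (Fin n) (Fin n) ℕ) :
    Epow γ = ((List.finRange n).map (Erow γ)).prod := rfl

theorem Erow_eq_one {n : ℕ} {γ : Matrix (Fin n) (Fin n) ℕ} {k : Fin n}
    (hγ : ∀ l < k, γ k l = 0) : Erow γ k = 1 := by
  refine List.prod_eq_one fun x hx => ?_
  obtain ⟨l, hl, rfl⟩ := List.mem_map.mp hx
  rw [hγ l (mem_filter_lt k l hl), pow_zero]

/-- Prepending a factor to an ordered monomial none of whose factors precedes it. -/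
theorem Epow_add_single {n : ℕ} {γ : Matrix (Fin n) (Fin n) ℕ} {m k : Fin n} (hkm : k < m)
    (hγ : ∀ r ≤ m, ∀ l < r, γ r l = 0) :
    Epow (γ + Matrix.single m k 1) = E m k * Epow γ := by
  obtain ⟨s, t, hst⟩ := List.append_of_mem (List.mem_finRange m)
  have hp : (List.finRange n).Pairwise (· < ·) := List.pairwise_lt_finRange n
  rw [hst] at hp
  obtain ⟨-, hmt, hsm⟩ := List.pairwise_append.mp hp
  have hs : ∀ r ∈ s, r < m := fun r hr => hsm r hr m (by simp)
  have ht : ∀ r ∈ t, m < r := (List.pairwise_cons.mp hmt).1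
  have h1 : (s.map (Erow (γ + Matrix.single m k 1))).prod = 1 := by
    refine List.prod_eq_one fun x hx => ?_
    obtain ⟨r, hr, rfl⟩ := List.mem_map.mp hx
    refine Erow_eq_one fun l hl => ?_
    rw [Matrix.add_apply, hγ r (hs r hr).le l hl, Matrix.single_apply_of_row_ne (hs r hr).ne',
      add_zero]
  have h2 : (s.map (Erow γ)).prod = 1 := by
    refine List.prod_eq_one fun x hx => ?_
    obtain ⟨r, hr, rfl⟩ := List.mem_map.mp hx
    exact Erow_eq_one (hγ r (hs r hr).le)
  have h3 : Erow (γ + Matrix.single m k 1) m = E m k := by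
    unfold Erow
    rw [List.prod_map_eq_pow_single k]
    · have h4 : ((List.finRange n).filter fun l => l < m).count k = 1 :=
        List.count_eq_one_of_mem ((List.nodup_finRange n).filter _)
          (List.mem_filter.mpr ⟨List.mem_finRange k, by simpa using hkm⟩)
      rw [h4, pow_one, Matrix.add_apply, hγ m le_rfl k hkm, Matrix.single_apply_same, zero_add,
        pow_one]
    · intro l hl hlm
      rw [Matrix.add_apply, hγ m le_rfl l (mem_filter_lt m l hlm),
        Matrix.single_apply_of_col_ne _ _ (Ne.symm hl), add_zero,
        pow_zero]
  have h5 : t.map (Erow (γ + Matrix.single m k 1)) = t.map (Erow γ) := by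
    refine List.map_congr_left fun r hr => ?_
    unfold Erow
    congr 1
    refine List.map_congr_left fun l _ => ?_
    rw [Matrix.add_apply, Matrix.single_apply_of_row_ne (ht r hr).ne, add_zero]
  rw [Epow_eq, Epow_eq, hst, List.map_append, List.map_append, List.prod_append, List.prod_append,
    h1, h2, List.map_cons, List.map_cons, List.prod_cons, List.prod_cons, h3, h5,
    Erow_eq_one (hγ m le_rfl), one_mul, one_mul, one_mul]

theorem eMat_insert {n : ℕ} {i m j : Fin n} {J : Finset (Fin n)} (him : i < m)
    (hJ : J ∈ chainSet m j) : eMat (insert i J) = eMat J + Matrix.single m i 1 := by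
  obtain ⟨h1, h2, -⟩ := mem_chainSet.mp hJ
  have hi : i ∉ J := fun hi => by have := (h1 i hi).1; omega
  ext k l
  rw [Matrix.add_apply, Matrix.single_apply]
  simp only [eMat, Finset.mem_insert]
  by_cases hl : l = i
  · subst hl
    by_cases hk : m = k
    · subst hk
      have h3 : ∀ x, x = l ∨ x ∈ J → ¬ (l < x ∧ x < m) := by
        rintro x (rfl | hx)
        · simp
        · have := (h1 x hx).1
          rintro ⟨-, h4⟩
          omega
      rw [if_pos ⟨Or.inr h2, Or.inl rfl, him, h3⟩, if_neg (by tauto)]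
      simp
    · refine (if_neg ?_).trans (by rw [if_neg (by tauto), if_neg (by tauto), add_zero])
      rintro ⟨h4, -, h5, h6⟩
      rcases h4 with rfl | h4
      · omega
      · have := (h1 k h4).1
        exact h6 m (Or.inr h2) ⟨him, by omega⟩
  · have hne : ¬ (m = k ∧ i = l) := fun h0 => hl h0.2.symm
    rw [if_neg hne, add_zero]
    refine if_congr ⟨?_, ?_⟩ rfl rfl
    · rintro ⟨h3, h4, h5, h6⟩
      have h4' := h4.resolve_left hl
      have h3' : k ∈ J := h3.resolve_left fun h0 => by
        have := (h1 l h4').1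
        omega
      exact ⟨h3', h4', h5, fun x hx => h6 x (Or.inr hx)⟩
    · rintro ⟨h3, h4, h5, h6⟩
      refine ⟨Or.inr h3, Or.inr h4, h5, ?_⟩
      rintro x (rfl | hx)
      · have := (h1 l h4).1
        omega
      · exact h6 x hx

theorem eMat_eq_zero_of_le {n : ℕ} {m j : Fin n} {J : Finset (Fin n)} (hJ : J ∈ chainSet m j) :
    ∀ r ≤ m, ∀ l < r, eMat J r l = 0 := by
  intro r hr l hl
  unfold eMat
  refine if_neg ?_
  rintro ⟨-, h2, -⟩
  have := ((mem_chainSet.mp hJ).1 l h2).1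
  omega

/-- The monomial of an increasing sequence, with its first step split off. -/
theorem Epow_eMat_insert {n : ℕ} {i m j : Fin n} {J : Finset (Fin n)} (him : i < m)
    (hJ : J ∈ chainSet m j) : Epow (eMat (insert i J)) = E m i * Epow (eMat J) := by
  rw [eMat_insert him hJ, Epow_add_single him (eMat_eq_zero_of_le hJ)]

theorem Epow_eMat_singleton {n : ℕ} (i : Fin n) : Epow (eMat {i}) = (1 : U n) := by
  refine List.prod_eq_one fun x hx => ?_
  obtain ⟨r, -, rfl⟩ := List.mem_map.mp hx
  refine Erow_eq_one fun l hl => if_neg ?_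
  rintro ⟨h1, h2, -⟩
  rw [Finset.mem_singleton] at h1 h2
  omega

/-! ### The formulas for `p B_j^±` -/

theorem h_sub_h_ne_zero {n : ℕ} {i j : Fin n} (hij : i ≠ j) : (h i - h j : Rh n) ≠ 0 := by
  have := h_sub_h_ne hij 0
  simpa using this

theorem h_sub_h_sub_one_ne_zero {n : ℕ} {i j : Fin n} (hij : i ≠ j) :
    (h i - h j - 1 : Rh n) ≠ 0 := by
  have := h_sub_h_ne hij (-1)
  simpa [sub_eq_add_neg] using this

theorem e_smul_cls_one {n : ℕ} {i j : Fin n} (hij : i < j) : e i j • (cls 1 : M' n) = 0 := by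
  rw [← map_smul, smul_eq_mul, mul_one]
  exact (Submodule.Quotient.mk_eq_zero _).mpr (Submodule.subset_span ⟨i, j, hij, rfl⟩)

theorem cls_eq_smul {n : ℕ} (x : U' n) : cls x = x • (cls 1 : M' n) := by
  rw [← map_smul, smul_eq_mul, mul_one]

theorem e_smul_B_neg {n : ℕ} {a b : Fin n} (hab : a < b) (k : Fin n) :
    e a b • (cls (ofU (B false k)) : M' n) = if a = k then -cls (ofU (B false b)) else 0 := by
  rw [cls_eq_smul, smul_smul, e, ← map_mul, E_mul_B_neg, map_sub, map_mul, sub_smul, mul_smul,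
    show ofU (E a b) • (cls 1 : M' n) = 0 from e_smul_cls_one hab, smul_zero, zero_sub]
  split_ifs
  · rw [← cls_eq_smul]
  · simp

/-- The tail of the formula for `p B_j^-`: the sum over the increasing sequences that start at `k`,
with the denominators of `p B_j^-`. -/
def minusTail {n : ℕ} (j k : Fin n) : M' n :=
  ∑ i ∈ Finset.Ici k, ∑ I ∈ chainSet k i,
    rho (∏ l ∈ I.erase k, (h j - h l)⁻¹) (cls (ofU (Epow (eMat I) * B false i)))

theorem minusTail_rec {n : ℕ} (j k : Fin n) :
    minusTail j k = cls (ofU (B false k))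
      + ∑ m ∈ Finset.Ioi k, rho (h j - h m)⁻¹ (e m k • minusTail j m) := by
  have h1 : Finset.Ici k = insert k (Finset.Ioi k) := by
    ext x
    simp only [Finset.mem_Ici, Finset.mem_insert, Finset.mem_Ioi]
    omega
  unfold minusTail
  rw [h1, Finset.sum_insert (by simp), chainSet_self, Finset.sum_singleton, Epow_eMat_singleton,
    Finset.erase_singleton, Finset.prod_empty, rho_one, one_mul]
  congr 1
  have h2 : ∀ i ∈ Finset.Ioi k, ∑ I ∈ chainSet k i,
      rho (∏ l ∈ I.erase k, (h j - h l)⁻¹) (cls (ofU (Epow (eMat I) * B false i)))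
      = ∑ m ∈ Finset.Ioc k i, ∑ J ∈ chainSet m i, rho (h j - h m)⁻¹ (e m k •
        rho (∏ l ∈ J.erase m, (h j - h l)⁻¹) (cls (ofU (Epow (eMat J) * B false i)))) := by
    intro i hi
    rw [sum_chainSet_of_lt (Finset.mem_Ioi.mp hi)]
    refine Finset.sum_congr rfl fun m hm => Finset.sum_congr rfl fun J hJ => ?_
    have hkm := (Finset.mem_Ioc.mp hm).1
    have hJ' := mem_chainSet.mp hJ
    have hk : k ∉ J := fun hk => by have := (hJ'.1 k hk).1; omega
    rw [Finset.erase_insert hk, Epow_eMat_insert hkm hJ, ← map_smul, rho_rho, mul_assoc, map_mul,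
      ← Finset.mul_prod_erase J _ hJ'.2.1, ← smul_eq_mul (a := ofU (E m k)), map_smul]
    rfl
  rw [Finset.sum_congr rfl h2]
  have h3 : ∀ m ∈ Finset.Ioi k, rho (h j - h m)⁻¹ (e m k • ∑ i ∈ Finset.Ici m,
      ∑ I ∈ chainSet m i, rho (∏ l ∈ I.erase m, (h j - h l)⁻¹)
        (cls (ofU (Epow (eMat I) * B false i))))
      = ∑ i ∈ Finset.Ici m, ∑ J ∈ chainSet m i, rho (h j - h m)⁻¹ (e m k •
        rho (∏ l ∈ J.erase m, (h j - h l)⁻¹) (cls (ofU (Epow (eMat J) * B false i)))) := by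
    intro m _
    simp only [Finset.smul_sum, map_sum]
  rw [Finset.sum_congr rfl h3]
  refine Finset.sum_comm' fun i m => ?_
  simp only [Finset.mem_Ioi, Finset.mem_Ioc, Finset.mem_Ici]
  constructor
  · rintro ⟨_, h4, h5⟩
    exact ⟨h5, h4⟩
  · rintro ⟨h4, h5⟩
    exact ⟨h5.trans_le h4, h5, h4⟩

/-- Induction over `Fin n` from the top. -/
theorem fin_top_induction {n : ℕ} {P : Fin n → Prop} (hP : ∀ k, (∀ m, k < m → P m) → P k)
    (k : Fin n) : P k :=
  WellFounded.induction (r := fun a b : Fin n => b < a) (wellFounded_gt) k hP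

theorem isWt_minusTail {n : ℕ} (j k : Fin n) : IsWt (-wt k) (minusTail j k) := by
  induction k using fin_top_induction with
  | hP k ih =>
    rw [minusTail_rec]
    refine IsWt.add ?_ (IsWt.sum fun m hm => IsWt.rho ?_ _)
    · have h1 := isWt_cls (hasWt_B false k)
      convert h1 using 1
      funext i
      simp [wt, Pi.single_apply, sgn]
      split_ifs <;> simp
    · have h1 := (ih m (Finset.mem_Ioi.mp hm)).e_smul m k
      convert h1 using 1
      abel

theorem e_smul_e_smul {n : ℕ} (a b c d : Fin n) (m : M' n) :
    e a b • e c d • m = e c d • e a b • m + (if b = c then e a d • m else 0)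
      - (if a = d then e c b • m else 0) := by
  rw [smul_smul, e_mul_e, sub_smul, add_smul, mul_smul]
  congr 2
  · split_ifs <;> simp
  · split_ifs <;> simp

/-- The action of the simple raising operators on the tails of the formula for `p B_j^-`. -/
theorem e_smul_minusTail {n : ℕ} {a b : Fin n} (hab : (b : ℕ) = a + 1) (j k : Fin n)
    (hjk : j ≤ k) :
    e a b • minusTail j k
      = if a = k then rho ((h a - h j) / (h j - h b)) (minusTail j b) else 0 := by
  have hlt : a < b := by omega
  induction k using fin_top_induction with
  | hP k ih =>
    have hterm : ∀ m ∈ Finset.Ioi k, e a b • rho (h j - h m)⁻¹ (e m k • minusTail j m)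
        = (if a = m then rho (h j - h m)⁻¹
            (e m k • rho ((h a - h j) / (h j - h b)) (minusTail j b)) else 0)
          + (if b = m then rho (h j - h m)⁻¹ (e a k • minusTail j m) else 0)
          - (if a = k then rho (h j - h m)⁻¹ (e m b • minusTail j m) else 0) := by
      intro m hm
      have hkm := Finset.mem_Ioi.mp hm
      rw [← map_smul, e_smul_e_smul, ih m hkm (hjk.trans hkm.le), map_sub, map_add]
      split_ifs <;> simp
    rw [minusTail_rec, smul_add, Finset.smul_sum, e_smul_B_neg hlt, Finset.sum_congr rfl hterm,
      Finset.sum_sub_distrib, Finset.sum_add_distrib, Finset.sum_ite_eq, Finset.sum_ite_eq]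
    simp only [Finset.mem_Ioi]
    rcases lt_trichotomy k a with hka | rfl | hka
    · have hkb : k < b := hka.trans hlt
      have hja : h j - h a ≠ 0 := h_sub_h_ne_zero (by omega)
      rw [if_neg hka.ne', if_neg hka.ne', if_pos hka, if_pos hkb]
      simp only [if_neg hka.ne', Finset.sum_const_zero]
      rw [← map_smul (rho _), rho_rho, zero_add, sub_zero, ← rho_add, map_smul]
      have h1 : (h j - h a)⁻¹ * ((h a - h j) / (h j - h b)) + (h j - h b)⁻¹ = 0 := by
        have hjb : h j - h b ≠ 0 := h_sub_h_ne_zero (by omega)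
        field_simp
        ring
      rw [h1, rho_zero, smul_zero]
    · have hjb : h j - h b ≠ 0 := h_sub_h_ne_zero (by omega)
      simp only [if_true, lt_irrefl, if_false, if_pos hlt, zero_add]
      have h2 : Finset.Ioi k = insert b (Finset.Ioi b) := by
        ext x
        simp only [Finset.mem_insert, Finset.mem_Ioi]
        omega
      have h3 := minusTail_rec j b
      have h4 := e_self_sub_smul (isWt_minusTail j b) k b
      rw [h2, Finset.sum_insert (by simp)]
      have h5 : ∑ m ∈ Finset.Ioi b, rho (h j - h m)⁻¹ (e m b • minusTail j m)
          = minusTail j b - cls (ofU (B false b)) := by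
        rw [h3]; abel
      rw [h5]
      have h6 : rho (h j - h b)⁻¹ (e k k • minusTail j b)
          = rho (h j - h b)⁻¹ (e b b • minusTail j b)
            + rho ((h j - h b)⁻¹ * (h k - h b)) (minusTail j b) := by
        rw [← rho_rho, ← map_add]
        congr 1
        rw [← sub_eq_iff_eq_add', h4]
        congr 1
        simp [wt, hlt.ne, hab]
      have h7 : rho ((h k - h j) / (h j - h b)) (minusTail j b)
          = rho ((h j - h b)⁻¹ * (h k - h b)) (minusTail j b) - minusTail j b := by
        have h8 : (h k - h j) / (h j - h b) = (h j - h b)⁻¹ * (h k - h b) + -1 := by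
          field_simp
          ring
        rw [h8, rho_add, rho_neg, rho_one]
        abel
      rw [h6, h7]
      abel
    · rw [if_neg hka.ne, if_neg hka.ne, if_neg (by omega), if_neg (by omega)]
      simp [hka.ne]

/-- The formula for `p B_j^-`, as a sum over all increasing sequences starting at `j`. -/
theorem pOf_B_neg {n : ℕ} (j : Fin n) : pOf (B false j) = minusTail j j := by
  have hs : ∀ i k : Fin n, i < k → e i k • minusTail j j = 0 := fun i k hik =>
    e_smul_eq_zero_of_simple (fun a b hab => by
      rw [e_smul_minusTail hab j j le_rfl]
      split_ifs with haj
      · rw [haj, sub_self, zero_div, rho_zero]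
      · rfl) hik
  rw [← extProj_of_singular hs]
  have h1 := minusTail_rec j j
  change extHom n _ = extHom n _
  rw [h1, map_add, map_sum, Finset.sum_eq_zero, add_zero]
  intro m hm
  rw [map_smul]
  exact extProj_lower_smul (Finset.mem_Ioi.mp hm) _

/-- The sum over the increasing sequences from `k` to `j` of the monomials `E^(e_I)`, with
coefficients chosen so that the recursion `plusTail_rec` is satisfied. -/
def plusTail {n : ℕ} (j k : Fin n) : M' n :=
  ∑ I ∈ chainSet k j, rho ((-1) ^ (I.card - 1) * ∏ l ∈ I.erase j, (h l - h j - 1)⁻¹)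
    (cls (ofU (Epow (eMat I))))

theorem plusTail_self {n : ℕ} (j : Fin n) : plusTail j j = cls 1 := by
  rw [plusTail, chainSet_self, Finset.sum_singleton, Epow_eMat_singleton]
  simp [rho_one]

theorem not_mem_of_chainSet {n : ℕ} {k m j : Fin n} {J : Finset (Fin n)} (hkm : k < m)
    (hJ : J ∈ chainSet m j) : k ∉ J := fun hk => by
  have := ((mem_chainSet.mp hJ).1 k hk).1
  omega

theorem neg_one_pow_card_insert {n : ℕ} {k m j : Fin n} {J : Finset (Fin n)} (hkm : k < m)
    (hJ : J ∈ chainSet m j) :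
    ((-1 : Rh n)) ^ ((insert k J).card - 1) = -(-1) ^ (J.card - 1) := by
  have h1 := Finset.card_pos.mpr ⟨m, (mem_chainSet.mp hJ).2.1⟩
  rw [Finset.card_insert_of_notMem (not_mem_of_chainSet hkm hJ), Nat.add_sub_cancel]
  obtain ⟨d, hd⟩ := Nat.exists_eq_add_of_le' h1
  rw [hd, pow_succ]
  simp

theorem plusTail_rec {n : ℕ} {j k : Fin n} (hkj : k < j) :
    plusTail j k
      = -rho (h k - h j - 1)⁻¹ (∑ m ∈ Finset.Ioc k j, e m k • plusTail j m) := by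
  unfold plusTail
  rw [sum_chainSet_of_lt hkj, map_sum, ← Finset.sum_neg_distrib]
  refine Finset.sum_congr rfl fun m hm => ?_
  rw [Finset.smul_sum, map_sum, ← Finset.sum_neg_distrib]
  refine Finset.sum_congr rfl fun J hJ => ?_
  have hkm := (Finset.mem_Ioc.mp hm).1
  rw [neg_one_pow_card_insert hkm hJ, Epow_eMat_insert hkm hJ,
    Finset.erase_insert_of_ne hkj.ne, Finset.prod_insert
      (fun hk => not_mem_of_chainSet hkm hJ (Finset.mem_erase.mp hk).2),
    map_mul, ← smul_eq_mul (a := ofU (E m k)), map_smul, map_smul, map_smul, rho_rho, neg_mul,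
    rho_neg, mul_left_comm, smul_neg]
  rfl

theorem isWt_plusTail {n : ℕ} {j k : Fin n} (hkj : k ≤ j) :
    IsWt (wt j - wt k) (plusTail j k) := by
  induction k using fin_top_induction with
  | hP k ih =>
    rcases hkj.eq_or_lt with rfl | hkj
    · rw [plusTail_self, sub_self]
      intro q
      rw [rho_cls, shiftR_zero, ← map_smul, one_mul, smul_eq_mul, mul_one]
    · rw [plusTail_rec hkj]
      refine IsWt.neg (IsWt.rho (IsWt.sum fun m hm => ?_) _)
      have hm' := Finset.mem_Ioc.mp hm
      have h1 := (ih m hm'.1 hm'.2).e_smul m k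
      convert h1 using 1
      abel

/-- The action of the simple raising operators on `plusTail`. -/
theorem e_smul_plusTail {n : ℕ} {a b : Fin n} (hab : (b : ℕ) = a + 1) (j k : Fin n)
    (hkj : k ≤ j) :
    e a b • plusTail j k = if a = k then (if a < j then -plusTail j b else 0) else 0 := by
  have hlt : a < b := by omega
  induction k using fin_top_induction with
  | hP k ih =>
    rcases hkj.eq_or_lt with rfl | hkj
    · rw [plusTail_self, e_smul_cls_one hlt]
      split_ifs with h1 h2
      · omega
      · rfl
      · rfl
    have hterm : ∀ m ∈ Finset.Ioc k j, e a b • e m k • plusTail j m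
        = (if a = m then e m k • (if a < j then -plusTail j b else 0) else 0)
          + (if b = m then e a k • plusTail j m else 0)
          - (if a = k then e m b • plusTail j m else 0) := by
      intro m hm
      have hm' := Finset.mem_Ioc.mp hm
      rw [e_smul_e_smul, ih m hm'.1 hm'.2]
      split_ifs <;> simp
    rw [plusTail_rec hkj, smul_neg, ← map_smul, Finset.smul_sum, Finset.sum_congr rfl hterm,
      Finset.sum_sub_distrib, Finset.sum_add_distrib, Finset.sum_ite_eq, Finset.sum_ite_eq]
    simp only [Finset.mem_Ioc]
    rcases lt_trichotomy k a with hka | rfl | hka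
    · simp only [if_neg hka.ne', Finset.sum_const_zero, sub_zero]
      rcases lt_or_ge a j with haj | haj
      · rw [if_pos ⟨hka, haj.le⟩, if_pos haj, if_pos ⟨hka.trans hlt, by omega⟩, smul_neg,
          neg_add_cancel, map_zero, neg_zero]
      · rw [if_neg haj.not_gt, smul_zero, if_neg (by omega : ¬ (k < b ∧ b ≤ j)), ite_self,
          add_zero, map_zero, neg_zero]
    · have hbj : b ≤ j := by omega
      have h4 := e_self_sub_smul (isWt_plusTail hbj) k b
      simp only [if_true, lt_irrefl, false_and, if_false, if_pos hkj, zero_add,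
        if_pos (And.intro hlt hbj)]
      have h2 : Finset.Ioc k j = insert b (Finset.Ioc b j) := by
        ext x
        simp only [Finset.mem_insert, Finset.mem_Ioc]
        omega
      rw [h2, Finset.sum_insert (by simp), ← sub_sub, h4]
      have h5 : ∑ m ∈ Finset.Ioc b j, e m b • plusTail j m
          = if b = j then 0 else -rho (h b - h j - 1) (plusTail j b) := by
        split_ifs with hbj'
        · subst hbj'; simp
        · have hbj'' : b < j := lt_of_le_of_ne hbj hbj'
          rw [plusTail_rec hbj'', map_neg, rho_rho,
            mul_inv_cancel₀ (h_sub_h_sub_one_ne_zero hbj'), rho_one, neg_neg]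
      rw [h5]
      have h7 : h k - h j - 1 ≠ 0 := h_sub_h_sub_one_ne_zero hkj.ne
      have h6 : rho (h k - h b + (((k : ℕ) : Rh n) - ((b : ℕ) : Rh n))
          + algebraMap ℂ (Rh n) ((wt j - wt b) k - (wt j - wt b) b)) (plusTail j b)
          - (if b = j then 0 else -rho (h b - h j - 1) (plusTail j b))
          = rho (h k - h j - 1) (plusTail j b) := by
        split_ifs with hbj'
        · subst hbj'
          rw [sub_zero]
          congr 1
          simp [hab]
          ring_nf
        · rw [sub_neg_eq_add, ← rho_add]
          congr 1
          simp [wt, hab, hkj.ne, hbj', hlt.ne]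
          ring_nf
      rw [h6, rho_rho, inv_mul_cancel₀ h7, rho_one]
    · rw [if_neg hka.ne, if_neg (by omega), if_neg (by omega)]
      simp [hka.ne]

theorem e_smul_B_smul {n : ℕ} (a b m : Fin n) (x : M' n) :
    e a b • ofU (B true m) • x = ofU (B true m) • e a b • x
      + if b = m then ofU (B true a) • x else 0 := by
  unfold e
  rw [smul_smul, ← map_mul, E_mul_B, map_add, add_smul, map_mul, mul_smul]
  congr 1
  split_ifs <;> simp

/-- The vector `p B_j^+`, up to a factor from `R(h)`. -/
def plusVec {n : ℕ} (j : Fin n) : M' n := ∑ m ∈ Finset.Iic j, ofU (B true m) • plusTail j m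

theorem e_smul_plusVec {n : ℕ} {a b : Fin n} (hab : a < b) (j : Fin n) :
    e a b • plusVec j = 0 := by
  refine e_smul_eq_zero_of_simple (fun a b hab => ?_) hab
  have hterm : ∀ m ∈ Finset.Iic j, e a b • ofU (B true m) • plusTail j m
      = (if a = m then ofU (B true m) • (if a < j then -plusTail j b else 0) else 0)
        + (if b = m then ofU (B true a) • plusTail j m else 0) := by
    intro m hm
    rw [e_smul_B_smul, e_smul_plusTail hab j m (Finset.mem_Iic.mp hm)]
    split_ifs <;> simp
  rw [plusVec, Finset.smul_sum, Finset.sum_congr rfl hterm, Finset.sum_add_distrib,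
    Finset.sum_ite_eq, Finset.sum_ite_eq]
  simp only [Finset.mem_Iic]
  rcases lt_or_ge a j with haj | haj
  · rw [if_pos haj.le, if_pos haj, if_pos (by omega), smul_neg, neg_add_cancel]
  · rw [if_neg haj.not_gt, smul_zero, ite_self, if_neg (by omega), add_zero]

/-- The monomial of an increasing sequence commutes with the generators `B_i^+` whose index
precedes the sequence. -/
theorem Epow_eMat_mul_B {n : ℕ} {i m j : Fin n} {J : Finset (Fin n)} (him : i < m)
    (hJ : J ∈ chainSet m j) :
    Epow (eMat J) * B true i = B true i * Epow (eMat J) := by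
  refine (Commute.list_prod_left _ _ fun x hx => ?_).eq
  obtain ⟨k, -, rfl⟩ := List.mem_map.mp hx
  refine Commute.list_prod_left _ _ fun y hy => ?_
  obtain ⟨l, -, rfl⟩ := List.mem_map.mp hy
  by_cases hl : l ∈ J
  · refine Commute.pow_left ?_ _
    have hne : l ≠ i := fun h0 => not_mem_of_chainSet him hJ (h0 ▸ hl)
    have h1 := E_mul_B k l i
    rw [if_neg hne, add_zero] at h1
    exact h1
  · have h1 : eMat J k l = 0 := if_neg (by tauto)
    rw [h1, pow_zero]
    exact Commute.one_left _

/-- The coefficient of the formula for `p B_j^+`. -/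
def plusCoeff {n : ℕ} (i j : Fin n) (I : Finset (Fin n)) : Rh n :=
  (-1) ^ (I.card - 1) * ((∏ l ∈ Finset.Icc i j \ I, (h l - h j - 1)) /
    ∏ l ∈ Finset.Ico i j, (h l - h j))

theorem plusCoeff_eq {n : ℕ} {i j : Fin n} {I : Finset (Fin n)} (hI : I ∈ chainSet i j) :
    plusCoeff i j I = (-1) ^ (I.card - 1) * (∏ l ∈ I.erase j, (h l - h j - 1)⁻¹) *
      ∏ l ∈ Finset.Ico i j, (1 - (h l - h j)⁻¹) := by
  obtain ⟨h1, h2, h3⟩ := mem_chainSet.mp hI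
  have hne : ∀ l ∈ Finset.Ico i j, h l - h j ≠ 0 := fun l hl =>
    h_sub_h_ne_zero (Finset.mem_Ico.mp hl).2.ne
  have h4 : ∏ l ∈ Finset.Ico i j, (1 - (h l - h j)⁻¹)
      = (∏ l ∈ Finset.Ico i j, (h l - h j - 1)) / ∏ l ∈ Finset.Ico i j, (h l - h j) := by
    rw [← Finset.prod_div_distrib]
    refine Finset.prod_congr rfl fun l hl => ?_
    have := hne l hl
    field_simp
  have h5 : Finset.Ico i j = (Finset.Icc i j \ I) ∪ I.erase j := by
    ext x
    simp only [Finset.mem_Ico, Finset.mem_union, Finset.mem_sdiff, Finset.mem_Icc,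
      Finset.mem_erase]
    by_cases hx : x ∈ I
    · have := h1 x hx
      simp only [hx, not_true, and_false, false_or, and_true, this.1, true_and]
      constructor
      · exact fun h0 => h0.ne
      · exact fun h0 => lt_of_le_of_ne this.2 h0
    · have : x ≠ j := fun h0 => hx (h0 ▸ h3)
      simp only [hx, not_false_iff, and_true, and_false, or_false]
      constructor
      · exact fun h0 => ⟨h0.1, h0.2.le⟩
      · exact fun h0 => ⟨h0.1, lt_of_le_of_ne h0.2 this⟩
  have h6 : Disjoint (Finset.Icc i j \ I) (I.erase j) := by
    rw [Finset.disjoint_left]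
    intro x hx hx'
    exact (Finset.mem_sdiff.mp hx).2 (Finset.mem_erase.mp hx').2
  have h7 : ∏ l ∈ Finset.Ico i j, (h l - h j - 1)
      = (∏ l ∈ Finset.Icc i j \ I, (h l - h j - 1)) * ∏ l ∈ I.erase j, (h l - h j - 1) := by
    rw [h5, Finset.prod_union h6]
  have h8 : ∏ l ∈ I.erase j, (h l - h j - 1) ≠ 0 := Finset.prod_ne_zero_iff.mpr fun l hl =>
    h_sub_h_sub_one_ne_zero (Finset.mem_erase.mp hl).1
  rw [plusCoeff, h4, h7, Finset.prod_inv_distrib]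
  field_simp

/-- The coefficient of `B_m^+ E^(e_J)` after all `B_i^+` have been moved to the left of the
monomials in the formula for `p B_j^+`: a monomial `E^(e_I)` with `I = {i} ∪ J` contributes `B_m^+ E^(e_J)`
as `E_mi B_i^+ = B_i^+ E_mi + B_m^+`. The resulting sum telescopes. -/
theorem plusCoeff_add_sum {n : ℕ} {m j : Fin n} (hmj : m ≤ j) {J : Finset (Fin n)}
    (hJ : J ∈ chainSet m j) :
    plusCoeff m j J + ∑ i ∈ Finset.Iio m, plusCoeff i j (insert i J)
      = (∏ l ∈ Finset.Iio j, (1 - (h l - h j)⁻¹)) *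
        ((-1) ^ (J.card - 1) * ∏ l ∈ J.erase j, (h l - h j - 1)⁻¹) := by
  set y : Rh n := (-1) ^ (J.card - 1) * ∏ l ∈ J.erase j, (h l - h j - 1)⁻¹ with hy
  set g : Fin n → Rh n := fun l => 1 - (h l - h j)⁻¹ with hg
  have h1 : ∀ i ∈ Finset.Iio m, plusCoeff i j (insert i J)
      = -((h i - h j)⁻¹ * (∏ l ∈ Finset.Iio m with i < l, g l)) *
        (y * ∏ l ∈ Finset.Ico m j, g l) := by
    intro i hi
    have him := Finset.mem_Iio.mp hi
    have hij : i < j := him.trans_le hmj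
    have hins : insert i J ∈ chainSet i j := by
      have h2 := mem_chainSet.mp hJ
      rw [mem_chainSet]
      refine ⟨fun x hx => ?_, by simp, by simp [h2.2.2]⟩
      rcases Finset.mem_insert.mp hx with rfl | hx
      · exact ⟨le_rfl, hij.le⟩
      · exact ⟨him.le.trans (h2.1 x hx).1, (h2.1 x hx).2⟩
    have h3 : Finset.Ico i j
        = insert i ((Finset.Iio m).filter (fun l => i < l) ∪ Finset.Ico m j) := by
      ext x
      simp only [Finset.mem_Ico, Finset.mem_insert, Finset.mem_union, Finset.mem_filter,
        Finset.mem_Iio]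
      omega
    have h4 : Disjoint ((Finset.Iio m).filter (fun l => i < l)) (Finset.Ico m j) := by
      rw [Finset.disjoint_left]
      intro x hx hx'
      simp only [Finset.mem_Ico, Finset.mem_filter, Finset.mem_Iio] at hx hx'
      omega
    have h5 : i ∉ (Finset.Iio m).filter (fun l => i < l) ∪ Finset.Ico m j := by
      simp only [Finset.mem_Ico, Finset.mem_filter, Finset.mem_Iio, Finset.mem_union]
      omega
    have h6 : h i - h j ≠ 0 := h_sub_h_ne_zero hij.ne
    have h7 : h i - h j - 1 ≠ 0 := h_sub_h_sub_one_ne_zero hij.ne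
    rw [plusCoeff_eq hins, neg_one_pow_card_insert him hJ, Finset.erase_insert_of_ne hij.ne,
      Finset.prod_insert (fun hk => not_mem_of_chainSet him hJ (Finset.mem_erase.mp hk).2), h3,
      Finset.prod_insert h5, Finset.prod_union h4, hy]
    have h8 : (h i - h j - 1)⁻¹ * (1 - (h i - h j)⁻¹) = (h i - h j)⁻¹ := by
      field_simp
    linear_combination (-(-1) ^ (J.card - 1) * (∏ l ∈ J.erase j, (h l - h j - 1)⁻¹) *
      (∏ l ∈ Finset.Iio m with i < l, g l) * ∏ l ∈ Finset.Ico m j, g l) * h8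
  have h2 := Finset.prod_add_ordered (Finset.Iio m) g fun l => (h l - h j)⁻¹
  have h3 : ∀ l, g l + (h l - h j)⁻¹ = 1 := fun l => by simp [hg]
  simp only [h3, Finset.prod_const_one, mul_one] at h2
  have h4 : Finset.Iio j = Finset.Iio m ∪ Finset.Ico m j := by
    ext x
    simp only [Finset.mem_Ico, Finset.mem_union, Finset.mem_Iio]
    omega
  have h5 : Disjoint (Finset.Iio m) (Finset.Ico m j) := by
    rw [Finset.disjoint_left]
    intro x hx hx'
    simp only [Finset.mem_Ico, Finset.mem_Iio] at hx hx'
    omega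
  rw [Finset.sum_congr rfl h1, ← Finset.sum_mul, Finset.sum_neg_distrib, plusCoeff_eq hJ, h4,
    Finset.prod_union h5]
  linear_combination (y * ∏ l ∈ Finset.Ico m j, g l) * h2

/-- The right-hand side of the formula for `p B_j^+` is proportional to `plusVec j`. -/
theorem sum_plusCoeff {n : ℕ} (j : Fin n) :
    ∑ i ∈ Finset.Iic j, ∑ I ∈ chainSet i j,
      rho (plusCoeff i j I) (cls (ofU (Epow (eMat I) * B true i)))
      = rho (∏ l ∈ Finset.Iio j, (1 - (h l - h j)⁻¹)) (plusVec j) := by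
  have h1 : ∀ i ∈ Finset.Iic j, ∑ I ∈ chainSet i j,
      rho (plusCoeff i j I) (cls (ofU (Epow (eMat I) * B true i)))
      = (∑ I ∈ chainSet i j, ofU (B true i) • rho (plusCoeff i j I) (cls (ofU (Epow (eMat I)))))
        + ∑ m ∈ Finset.Ioc i j, ∑ J ∈ chainSet m j, ofU (B true m) •
          rho (plusCoeff i j (insert i J)) (cls (ofU (Epow (eMat J)))) := by
    intro i hi
    rcases (Finset.mem_Iic.mp hi).eq_or_lt with rfl | hij
    · simp [chainSet_self, Epow_eMat_singleton, cls_eq_smul (ofU _)]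
    · rw [sum_chainSet_of_lt hij, sum_chainSet_of_lt hij, ← Finset.sum_add_distrib]
      refine Finset.sum_congr rfl fun m hm => ?_
      rw [← Finset.sum_add_distrib]
      refine Finset.sum_congr rfl fun J hJ => ?_
      have him := (Finset.mem_Ioc.mp hm).1
      rw [← map_smul (rho _), ← map_smul (rho _), ← map_add (rho _), ← map_smul cls,
        ← map_smul cls, ← map_add cls, smul_eq_mul, smul_eq_mul, ← map_mul, ← map_mul, ← map_add,
        Epow_eMat_insert him hJ, mul_assoc, Epow_eMat_mul_B him hJ, ← mul_assoc, E_mul_B, if_pos rfl, add_mul, mul_assoc]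
  have h2 : ∀ m ∈ Finset.Iic j, ofU (B true m) •
      rho (∏ l ∈ Finset.Iio j, (1 - (h l - h j)⁻¹)) (plusTail j m)
      = (∑ J ∈ chainSet m j, ofU (B true m) • rho (plusCoeff m j J) (cls (ofU (Epow (eMat J)))))
        + ∑ i ∈ Finset.Iio m, ∑ J ∈ chainSet m j, ofU (B true m) •
          rho (plusCoeff i j (insert i J)) (cls (ofU (Epow (eMat J)))) := by
    intro m hm
    rw [Finset.sum_comm, ← Finset.sum_add_distrib, plusTail, map_sum, Finset.smul_sum]
    refine Finset.sum_congr rfl fun J hJ => ?_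
    rw [rho_rho, ← plusCoeff_add_sum (Finset.mem_Iic.mp hm) hJ, rho_add, rho_sum, smul_add,
      Finset.smul_sum]
  rw [Finset.sum_congr rfl h1, plusVec, map_sum]
  simp only [map_smul]
  rw [Finset.sum_congr rfl h2, Finset.sum_add_distrib, Finset.sum_add_distrib]
  congr 1
  refine Finset.sum_comm' fun i m => ?_
  simp only [Finset.mem_Iic, Finset.mem_Ioc, Finset.mem_Iio]
  omega

/-- The formula for `p B_j^+`, as a sum over all increasing sequences ending at `j`. -/
theorem pOf_B_pos {n : ℕ} (j : Fin n) :
    pOf (B true j) = ∑ i ∈ Finset.Iic j, ∑ I ∈ chainSet i j,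
      rho (plusCoeff i j I) (cls (ofU (Epow (eMat I) * B true i))) := by
  have h1 : extProj (∑ i ∈ Finset.Iic j, ∑ I ∈ chainSet i j,
      rho (plusCoeff i j I) (cls (ofU (Epow (eMat I) * B true i))))
      = ∑ i ∈ Finset.Iic j, ∑ I ∈ chainSet i j,
      rho (plusCoeff i j I) (cls (ofU (Epow (eMat I) * B true i))) := by
    refine extProj_of_singular fun a b hab => ?_
    rw [sum_plusCoeff, ← map_smul, e_smul_plusVec hab, map_zero]
  rw [← h1]
  change extHom n _ = extHom n _
  have h2 : Finset.Iic j = insert j (Finset.Iio j) := by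
    ext x
    simp only [Finset.mem_Iic, Finset.mem_insert, Finset.mem_Iio]
    omega
  rw [h2, Finset.sum_insert (by simp), chainSet_self, Finset.sum_singleton, map_add, map_sum,
    Finset.sum_eq_zero, add_zero]
  · simp [plusCoeff, Epow_eMat_singleton, rho_one]
  · intro i hi
    have hij := Finset.mem_Iio.mp hi
    rw [sum_chainSet_of_lt hij, map_sum]
    refine Finset.sum_eq_zero fun m hm => ?_
    rw [map_sum]
    refine Finset.sum_eq_zero fun J hJ => ?_
    have him := (Finset.mem_Ioc.mp hm).1
    rw [Epow_eMat_insert him hJ, mul_assoc, map_mul, ← smul_eq_mul, map_smul, map_smul]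
    exact extProj_lower_smul him _

/-! ### Vectors generated by the anticommutators -/

theorem hasWt_B_sgn {n : ℕ} (ε : Bool) (l : Fin n) : HasWt (sgn ε • wt l) (B ε l) := by
  convert hasWt_B ε l using 1
  funext i
  simp [wt, Pi.single_apply]

theorem hasWt_acomm {n : ℕ} (ε : Bool) (k l : Fin n) :
    HasWt (sgn ε • (wt k + wt l)) (acomm (B ε k) (B ε l)) := by
  have h1 := (hasWt_B_sgn ε k).mul (hasWt_B_sgn ε l)
  have h2 := (hasWt_B_sgn ε l).mul (hasWt_B_sgn ε k)
  rw [← smul_add] at h1 h2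
  rw [add_comm] at h2
  exact h1.add h2

theorem acomm_comm {R : Type*} [Ring R] (x y : R) : acomm x y = acomm y x := add_comm _ _

/-- The products of lowering operators and one anticommutator `{B_k^ε, B_l^ε}`, together with their
weights. -/
inductive Word {n : ℕ} (ε : Bool) : (Fin n → ℂ) → U n → Prop
  | base (k l : Fin n) : Word ε (sgn ε • (wt k + wt l)) (acomm (B ε k) (B ε l))
  | step {μ : Fin n → ℂ} {u : U n} (c d : Fin n) (hdc : d < c) (hu : Word ε μ u) :
      Word ε (μ + (wt c - wt d)) (E c d * u)

/-- The part of weight `μ` of the `R(h)`-span of the classes of the words. -/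
def wordSpan {n : ℕ} (ε : Bool) (μ : Fin n → ℂ) : AddSubgroup (M' n) :=
  AddSubgroup.closure {m : M' n | ∃ (q : Rh n) (u : U n), Word ε μ u ∧ m = ofR q • cls (ofU u)}

theorem Word.mem_wordSpan {n : ℕ} {ε : Bool} {μ : Fin n → ℂ} {u : U n} (hu : Word ε μ u) :
    cls (ofU u) ∈ wordSpan ε μ :=
  AddSubgroup.subset_closure ⟨1, u, hu, by rw [map_one, one_smul]⟩

theorem ofR_smul_mem_wordSpan {n : ℕ} {ε : Bool} {μ : Fin n → ℂ} (q : Rh n) {m : M' n}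
    (hm : m ∈ wordSpan ε μ) : ofR q • m ∈ wordSpan ε μ := by
  induction hm using AddSubgroup.closure_induction with
  | mem x hx =>
    obtain ⟨q', u, hu, rfl⟩ := hx
    exact AddSubgroup.subset_closure ⟨q * q', u, hu, by rw [map_mul, mul_smul]⟩
  | zero => rw [smul_zero]; exact zero_mem _
  | add x y _ _ hx hy => rw [smul_add]; exact add_mem hx hy
  | neg x _ hx => rw [smul_neg]; exact neg_mem hx

theorem e_smul_mem_wordSpan_of_words {n : ℕ} {ε : Bool} {μ : Fin n → ℂ} {a b : Fin n}
    (hw : ∀ u, Word ε μ u → e a b • cls (ofU u) ∈ wordSpan ε (μ + (wt a - wt b)))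
    {m : M' n} (hm : m ∈ wordSpan ε μ) : e a b • m ∈ wordSpan ε (μ + (wt a - wt b)) := by
  induction hm using AddSubgroup.closure_induction with
  | mem x hx =>
    obtain ⟨q, u, hu, rfl⟩ := hx
    rw [smul_smul, show e a b * ofR q = _ from ofU_mul_ofR (hasWt_E_sub a b) q, mul_smul]
    exact ofR_smul_mem_wordSpan _ (hw u hu)
  | zero => rw [smul_zero]; exact zero_mem _
  | add x y _ _ hx hy => rw [smul_add]; exact add_mem hx hy
  | neg x _ hx => rw [smul_neg]; exact neg_mem hx

theorem lower_smul_word {n : ℕ} {ε : Bool} {μ : Fin n → ℂ} {u : U n} {a b : Fin n} (hba : b < a)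
    (hu : Word ε μ u) : e a b • cls (ofU u) ∈ wordSpan ε (μ + (wt a - wt b)) := by
  rw [e, ← map_smul, smul_eq_mul, ← map_mul]
  exact (hu.step a b hba).mem_wordSpan

theorem E_mul_acomm_pos {n : ℕ} (a b k l : Fin n) :
    E a b * acomm (B true k) (B true l) = acomm (B true k) (B true l) * E a b
      + (if b = k then acomm (B true a) (B true l) else 0)
      + (if b = l then acomm (B true k) (B true a) else 0) := by
  have h3 : ∀ x y : U n, acomm x y = x * y + y * x := fun _ _ => rfl
  simp only [h3]
  rw [mul_add, ← mul_assoc, ← mul_assoc, E_mul_B, E_mul_B, add_mul, add_mul, mul_assoc, mul_assoc,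
    E_mul_B, E_mul_B]
  split_ifs <;> (simp only [mul_add, add_mul, mul_assoc, zero_mul, mul_zero]; abel)

theorem E_mul_acomm_neg {n : ℕ} (a b k l : Fin n) :
    E a b * acomm (B false k) (B false l) = acomm (B false k) (B false l) * E a b
      - (if a = k then acomm (B false b) (B false l) else 0)
      - (if a = l then acomm (B false k) (B false b) else 0) := by
  have h3 : ∀ x y : U n, acomm x y = x * y + y * x := fun _ _ => rfl
  simp only [h3]
  rw [mul_add, ← mul_assoc, ← mul_assoc, E_mul_B_neg, E_mul_B_neg, sub_mul, sub_mul, mul_assoc,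
    mul_assoc, E_mul_B_neg, E_mul_B_neg]
  split_ifs <;> (simp only [mul_sub, add_mul, mul_assoc, zero_mul, mul_zero]; abel)

theorem raise_smul_acomm {n : ℕ} (ε : Bool) {a b : Fin n} (hab : a < b) (k l : Fin n) :
    e a b • cls (ofU (acomm (B ε k) (B ε l)))
      ∈ wordSpan ε (sgn ε • (wt k + wt l) + (wt a - wt b)) := by
  have hz : cls (ofU (acomm (B ε k) (B ε l) * E a b)) = (0 : M' n) := by
    rw [map_mul, ← smul_eq_mul, map_smul, cls_eq_smul (ofU (E a b))]
    exact (congrArg _ (e_smul_cls_one hab)).trans (smul_zero _)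
  have hbase : ∀ {μ : Fin n → ℂ} (k l : Fin n), sgn ε • (wt k + wt l) = μ →
      cls (ofU (acomm (B ε k) (B ε l))) ∈ wordSpan ε μ := by
    rintro _ k l rfl
    exact (Word.base k l).mem_wordSpan
  rw [e, ← map_smul, smul_eq_mul, ← map_mul]
  cases ε
  · rw [E_mul_acomm_neg, map_sub, map_sub, map_sub, map_sub, hz, zero_sub]
    refine sub_mem (neg_mem ?_) ?_
    · split_ifs with h1
      · exact hbase _ _ (by subst h1; simp only [sgn]; module)
      · rw [map_zero, map_zero]; exact zero_mem _
    · split_ifs with h1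
      · exact hbase _ _ (by subst h1; simp only [sgn]; module)
      · rw [map_zero, map_zero]; exact zero_mem _
  · rw [E_mul_acomm_pos, map_add, map_add, map_add, map_add, hz, zero_add]
    refine add_mem ?_ ?_
    · split_ifs with h1
      · exact hbase _ _ (by subst h1; simp only [sgn]; module)
      · rw [map_zero, map_zero]; exact zero_mem _
    · split_ifs with h1
      · exact hbase _ _ (by subst h1; simp only [sgn]; module)
      · rw [map_zero, map_zero]; exact zero_mem _

theorem diag_smul_mem_wordSpan {n : ℕ} {ε : Bool} {μ : Fin n → ℂ} (a : Fin n) {m : M' n}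
    (hm : m ∈ wordSpan ε μ) : e a a • m ∈ wordSpan ε (μ + (wt a - wt a)) := by
  rw [sub_self, add_zero, e_self]
  exact ofR_smul_mem_wordSpan _ hm

/-- By induction on the word, `E_ab` maps words into the span of words: lowering operators lengthen
the word, diagonal elements act by elements of `R(h)`, and raising operators are commuted to the
right, past the anticommutator, until they reach the class of `1`, which they annihilate. -/
theorem e_smul_word {n : ℕ} {ε : Bool} {μ : Fin n → ℂ} {u : U n} (hu : Word ε μ u) :
    ∀ a b : Fin n, e a b • cls (ofU u) ∈ wordSpan ε (μ + (wt a - wt b)) := by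
  induction hu with
  | base k l =>
    intro a b
    rcases lt_trichotomy a b with hab | rfl | hab
    · exact raise_smul_acomm ε hab k l
    · exact diag_smul_mem_wordSpan a (Word.base k l).mem_wordSpan
    · exact lower_smul_word hab (Word.base k l)
  | @step μ u c d hdc hu ih =>
    intro a b
    have h0 : cls (ofU (E c d * u)) = e c d • (cls (ofU u) : M' n) := by
      rw [map_mul, ← smul_eq_mul, map_smul]; rfl
    rw [h0, e_smul_e_smul]
    refine sub_mem (add_mem ?_ ?_) ?_
    · have h1 := e_smul_mem_wordSpan_of_words (a := c) (b := d)
        (fun u hu => lower_smul_word hdc hu) (ih a b)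
      rwa [add_right_comm] at h1
    · split_ifs with h1
      · subst h1
        have h2 := ih a d
        rwa [show μ + (wt a - wt d) = μ + (wt b - wt d) + (wt a - wt b) by abel] at h2
      · exact zero_mem _
    · split_ifs with h1
      · subst h1
        have h2 := ih c b
        rwa [show μ + (wt c - wt b) = μ + (wt c - wt a) + (wt a - wt b) by abel] at h2
      · exact zero_mem _

theorem e_smul_mem_wordSpan {n : ℕ} {ε : Bool} {μ : Fin n → ℂ} (a b : Fin n) {m : M' n}
    (hm : m ∈ wordSpan ε μ) : e a b • m ∈ wordSpan ε (μ + (wt a - wt b)) :=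
  e_smul_mem_wordSpan_of_words (fun _ hu => e_smul_word hu a b) hm

theorem e_pow_smul_mem_wordSpan {n : ℕ} {ε : Bool} {μ : Fin n → ℂ} (a b : Fin n) (k : ℕ)
    {m : M' n} (hm : m ∈ wordSpan ε μ) :
    e a b ^ k • m ∈ wordSpan ε (μ + (k : ℂ) • (wt a - wt b)) := by
  induction k with
  | zero => simpa using hm
  | succ k ih =>
    rw [pow_succ', mul_smul]
    have h1 := e_smul_mem_wordSpan a b ih
    convert h1 using 2
    push_cast
    module

/-- The factors of the extremal projector preserve the spans of words of a given weight. -/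
theorem pFactor_mem_wordSpan {n : ℕ} {ε : Bool} {μ : Fin n → ℂ} {i j : Fin n} (hij : i < j)
    {m : M' n} (hm : m ∈ wordSpan ε μ) : pFactor i j m ∈ wordSpan ε μ := by
  obtain ⟨K, hK⟩ := exists_pow_smul_eq_zero hij m
  rw [pFactor_eq_pairSum, pairSum_eq_sum (hK K le_rfl)]
  refine sum_mem fun k _ => ?_
  rw [mul_smul, mul_smul]
  have h1 := e_pow_smul_mem_wordSpan j i k
    (e_pow_smul_mem_wordSpan i j k (ofR_smul_mem_wordSpan (phi (h i - h j) k) hm))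
  rwa [show μ + (k : ℂ) • (wt i - wt j) + (k : ℂ) • (wt j - wt i) = μ by module] at h1

theorem pOf_acomm_mem_wordSpan {n : ℕ} (ε : Bool) (i j : Fin n) :
    pOf (acomm (B ε i) (B ε j)) ∈ wordSpan ε (sgn ε • (wt i + wt j)) :=
  extProj_induction (P := fun m => m ∈ wordSpan ε (sgn ε • (wt i + wt j)))
    (fun _ _ hij _ hm => pFactor_mem_wordSpan hij hm) (Word.base i j).mem_wordSpan

/-! ### Ordered monomials span `U(t^-)` -/

/-- The commutative subalgebra generated by the `E_kl` with `l < k`. -/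
def rowAlg {n : ℕ} (k : Fin n) : Subalgebra ℂ (U n) :=
  Algebra.adjoin ℂ {x | ∃ l < k, x = E k l}

/-- The span of the `E_al` with `l < a`. -/
def rowSpan {n : ℕ} (a : Fin n) : Submodule ℂ (U n) :=
  Submodule.span ℂ {x | ∃ l < a, x = E a l}

theorem E_mul_Erow {n : ℕ} (γ : Matrix (Fin n) (Fin n) ℕ) {k l : Fin n} (hlk : l < k) :
    E k l * Erow γ k = Erow (γ + Matrix.single k l 1) k := by
  have hmem : l ∈ (List.finRange n).filter fun l => l < k :=
    List.mem_filter.mpr ⟨List.mem_finRange l, by simpa using hlk⟩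
  have hnd : ((List.finRange n).filter fun l => l < k).Nodup := (List.nodup_finRange n).filter _
  have hlt := mem_filter_lt k
  unfold Erow
  generalize (List.finRange n).filter (fun l => l < k) = L at hmem hnd hlt
  obtain ⟨s, t, rfl⟩ := List.append_of_mem hmem
  rw [List.nodup_append] at hnd
  obtain ⟨-, hlt', hdisj⟩ := hnd
  have hs : l ∉ s := fun hls => hdisj l hls l (by simp) rfl
  have ht : l ∉ t := (List.nodup_cons.mp hlt').1
  have hmap : ∀ r : List (Fin n), l ∉ r →
      r.map (fun x => E k x ^ ((γ + Matrix.single k l 1 : Matrix (Fin n) (Fin n) ℕ) k x))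
      = r.map (fun x => (E k x ^ γ k x : U n)) := by
    intro r hr
    refine List.map_congr_left fun x hx => ?_
    rw [Matrix.add_apply, Matrix.single_apply_of_col_ne _ _ (ne_of_mem_of_not_mem hx hr).symm,
      add_zero]
  have hcomm : Commute (E k l) (s.map fun x => (E k x ^ γ k x : U n)).prod := by
    refine Commute.list_prod_right _ _ fun x hx => ?_
    obtain ⟨y, hy, rfl⟩ := List.mem_map.mp hx
    have h1 := E_mul_E k l k y
    have h2 := hlt y (by simp [hy])
    rw [if_neg hlk.ne, if_neg h2.ne', add_zero, sub_zero] at h1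
    exact (show Commute (E k l) (E k y) from h1).pow_right _
  rw [List.map_append, List.map_append, List.prod_append, List.prod_append, hmap s hs,
    List.map_cons, List.map_cons, hmap t ht, List.prod_cons, List.prod_cons, ← mul_assoc,
    hcomm.eq, mul_assoc, Matrix.add_apply, Matrix.single_apply_same, pow_succ', mul_assoc]

theorem rowAlg_le {n : ℕ} (k : Fin n) :
    (rowAlg k).toSubmodule ≤ Submodule.span ℂ (Set.range fun γ => (Erow γ k : U n)) := by
  rw [rowAlg, Algebra.adjoin_eq_span, Submodule.span_le]
  intro x hx
  induction hx using Submonoid.closure_induction_left with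
  | one => exact Submodule.subset_span ⟨0, Erow_eq_one fun _ _ => rfl⟩
  | mul_left x hx y _ ih =>
    obtain ⟨l, hl, rfl⟩ := hx
    have h1 : Submodule.span ℂ (Set.range fun γ => (Erow γ k : U n))
        ≤ (Submodule.span ℂ (Set.range fun γ => (Erow γ k : U n))).comap
          (LinearMap.mulLeft ℂ (E k l)) := by
      rw [Submodule.span_le]
      rintro _ ⟨γ, rfl⟩
      exact Submodule.subset_span ⟨_, (E_mul_Erow γ hl).symm⟩
    exact h1 ih

/-- Rows with larger index can be moved to the right of rows with smaller index. -/
theorem rowSpan_mul_rowAlg_le {n : ℕ} {k a : Fin n} (hka : k < a) :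
    rowSpan a * (rowAlg k).toSubmodule ≤ (rowAlg k).toSubmodule * rowSpan a := by
  rw [Submodule.mul_le]
  intro v hv y hy
  have hone : ∀ x ∈ rowSpan a, x ∈ (rowAlg k).toSubmodule * rowSpan a := fun x hx => by
    have h1 := Submodule.mul_mem_mul (M := (rowAlg k).toSubmodule) (one_mem (rowAlg k)) hx
    rwa [one_mul] at h1
  change y ∈ rowAlg k at hy
  induction hy using Algebra.adjoin_induction generalizing v with
  | mem y hy =>
    obtain ⟨l, hl, rfl⟩ := hy
    induction hv using Submodule.span_induction with
    | mem v hv =>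
      obtain ⟨i, hi, rfl⟩ := hv
      rw [E_mul_E, if_neg (hl.trans hka).ne', sub_zero]
      refine add_mem (Submodule.mul_mem_mul (Algebra.subset_adjoin ⟨l, hl, rfl⟩)
        (Submodule.subset_span ⟨i, hi, rfl⟩)) ?_
      split_ifs
      · exact hone _ (Submodule.subset_span ⟨l, hl.trans hka, rfl⟩)
      · exact zero_mem _
    | zero => rw [zero_mul]; exact zero_mem _
    | add x y _ _ hx hy => rw [add_mul]; exact add_mem hx hy
    | smul c x _ hx => rw [smul_mul_assoc]; exact Submodule.smul_mem _ c hx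
  | algebraMap c =>
    rw [← Algebra.commutes, ← Algebra.smul_def]
    exact Submodule.smul_mem _ c (hone v hv)
  | add x y _ _ hx hy => rw [mul_add]; exact add_mem (hx v hv) (hy v hv)
  | mul x y hx' hy' hx hy =>
    rw [← mul_assoc]
    refine Submodule.mul_induction_on (hx v hv) (fun p hp w hw => ?_) fun p q hp hq => ?_
    · rw [mul_assoc]
      have h1 := Submodule.mul_mem_mul (M := (rowAlg k).toSubmodule) hp (hy w hw)
      rwa [← mul_assoc, (rowAlg k).isIdempotentElem_toSubmodule.eq] at h1
    · rw [add_mul]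
      exact add_mem hp hq

/-- The product of the row subalgebras, in increasing order. -/
def lowerSpan (n : ℕ) : Submodule ℂ (U n) :=
  ((List.finRange n).map fun k => (rowAlg k).toSubmodule).prod

theorem one_mem_lowerSpan (n : ℕ) : (1 : U n) ∈ lowerSpan n := by
  unfold lowerSpan
  induction List.finRange n with
  | nil => exact Submodule.one_le.mp le_rfl
  | cons a l ih =>
    rw [List.map_cons, List.prod_cons]
    have h1 := Submodule.mul_mem_mul (M := (rowAlg a).toSubmodule) (one_mem (rowAlg a)) ih
    rwa [one_mul] at h1

/-- `E_ab` moves to the right through the rows of index less than `a`, turning into other operators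
of row `a`, and is absorbed by row `a`. -/
theorem E_mul_mem_lowerSpan {n : ℕ} {a b : Fin n} (hba : b < a) {x : U n}
    (hx : x ∈ lowerSpan n) : E a b * x ∈ lowerSpan n := by
  obtain ⟨s, t, hst⟩ := List.append_of_mem (List.mem_finRange a)
  have hp : (List.finRange n).Pairwise (· < ·) := List.pairwise_lt_finRange n
  rw [hst] at hp
  have hs : ∀ r ∈ s, r < a := fun r hr => (List.pairwise_append.mp hp).2.2 r hr a (by simp)
  have h1 : ∀ s : List (Fin n), (∀ r ∈ s, r < a) →
      rowSpan a * (s.map fun k => (rowAlg k).toSubmodule).prod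
        ≤ (s.map fun k => (rowAlg k).toSubmodule).prod * rowSpan a := by
    intro s
    induction s with
    | nil => intro _; simp
    | cons k s ih =>
      intro hs
      rw [List.map_cons, List.prod_cons, ← mul_assoc]
      calc _ ≤ (rowAlg k).toSubmodule * rowSpan a
              * (s.map fun k => (rowAlg k).toSubmodule).prod :=
            mul_le_mul' (rowSpan_mul_rowAlg_le (hs k (by simp))) le_rfl
        _ ≤ _ := by
            rw [mul_assoc, mul_assoc]
            exact mul_le_mul' le_rfl (ih fun r hr => hs r (by simp [hr]))
  have h2 : rowSpan a * (rowAlg a).toSubmodule ≤ (rowAlg a).toSubmodule := by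
    have h3 : rowSpan a ≤ (rowAlg a).toSubmodule := by
      rw [rowSpan, Submodule.span_le]
      exact Algebra.subset_adjoin
    calc _ ≤ (rowAlg a).toSubmodule * (rowAlg a).toSubmodule := mul_le_mul' h3 le_rfl
      _ = _ := (rowAlg a).isIdempotentElem_toSubmodule
  have h4 : rowSpan a * lowerSpan n ≤ lowerSpan n := by
    unfold lowerSpan
    rw [hst, List.map_append, List.map_cons, List.prod_append, List.prod_cons, ← mul_assoc]
    refine (mul_le_mul' (h1 s hs) le_rfl).trans ?_
    rw [mul_assoc, ← mul_assoc (rowSpan a)]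
    exact mul_le_mul' le_rfl (mul_le_mul' h2 le_rfl)
  exact h4 (Submodule.mul_mem_mul (Submodule.subset_span ⟨b, hba, rfl⟩) hx)

theorem lowerSpan_le (n : ℕ) : lowerSpan n ≤ Submodule.span ℂ (Set.range (Epow (n := n))) := by
  have h1 : ∀ L : List (Fin n), L.Nodup →
      (L.map fun k => (rowAlg k).toSubmodule).prod
        ≤ Submodule.span ℂ (Set.range fun γ => ((L.map (Erow γ)).prod : U n)) := by
    intro L
    induction L with
    | nil =>
      intro _
      rw [List.map_nil, List.prod_nil, Submodule.one_le]
      exact Submodule.subset_span ⟨0, rfl⟩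
    | cons k L ih =>
      intro hL
      rw [List.nodup_cons] at hL
      rw [List.map_cons, List.prod_cons]
      refine (mul_le_mul' (rowAlg_le k) (ih hL.2)).trans ?_
      rw [Submodule.span_mul_span, Submodule.span_le]
      rintro _ ⟨_, ⟨γ, rfl⟩, _, ⟨γ', rfl⟩, rfl⟩
      refine Submodule.subset_span ⟨fun r => if r = k then γ k else γ' r, ?_⟩
      have h2 : L.map (Erow fun r => if r = k then γ k else γ' r) = L.map (Erow γ') := by
        refine List.map_congr_left fun r hr => ?_
        have hrk : r ≠ k := fun h0 => hL.1 (h0 ▸ hr)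
        simp [Erow, hrk]
      simp only [List.map_cons, List.prod_cons, h2]
      simp [Erow]
  exact h1 _ (List.nodup_finRange n)

/-! ### Weights of ordered monomials -/

/-- The weight of the ordered monomial `E^γ`. -/
def wtMat {n : ℕ} (γ : Matrix (Fin n) (Fin n) ℕ) : Fin n → ℂ :=
  ∑ k, ∑ l ∈ Finset.Iio k, (γ k l : ℂ) • (wt k - wt l)

theorem HasWt.list_prod {n : ℕ} {ι : Type*} {w : ι → Fin n → ℂ} {f : ι → U n}
    (hf : ∀ x, HasWt (w x) (f x)) (L : List ι) : HasWt (L.map w).sum (L.map f).prod := by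
  induction L with
  | nil => intro i; simp
  | cons a L ih =>
    rw [List.map_cons, List.map_cons, List.sum_cons, List.prod_cons]
    exact (hf a).mul ih

theorem hasWt_Epow {n : ℕ} (γ : Matrix (Fin n) (Fin n) ℕ) : HasWt (wtMat γ) (Epow γ) := by
  have h1 : wtMat γ = ((List.finRange n).map fun k =>
      (((List.finRange n).filter fun l => l < k).map fun l =>
        (γ k l : ℂ) • (wt k - wt l)).sum).sum := by
    unfold wtMat
    rw [Fin.sum_univ_def]
    congr 1
    refine List.map_congr_left fun k _ => ?_
    rw [← List.sum_toFinset _ ((List.nodup_finRange n).filter _)]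
    refine Finset.sum_congr ?_ fun _ _ => rfl
    ext l
    simp
  rw [h1]
  exact HasWt.list_prod (fun k => HasWt.list_prod (fun l => (hasWt_E_sub k l).pow _) _) _

theorem Epow_congr {n : ℕ} {γ γ' : Matrix (Fin n) (Fin n) ℕ}
    (hγ : ∀ r, ∀ l < r, γ r l = γ' r l) : Epow γ = Epow γ' := by
  unfold Epow
  congr 1
  refine List.map_congr_left fun k _ => ?_
  congr 1
  refine List.map_congr_left fun l hl => ?_
  rw [hγ k l (mem_filter_lt k l hl)]

/-- A weight vector in the span of a family of weight vectors is in the span of the members of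
the same weight. -/
theorem mem_span_of_hasWt {n : ℕ} {ι : Type*} {v : ι → U n} {ω : ι → Fin n → ℂ}
    (hv : ∀ i, HasWt (ω i) (v i)) {w : Fin n → ℂ} {x : U n} (hx : HasWt w x)
    (hxs : x ∈ Submodule.span ℂ (Set.range v)) :
    x ∈ Submodule.span ℂ (v '' {i | ω i = w}) := by
  classical
  obtain ⟨c, rfl⟩ := Finsupp.mem_span_range_iff_exists_finsupp.mp hxs
  have h1 := wt_indep (insert w (c.support.image ω))
    (fun μ => (∑ i ∈ c.support with ω i = μ, c i • v i)
      - if μ = w then c.sum fun i a => a • v i else 0)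
    (fun μ _ => by
      refine (wtSpace μ).sub_mem (Submodule.sum_mem _ fun i hi => ?_) ?_
      · have h2 := (hv i).smul (c i)
        rwa [(Finset.mem_filter.mp hi).2] at h2
      · split_ifs with h2
        · subst h2
          exact hx
        · exact zero_mem _)
    (by
      rw [Finset.sum_sub_distrib, Finset.sum_fiberwise_of_maps_to fun i hi =>
        Finset.mem_insert_of_mem (Finset.mem_image_of_mem ω hi), Finset.sum_ite_eq',
        if_pos (Finset.mem_insert_self _ _)]
      exact sub_self _)
    w (Finset.mem_insert_self _ _)
  rw [if_pos rfl, sub_eq_zero] at h1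
  rw [← h1]
  exact Submodule.sum_mem _ fun i hi => Submodule.smul_mem _ _
    (Submodule.subset_span ⟨i, (Finset.mem_filter.mp hi).2, rfl⟩)

theorem wtMat_add_single {n : ℕ} (γ : Matrix (Fin n) (Fin n) ℕ) {k l : Fin n} (hlk : l < k) :
    wtMat (γ + Matrix.single k l 1) = wtMat γ + (wt k - wt l) := by
  have h1 : ∀ k' l' : Fin n, (((γ + Matrix.single k l 1 : Matrix (Fin n) (Fin n) ℕ) k' l' : ℕ) : ℂ)
      • (wt k' - wt l') = (γ k' l' : ℂ) • (wt k' - wt l')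
        + if k' = k then (if l' = l then wt k - wt l else 0) else (0 : Fin n → ℂ) := by
    intro k' l'
    rw [Matrix.add_apply, Matrix.single_apply, Nat.cast_add, add_smul]
    congr 1
    by_cases h2 : k' = k
    · subst h2
      by_cases h3 : l' = l
      · subst h3
        simp
      · rw [if_pos rfl, if_neg h3, if_neg (fun h4 => h3 h4.2.symm), Nat.cast_zero, zero_smul]
    · rw [if_neg h2, if_neg (fun h4 => h2 h4.1.symm), Nat.cast_zero, zero_smul]
  unfold wtMat
  simp only [h1, Finset.sum_add_distrib]
  congr 1
  rw [Finset.sum_eq_single k, Finset.sum_eq_single l]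
  · simp
  · intro l' _ hl'
    simp [hl']
  · intro h2
    exact absurd (Finset.mem_Iio.mpr hlk) h2
  · intro k' _ hk'
    simp [hk']
  · intro h2
    exact absurd (Finset.mem_univ k) h2

/-- A monomial of weight zero in the lowering operators is trivial. -/
theorem eq_zero_of_wtMat_eq_zero {n : ℕ} {γ : Matrix (Fin n) (Fin n) ℕ} (hγ : wtMat γ = 0) :
    ∀ r, ∀ l < r, γ r l = 0 := by
  -- pairing with the functional `w ↦ ∑ r * w r` is positive on every `wt k - wt l`, `l < k`
  have h1 : ∑ r : Fin n, ((r : ℕ) : ℂ) * wtMat γ r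
      = ((∑ k : Fin n, ∑ l ∈ Finset.Iio k, γ k l * ((k : ℕ) - (l : ℕ)) : ℕ) : ℂ) := by
    have h2 : ∀ k l : Fin n, ∑ r : Fin n, ((r : ℕ) : ℂ) * (wt k - wt l) r
        = ((k : ℕ) : ℂ) - ((l : ℕ) : ℂ) := by
      intro k l
      simp [wt, mul_sub, Pi.single_apply, Finset.sum_sub_distrib]
    unfold wtMat
    simp only [Finset.sum_apply, Pi.smul_apply, smul_eq_mul, Finset.mul_sum]
    push_cast
    rw [Finset.sum_comm]
    refine Finset.sum_congr rfl fun k _ => ?_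
    rw [Finset.sum_comm]
    refine Finset.sum_congr rfl fun l hl => ?_
    rw [Nat.cast_sub (Finset.mem_Iio.mp hl).le, ← h2, Finset.mul_sum]
    exact Finset.sum_congr rfl fun r _ => by ring
  rw [hγ] at h1
  simp only [Pi.zero_apply, mul_zero, Finset.sum_const_zero] at h1
  have h3 := Nat.cast_eq_zero.mp h1.symm
  intro r l hl
  have h4 := Finset.sum_eq_zero_iff.mp (Finset.sum_eq_zero_iff.mp h3 r (Finset.mem_univ r)) l
    (Finset.mem_Iio.mpr hl)
  have h5 : (l : ℕ) < r := hl
  rcases Nat.mul_eq_zero.mp h4 with h6 | h6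
  · exact h6
  · omega

/-- If the weight of `E^γ` is not a natural number at `k`, then `E^γ` has a factor `E_mk`. -/
theorem exists_eq_add_single {n : ℕ} {γ : Matrix (Fin n) (Fin n) ℕ} {k : Fin n}
    (hγ : ∀ N : ℕ, wtMat γ k ≠ N) :
    ∃ m γ', k < m ∧ γ = γ' + Matrix.single m k 1 ∧ wtMat γ' = wtMat γ - wt m + wt k := by
  have h1 : ∃ m, k < m ∧ γ m k ≠ 0 := by
    by_contra! h0
    refine hγ (∑ r : Fin n, ∑ l ∈ Finset.Iio r, γ r l * if k = r then 1 else 0) ?_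
    unfold wtMat
    simp only [Finset.sum_apply, Pi.smul_apply, smul_eq_mul]
    push_cast
    refine Finset.sum_congr rfl fun r _ => Finset.sum_congr rfl fun l hl => ?_
    by_cases h2 : k = l
    · subst h2
      simp [h0 r (Finset.mem_Iio.mp hl)]
    · simp [wt, Pi.single_apply, h2]
  obtain ⟨m, hkm, hm⟩ := h1
  have h2 : γ = (γ - Matrix.single m k 1) + Matrix.single m k 1 := by
    ext r l
    rw [Matrix.add_apply, Matrix.sub_apply, Matrix.single_apply]
    split_ifs with h3
    · obtain ⟨rfl, rfl⟩ := h3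
      omega
    · rfl
  refine ⟨m, γ - Matrix.single m k 1, hkm, h2, ?_⟩
  have h3 := wtMat_add_single (γ - Matrix.single m k 1) hkm
  rw [← h2] at h3
  rw [h3]
  abel

theorem wt_apply {n : ℕ} (i k : Fin n) : wt i k = if k = i then 1 else 0 := by
  simp [wt, Pi.single_apply]

/-- A monomial of weight `ε_i - ε_k` in the lowering operators comes from an increasing sequence
from `k` to `i`. -/
theorem exists_chain {n : ℕ} (i k : Fin n) : ∀ γ : Matrix (Fin n) (Fin n) ℕ,
    wtMat γ = wt i - wt k → ∃ I ∈ chainSet k i, ∀ r, ∀ l < r, γ r l = eMat I r l := by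
  induction k using fin_top_induction with
  | hP k ih =>
    intro γ hγ
    by_cases hki : k = i
    · subst hki
      rw [sub_self] at hγ
      refine ⟨{k}, by rw [chainSet_self]; simp, fun r l hl => ?_⟩
      rw [eq_zero_of_wtMat_eq_zero hγ r l hl]
      symm
      refine if_neg ?_
      rintro ⟨h1, h2, -⟩
      rw [Finset.mem_singleton] at h1 h2
      omega
    · obtain ⟨m, γ', hkm, rfl, hγ'⟩ := exists_eq_add_single (γ := γ) (k := k) (fun N hN => by
        rw [hγ, Pi.sub_apply, wt_apply, wt_apply, if_neg hki, if_pos rfl] at hN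
        have h1 : ((N + 1 : ℕ) : ℂ) = 0 := by push_cast; rw [← hN]; ring
        exact absurd (Nat.cast_eq_zero.mp h1) (Nat.succ_ne_zero N))
      obtain ⟨I, hI, hI'⟩ := ih m hkm γ' (by rw [hγ', hγ]; abel)
      have hI2 := mem_chainSet.mp hI
      refine ⟨insert k I, mem_chainSet.mpr ⟨fun x hx => ?_, Finset.mem_insert_self _ _,
        Finset.mem_insert_of_mem hI2.2.2⟩, fun r l hl => ?_⟩
      · rcases Finset.mem_insert.mp hx with rfl | hx
        · exact ⟨le_rfl, hkm.le.trans (hI2.1 m hI2.2.1).2⟩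
        · exact ⟨hkm.le.trans (hI2.1 x hx).1, (hI2.1 x hx).2⟩
      · rw [eMat_insert hkm hI, Matrix.add_apply, Matrix.add_apply, hI' r l hl]

/-- A monomial of weight `ε_i + ε_j - ε_k - ε_l` in the lowering operators comes from two
increasing sequences joining `k` and `l` with `i` and `j`. -/
theorem exists_two_chains {n : ℕ} (i j l k : Fin n) : ∀ γ : Matrix (Fin n) (Fin n) ℕ,
    wtMat γ = wt i + wt j - wt k - wt l →
      (∃ I ∈ chainSet k i, ∃ J ∈ chainSet l j, ∀ r, ∀ s < r, γ r s = (eMat I + eMat J) r s) ∨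
      ∃ I ∈ chainSet k j, ∃ J ∈ chainSet l i, ∀ r, ∀ s < r, γ r s = (eMat I + eMat J) r s := by
  induction k using fin_top_induction with
  | hP k ih =>
    intro γ hγ
    have hself : {k} ∈ chainSet k k := by rw [chainSet_self]; simp
    have hzero : ∀ r, ∀ s < r, eMat {k} r s = 0 := by
      intro r s hs
      refine if_neg ?_
      rintro ⟨h1, h2, -⟩
      rw [Finset.mem_singleton] at h1 h2
      omega
    by_cases hki : k = i
    · subst hki
      obtain ⟨J, hJ, hJ'⟩ := exists_chain j l γ (by rw [hγ]; abel)
      refine Or.inl ⟨{k}, hself, J, hJ, fun r s hs => ?_⟩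
      rw [Matrix.add_apply, hzero r s hs, zero_add, hJ' r s hs]
    by_cases hkj : k = j
    · subst hkj
      obtain ⟨J, hJ, hJ'⟩ := exists_chain i l γ (by rw [hγ]; abel)
      refine Or.inr ⟨{k}, hself, J, hJ, fun r s hs => ?_⟩
      rw [Matrix.add_apply, hzero r s hs, zero_add, hJ' r s hs]
    obtain ⟨m, γ', hkm, rfl, hγ'⟩ := exists_eq_add_single (γ := γ) (k := k) (fun N hN => by
      rw [hγ, Pi.sub_apply, Pi.sub_apply, Pi.add_apply, wt_apply, wt_apply, wt_apply, wt_apply,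
        if_neg hki, if_neg hkj, if_pos rfl] at hN
      have h1 : ((N + 1 + if k = l then 1 else 0 : ℕ) : ℂ) = 0 := by
        push_cast; rw [← hN]; ring
      have h2 := Nat.cast_eq_zero.mp h1
      omega)
    have hins : ∀ {x : Fin n} {I : Finset (Fin n)}, I ∈ chainSet m x →
        insert k I ∈ chainSet k x := by
      intro x I hI
      have hI2 := mem_chainSet.mp hI
      refine mem_chainSet.mpr ⟨fun y hy => ?_, Finset.mem_insert_self _ _,
        Finset.mem_insert_of_mem hI2.2.2⟩
      rcases Finset.mem_insert.mp hy with rfl | hy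
      · exact ⟨le_rfl, hkm.le.trans (hI2.1 m hI2.2.1).2⟩
      · exact ⟨hkm.le.trans (hI2.1 y hy).1, (hI2.1 y hy).2⟩
    refine (ih m hkm γ' (by rw [hγ', hγ]; abel)).imp ?_ ?_
    all_goals
      rintro ⟨I, hI, J, hJ, hIJ⟩
      refine ⟨insert k I, hins hI, J, hJ, fun r s hs => ?_⟩
      rw [Matrix.add_apply, hIJ r s hs, eMat_insert hkm hI, ← Matrix.add_apply, add_right_comm]

/-! ### The expansions of the projected anticommutators -/

/-- A word is the product of an element of `lowerSpan n` and an anticommutator. -/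
theorem Word.exists_eq {n : ℕ} {ε : Bool} {μ : Fin n → ℂ} {u : U n} (hu : Word ε μ u) :
    ∃ k l p ν, p ∈ lowerSpan n ∧ HasWt ν p ∧ ν + sgn ε • (wt k + wt l) = μ ∧
      u = p * acomm (B ε k) (B ε l) := by
  induction hu with
  | base k l => exact ⟨k, l, 1, 0, one_mem_lowerSpan n, fun i => by simp, zero_add _,
      (one_mul _).symm⟩
  | step c d hdc _ ih =>
    obtain ⟨k, l, p, ν, hp, hν, rfl, rfl⟩ := ih
    refine ⟨k, l, E c d * p, _, E_mul_mem_lowerSpan hdc hp, (hasWt_E_sub c d).mul hν, ?_,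
      (mul_assoc _ _ _).symm⟩
    abel

/-- The additive subgroup generated by the right `R(h)`-multiples of finitely many vectors consists
of their linear combinations. -/
theorem exists_sum_rho {n : ℕ} {ι : Type*} (D : Finset ι) (v : ι → M' n) {m : M' n}
    (hm : m ∈ AddSubgroup.closure {y : M' n | ∃ x ∈ D, ∃ q : Rh n, y = rho q (v x)}) :
    ∃ H : ι → Rh n, m = ∑ x ∈ D, rho (H x) (v x) := by
  classical
  induction hm using AddSubgroup.closure_induction with
  | mem y hy =>
    obtain ⟨x, hx, q, rfl⟩ := hy
    refine ⟨Pi.single x q, ?_⟩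
    rw [Finset.sum_eq_single_of_mem x hx, Pi.single_eq_same]
    intro z _ hz
    rw [Pi.single_eq_of_ne hz, rho_zero]
  | zero => exact ⟨0, by simp [rho_zero]⟩
  | add x y _ _ hx hy =>
    obtain ⟨H, rfl⟩ := hx
    obtain ⟨H', rfl⟩ := hy
    refine ⟨H + H', ?_⟩
    rw [← Finset.sum_add_distrib]
    exact Finset.sum_congr rfl fun x _ => (rho_add _ _ _).symm
  | neg x _ hx =>
    obtain ⟨H, rfl⟩ := hx
    refine ⟨-H, ?_⟩
    rw [← Finset.sum_neg_distrib]
    exact Finset.sum_congr rfl fun x _ => (rho_neg _ _).symm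

/-- The projection of `{B_i^ε, B_j^ε}` is a combination of any family of vectors
`E^γ {B_k^ε, B_l^ε}` that contains all of them whose weight is that of `{B_i^ε, B_j^ε}`. -/
theorem exists_pOf_acomm_eq {n : ℕ} (ε : Bool) (i j : Fin n) {ι : Type*} (D : Finset ι)
    (v : ι → U n)
    (hD : ∀ k l γ, wtMat γ + sgn ε • (wt k + wt l) = sgn ε • (wt i + wt j) →
      ∃ x ∈ D, v x = Epow γ * acomm (B ε k) (B ε l)) :
    ∃ H : ι → Rh n, pOf (acomm (B ε i) (B ε j)) = ∑ x ∈ D, rho (H x) (cls (ofU (v x))) := by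
  refine exists_sum_rho D (fun x => cls (ofU (v x))) ?_
  have h0 := pOf_acomm_mem_wordSpan ε i j
  unfold wordSpan at h0
  refine (AddSubgroup.closure_le _).mpr ?_ h0
  rintro _ ⟨q, u, hu, rfl⟩
  obtain ⟨k, l, p, ν, hp, hν, hw, rfl⟩ := hu.exists_eq
  have h1 := mem_span_of_hasWt hasWt_Epow hν (lowerSpan_le n hp)
  clear h0 hu hν hp
  change ofR q • cls (ofU (p * acomm (B ε k) (B ε l))) ∈ AddSubgroup.closure _
  induction h1 using Submodule.span_induction generalizing q with
  | mem p hp =>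
    obtain ⟨γ, hγ, rfl⟩ := hp
    obtain ⟨x, hx, hxv⟩ := hD k l γ (by rw [hγ, hw])
    refine AddSubgroup.subset_closure ⟨x, hx, shiftR (sgn ε • (wt i + wt j)) q, ?_⟩
    simp only [hxv]
    refine isWt_cls ?_ q
    rw [← hw, ← hγ]
    exact (hasWt_Epow γ).mul (hasWt_acomm ε k l)
  | zero =>
    rw [zero_mul, map_zero, map_zero, smul_zero]
    exact zero_mem _
  | add x y _ _ hx hy =>
    rw [add_mul, map_add, map_add, smul_add]
    exact add_mem (hx q) (hy q)
  | smul c x _ hx =>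
    have h2 : ofU (c • x * acomm (B ε k) (B ε l))
        = ofR (algebraMap ℂ (Rh n) c) * ofU (x * acomm (B ε k) (B ε l)) := by
      rw [smul_mul_assoc, Algebra.smul_def, map_mul, ← (cartan n).commutes, ← ofR_algebraMap,
        ← IsScalarTower.algebraMap_apply]
    rw [h2, ← smul_eq_mul, map_smul, smul_smul, ← map_mul]
    exact hx _

theorem min'_of_mem_chainSet {n : ℕ} {k i : Fin n} {I : Finset (Fin n)} (hI : I ∈ chainSet k i)
    (hne : I.Nonempty) : I.min' hne = k :=
  le_antisymm (I.min'_le _ (mem_chainSet.mp hI).2.1)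
    ((mem_chainSet.mp hI).1 _ (I.min'_mem hne)).1

theorem max'_of_mem_chainSet {n : ℕ} {k i : Fin n} {I : Finset (Fin n)} (hI : I ∈ chainSet k i)
    (hne : I.Nonempty) : I.max' hne = i :=
  le_antisymm ((mem_chainSet.mp hI).1 _ (I.max'_mem hne)).2
    (I.le_max' _ (mem_chainSet.mp hI).2.2)

/-- The starting and the end point of an increasing sequence are determined by its set of
entries, so that coefficients depending on them can be written as functions of the sets alone. -/
theorem exists_eq_of_mem_chainSet {n : ℕ} {R : Type*} [Zero R]
    (H : Fin n → Fin n → Finset (Fin n) → Fin n → Fin n → Finset (Fin n) → R) :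
    ∃ H' : Finset (Fin n) → Finset (Fin n) → R, ∀ {k i l j I J}, I ∈ chainSet k i →
      J ∈ chainSet l j → H' I J = H k i I l j J := by
  classical
  refine ⟨fun I J => if hIJ : I.Nonempty ∧ J.Nonempty then
    H (I.min' hIJ.1) (I.max' hIJ.1) I (J.min' hIJ.2) (J.max' hIJ.2) J else 0,
    fun {k i l j I J} hI hJ => ?_⟩
  have hIJ : I.Nonempty ∧ J.Nonempty := ⟨⟨k, (mem_chainSet.mp hI).2.1⟩,
    ⟨l, (mem_chainSet.mp hJ).2.1⟩⟩
  simp only [dif_pos hIJ, min'_of_mem_chainSet hI, max'_of_mem_chainSet hI,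
    min'_of_mem_chainSet hJ, max'_of_mem_chainSet hJ]

theorem le_of_mem_chainSet {n : ℕ} {k i : Fin n} {I : Finset (Fin n)} (hI : I ∈ chainSet k i) :
    k ≤ i :=
  ((mem_chainSet.mp hI).1 k (mem_chainSet.mp hI).2.1).2

theorem exists_pOf_acomm_pos {n : ℕ} :
    ∃ H : Finset (Fin n) → Finset (Fin n) → Rh n, ∀ i j : Fin n,
      pOf (acomm (B true i) (B true j)) =
        ∑ k ∈ Finset.Iic i, ∑ I ∈ chainSet k i, ∑ l ∈ Finset.Iic j, ∑ J ∈ chainSet l j,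
          cls (ofU (Epow (eMat I + eMat J) * acomm (B true k) (B true l)) * ofR (H I J)) := by
  have h1 : ∀ i j : Fin n, _ := fun i j => exists_pOf_acomm_eq true i j
    (((Finset.Iic i).sigma fun k => chainSet k i) ×ˢ (Finset.Iic j).sigma fun l => chainSet l j)
    (fun x => Epow (eMat x.1.2 + eMat x.2.2) * acomm (B true x.1.1) (B true x.2.1)) (by
      intro k l γ hγ
      simp only [sgn, one_smul] at hγ
      rcases exists_two_chains i j l k γ (by rw [← hγ]; abel) with
        ⟨I, hI, J, hJ, hIJ⟩ | ⟨I, hI, J, hJ, hIJ⟩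
      · refine ⟨(⟨k, I⟩, ⟨l, J⟩), ?_, by rw [Epow_congr hIJ]⟩
        simp [hI, hJ, le_of_mem_chainSet hI, le_of_mem_chainSet hJ]
      · refine ⟨(⟨l, J⟩, ⟨k, I⟩), ?_, by rw [Epow_congr hIJ, acomm_comm, add_comm]⟩
        simp [hI, hJ, le_of_mem_chainSet hI, le_of_mem_chainSet hJ])
  choose H hH using h1
  obtain ⟨H', hH'⟩ := exists_eq_of_mem_chainSet fun k i I l j J => H i j (⟨k, I⟩, ⟨l, J⟩)
  refine ⟨H', fun i j => ?_⟩
  rw [hH, Finset.sum_product, Finset.sum_sigma]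
  refine Finset.sum_congr rfl fun k _ => Finset.sum_congr rfl fun I hI => ?_
  rw [Finset.sum_sigma]
  refine Finset.sum_congr rfl fun l _ => Finset.sum_congr rfl fun J hJ => ?_
  rw [rho_cls, hH' hI hJ]

theorem exists_pOf_acomm_neg {n : ℕ} :
    ∃ H : Finset (Fin n) → Finset (Fin n) → Rh n, ∀ i j : Fin n,
      pOf (acomm (B false i) (B false j)) =
        ∑ k ∈ Finset.Ici i, ∑ I ∈ chainSet i k, ∑ l ∈ Finset.Ici j, ∑ J ∈ chainSet j l,
          cls (ofU (Epow (eMat I + eMat J) * acomm (B false k) (B false l)) * ofR (H I J)) := by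
  have h1 : ∀ i j : Fin n, _ := fun i j => exists_pOf_acomm_eq false i j
    (((Finset.Ici i).sigma fun k => chainSet i k) ×ˢ (Finset.Ici j).sigma fun l => chainSet j l)
    (fun x => Epow (eMat x.1.2 + eMat x.2.2) * acomm (B false x.1.1) (B false x.2.1)) (by
      intro k l γ hγ
      simp only [sgn, neg_smul, one_smul] at hγ
      have hγ' : wtMat γ = wt k + wt l - wt i - wt j := by
        rw [← sub_eq_add_neg, sub_eq_iff_eq_add] at hγ
        rw [hγ]
        abel
      rcases exists_two_chains k l j i γ hγ' with ⟨I, hI, J, hJ, hIJ⟩ | ⟨I, hI, J, hJ, hIJ⟩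
      · refine ⟨(⟨k, I⟩, ⟨l, J⟩), ?_, by rw [Epow_congr hIJ]⟩
        simp [hI, hJ, le_of_mem_chainSet hI, le_of_mem_chainSet hJ]
      · refine ⟨(⟨l, I⟩, ⟨k, J⟩), ?_, by rw [Epow_congr hIJ, acomm_comm]⟩
        simp [hI, hJ, le_of_mem_chainSet hI, le_of_mem_chainSet hJ])
  choose H hH using h1
  obtain ⟨H', hH'⟩ := exists_eq_of_mem_chainSet fun i k I j l J => H i j (⟨k, I⟩, ⟨l, J⟩)
  refine ⟨H', fun i j => ?_⟩
  rw [hH, Finset.sum_product, Finset.sum_sigma]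
  refine Finset.sum_congr rfl fun k _ => Finset.sum_congr rfl fun I hI => ?_
  rw [Finset.sum_sigma]
  refine Finset.sum_congr rfl fun l _ => Finset.sum_congr rfl fun J hJ => ?_
  rw [rho_cls, hH' hI hJ]

theorem cls_neg_one_pow_mul {n : ℕ} (k : ℕ) (u : U n) (q : Rh n) :
    cls ((-1) ^ k * ofU u * ofR q) = rho ((-1) ^ k * q) (cls (ofU u)) := by
  have h1 : ofR ((-1) ^ k * q) = (-1) ^ k * ofR q := by
    rw [map_mul, map_pow, map_neg, map_one]
  rw [rho_cls, h1, ← mul_assoc, ((Commute.neg_one_left (ofU u)).pow_left k).eq]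

end

end OspGl

theorem mainTheorem4 (n : ℕ) :
    -- the elements `p B_j^±` and `p {B_i^±, B_j^±}` lie in `Z(osp(1|2n), gl(n))`
    (∀ (ε : Bool) (j : Fin n), pOf (B ε j) ∈ Z n) ∧
    (∀ (ε : Bool) (i j : Fin n), i ≤ j → pOf (acomm (B ε i) (B ε j)) ∈ Z n) ∧
    -- the formula for `p B_j^+`
    (∀ j : Fin n, pOf (B true j) =
      ∑ i ∈ Finset.Iic j, ∑ s ∈ Finset.Icc 1 ((j : ℕ) - (i : ℕ) + 1), ∑ I ∈ chains i j s,
        cls ((-1) ^ (s - 1) * ofU (Epow (eMat I) * B true i) *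
          ofR ((∏ l ∈ Finset.Icc i j \ I, (h l - h j - 1)) /
            ∏ l ∈ Finset.Ico i j, (h l - h j)))) ∧
    -- the formula for `p B_j^-`
    (∀ j : Fin n, pOf (B false j) =
      ∑ i ∈ Finset.Ici j, ∑ s ∈ Finset.Icc 1 ((i : ℕ) - (j : ℕ) + 1), ∑ I ∈ chains j i s,
        cls (ofU (Epow (eMat I) * B false i) *
          ofR (1 / ∏ l ∈ I.erase j, (h j - h l)))) ∧
    -- the expansions of `p {B_i^+, B_j^+}` and `p {B_i^-, B_j^-}`
    (∃ Hp : Finset (Fin n) → Finset (Fin n) → Rh n, ∀ i j : Fin n, i ≤ j →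
      pOf (acomm (B true i) (B true j)) =
        ∑ k ∈ Finset.Iic i, ∑ s ∈ Finset.Icc 1 ((i : ℕ) - (k : ℕ) + 1), ∑ I ∈ chains k i s,
        ∑ l ∈ Finset.Iic j, ∑ t ∈ Finset.Icc 1 ((j : ℕ) - (l : ℕ) + 1), ∑ J ∈ chains l j t,
          cls (ofU (Epow (eMat I + eMat J) * acomm (B true k) (B true l)) * ofR (Hp I J))) ∧
    (∃ Hm : Finset (Fin n) → Finset (Fin n) → Rh n, ∀ i j : Fin n, i ≤ j →
      pOf (acomm (B false i) (B false j)) =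
        ∑ k ∈ Finset.Ici i, ∑ s ∈ Finset.Icc 1 ((k : ℕ) - (i : ℕ) + 1), ∑ I ∈ chains i k s,
        ∑ l ∈ Finset.Ici j, ∑ t ∈ Finset.Icc 1 ((l : ℕ) - (j : ℕ) + 1), ∑ J ∈ chains j l t,
          cls (ofU (Epow (eMat I + eMat J) * acomm (B false k) (B false l)) * ofR (Hm I J))) := by
  refine ⟨fun ε j => pOf_mem_Z _, fun ε i j _ => pOf_mem_Z _, fun j => ?_, fun j => ?_, ?_, ?_⟩
  · rw [pOf_B_pos]
    refine Finset.sum_congr rfl fun i _ => ?_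
    rw [sum_chains]
    exact Finset.sum_congr rfl fun I _ => (cls_neg_one_pow_mul _ _ _).symm
  · rw [pOf_B_neg]
    refine Finset.sum_congr rfl fun i _ => ?_
    rw [sum_chains]
    refine Finset.sum_congr rfl fun I _ => ?_
    rw [rho_cls, one_div, Finset.prod_inv_distrib]
  · obtain ⟨H, hH⟩ := exists_pOf_acomm_pos (n := n)
    refine ⟨H, fun i j _ => ?_⟩
    simp only [hH, sum_chains]
  · obtain ⟨H, hH⟩ := exists_pOf_acomm_neg (n := n)
    refine ⟨H, fun i j _ => ?_⟩
    simp only [hH, sum_chains]
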